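/- Let $M$ be a smooth compact manifold without boundary, of dimension $n$, and let $(\varphi^t)_{t\in\mathbb R}$ be the smooth flow of a vector field $V$ on $M$. Suppose that $\varphi^t$ is Morse--Smale: its non-wandering set is a finite union of hyperbolic fixed points and hyperbolic closed orbits, and the unstable and stable manifolds $W^u(\Lambda_1)$, $W^s(\Lambda_2)$ of any two of them intersect transversally. Let $\Lambda$ be a fixed point at which the flow is $\mathcal C^\infty$-diagonalizable, i.e. in some smooth chart centred at $\Lambda$ one has $V=Aq\cdot\partial_q$ with a real matrix $A$ diagonalizable over $\mathbb C$. Then there are smooth local coordinates $(x,y)$ centred at $\Lambda$ in which $V$ is a linear vector field with block-diagonal matrix whose blocks are of one of four types: $(\chi_j)$ with $\chi_j<0$ ($j\in L_s$, real coordinate $x_j$); $\begin{pmatrix}\chi_j&\omega_j\\-\omega_j&\chi_j\end{pmatrix}$ with $\chi_j<0$, $\omega_j\neq0$ ($j\in P_s$, coordinates $(x_{j1},x_{j2})$); $(\chi_j)$ with $\chi_j>0$ ($j\in L_u$, real coordinate $y_j$); $\begin{pmatrix}\chi_j&\omega_j\\-\omega_j&\chi_j\end{pmatrix}$ with $\chi_j>0$,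 $\omega_j\ne0$ ($j\in P_u$, coordinates $(y_{j1},y_{j2})$). Write $w_j=y_{j1}+iy_{j2}$, $\partial_{z_j}=\partial_{x_{j1}}+i\partial_{x_{j2}}$ and $\partial_{\bar z_j}=\partial_{x_{j1}}-i\partial_{x_{j2}}$. For a multi-index $\alpha=(\alpha_x,\alpha_y)$ with entries in $\mathbb N$, consisting of one exponent $\alpha_j$ for each $j\in L_s\cup L_u$ and two exponents $\alpha_j,\bar\alpha_j$ for each $j\in P_s\cup P_u$, put $$u_\alpha^\Lambda=\delta_0^{(\alpha_x)}(x)\,y^{\alpha_y}:=\Big(\prod_{j\in L_s}\partial_{x_j}^{\alpha_j}\prod_{j\in P_s}\partial_{z_j}^{\alpha_j}\partial_{\bar z_j}^{\bar\alpha_j}\Big)\delta_0(x)\cdot\prod_{j\in L_u}y_j^{\alpha_j}\prod_{j\in P_u}w_j^{\alpha_j}\bar w_j^{\bar\alpha_j},$$ $$\lambda_\alpha^\Lambda=-\sum_{j\in L_s}|\chi_j|-2\sum_{j\in P_s}|\chi_j|+\sum_{j\in L_s}\alpha_j\chi_j+\sum_{j\in P_s}\big(\alpha_j(\chi_j+i\omega_j)+\bar\alpha_j(\chi_j-i\omega_j)\big)-\sum_{j\in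 L_u}\alpha_j\chi_j-\sum_{j\in P_u}\big(\alpha_j(\chi_j-i\omega_j)+\bar\alpha_j(\chi_j+i\omega_j)\big).$$ Let $(x,y)$ be any such coordinates, let $U$ be an open neighbourhood of $\Lambda$ in their domain, and let $u$ be a complex distribution on $U$ (extending functions, so that $\langle \mathcal L_Vu,\psi\rangle=-\langle u,\operatorname{div}(\psi V)\rangle$ in the coordinates) which does not vanish in any neighbourhood of $\Lambda$. Suppose that $(\mathcal L_V+\lambda)^pu=0$ on $U$ for some $\lambda\in\mathbb C$ and some integer $p\ge1$, that $\operatorname{supp}(u)\cap U\subset W^u(\Lambda)$, and that $\mathrm{WF}(u)\subset N^*(W^u(\Lambda))$ over $U$. Then $\lambda=\lambda_\alpha^\Lambda$ for some $\alpha$. Moreover, on some neighbourhood of $\Lambda$, $u$ is a finite linear combination $$u=\sum_{\alpha:\lambda_\alpha^\Lambda=\lambda}c_\alpha u_\alpha^\Lambda,\qquad c_\alpha\in\mathbb C,$$ and $(\mathcal L_V+\lambda)u=0$. -/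

import Mathlib

open Set Filter Topology MeasureTheory TopologicalSpace
open scoped Manifold ContDiff Distributions CompactConvergenceCLM LineDeriv

noncomputable section

/-! ### Smooth flows, invariant manifolds, Morse-Smale flows -/

section Dynamics

variable {n : ℕ} {M : Type*} [TopologicalSpace M] [ChartedSpace (EuclideanSpace ℝ (Fin n)) M]

/-- `φ` is a smooth flow on `M`, and it is generated by the vector field `V`. -/
structure IsSmoothFlowOf (φ : Flow ℝ M) (V : (x : M) → TangentSpace (𝓡 n) x) : Prop where
  smooth : ContMDiff (𝓘(ℝ, ℝ).prod (𝓡 n)) (𝓡 n) ∞ (fun q : ℝ × M => φ q.1 q.2)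
  generator : ∀ x : M, IsMIntegralCurve (fun t => φ t x) V

/-- `p` is a fixed (critical) point of the flow. -/
def IsFixedPointOf (φ : Flow ℝ M) (p : M) : Prop := ∀ t : ℝ, φ t p = p

/-- An elementary critical element: a fixed point or a closed orbit, i.e. the orbit of a point
which is periodic for some positive time. -/
def IsCriticalElement (φ : Flow ℝ M) (Λ : Set M) : Prop :=
  ∃ p : M, (∃ T : ℝ, 0 < T ∧ φ T p = p) ∧ Λ = φ.orbit p

/-- Complex eigenvalues of modulus one, with algebraic multiplicity, of the differential of `φ T`
at `p`. It is used only when `φ T p = p`, so that this differential is an endomorphism of the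
tangent space at `p` (all tangent spaces are modelled on `EuclideanSpace ℝ (Fin n)`, the one at
`p` through the preferred chart at `p`). -/
def unitModulusEigenvalues (φ : Flow ℝ M) (T : ℝ) (p : M) : Multiset ℂ :=
  let D : EuclideanSpace ℝ (Fin n) →L[ℝ] EuclideanSpace ℝ (Fin n) :=
    mfderiv (𝓡 n) (𝓡 n) (φ T) p
  ((D.toLinearMap.charpoly.map (algebraMap ℝ ℂ)).roots).filter (fun z => ‖z‖ = 1)

/-- Hyperbolicity of a critical element: at a fixed point no eigenvalue of the differential of the
time `T` maps, `T > 0`, lies on the unit circle; at a point of a closed orbit the only eigenvalue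
on the unit circle of the return differential is the simple eigenvalue `1` of the direction of the
flow. -/
def IsHyperbolicElement (n : ℕ) {M : Type*} [TopologicalSpace M]
    [ChartedSpace (EuclideanSpace ℝ (Fin n)) M] (φ : Flow ℝ M) (Λ : Set M) : Prop :=
  ∀ p ∈ Λ, ∀ T : ℝ, 0 < T → φ T p = p →
    (IsFixedPointOf φ p → unitModulusEigenvalues (n := n) φ T p = 0) ∧
    (¬ IsFixedPointOf φ p → unitModulusEigenvalues (n := n) φ T p = {1})

/-- The non-wandering set. -/
def nonWanderingSet (φ : Flow ℝ M) : Set M :=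
  {x | ∀ U ∈ 𝓝 x, ∀ T : ℝ, ∃ t : ℝ, T ≤ t ∧ (φ t '' U ∩ U).Nonempty}

/-- The unstable manifold: points whose orbit converges to `Λ` in the past. -/
def unstableManifold (φ : Flow ℝ M) (Λ : Set M) : Set M :=
  {x | Tendsto (fun t => φ t x) atBot (𝓝ˢ Λ)}

/-- The stable manifold: points whose orbit converges to `Λ` in the future. -/
def stableManifold (φ : Flow ℝ M) (Λ : Set M) : Set M :=
  {x | Tendsto (fun t => φ t x) atTop (𝓝ˢ Λ)}

/-- Velocities at `x` of the `C¹` curves through `x` whose points converge to `Λ`, uniformly along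
the curve, as time tends to infinity in the direction given by `l`. The uniformity says that the
curve moves in the (immersed) invariant manifold continuously for the topology of that manifold. -/
def asymptoticTangent (φ : Flow ℝ M) (l : Filter ℝ) (Λ : Set M) (x : M) :
    Set (TangentSpace (𝓡 n) x) :=
  {v | ∃ γ : ℝ → M, ContMDiffAt 𝓘(ℝ, ℝ) (𝓡 n) 1 γ 0 ∧
    (⟨γ 0, mfderiv 𝓘(ℝ, ℝ) (𝓡 n) γ 0 (1 : ℝ)⟩ : TangentBundle (𝓡 n) M) = ⟨x, v⟩ ∧
    ∃ ε : ℝ, 0 < ε ∧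
      Tendsto (fun q : ℝ × ℝ => φ q.1 (γ q.2)) (l ×ˢ 𝓟 (Ioo (-ε) ε)) (𝓝ˢ Λ)}

/-- Tangent space at `x` of the unstable manifold of `Λ`. -/
def unstableTangent (φ : Flow ℝ M) (Λ : Set M) (x : M) : Set (TangentSpace (𝓡 n) x) :=
  asymptoticTangent φ atBot Λ x

/-- Tangent space at `x` of the stable manifold of `Λ`. -/
def stableTangent (φ : Flow ℝ M) (Λ : Set M) (x : M) : Set (TangentSpace (𝓡 n) x) :=
  asymptoticTangent φ atTop Λ x

/-- Morse-Smale flows: the non-wandering set is a finite union of hyperbolic critical elements,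
whose unstable and stable manifolds intersect transversally. -/
def IsMorseSmale (n : ℕ) {M : Type*} [TopologicalSpace M]
    [ChartedSpace (EuclideanSpace ℝ (Fin n)) M] (φ : Flow ℝ M) : Prop :=
  ∃ C : Set (Set M), C.Finite ∧
    (∀ Λ ∈ C, IsCriticalElement φ Λ ∧ IsHyperbolicElement n φ Λ) ∧
    nonWanderingSet φ = ⋃₀ C ∧
    ∀ Λ₁ ∈ C, ∀ Λ₂ ∈ C, ∀ x ∈ unstableManifold φ Λ₁ ∩ stableManifold φ Λ₂,
      ∀ w : TangentSpace (𝓡 n) x,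
        ∃ v₁ ∈ unstableTangent φ Λ₁ x, ∃ v₂ ∈ stableTangent φ Λ₂ x, w = v₁ + v₂

end Dynamics

/-! ### Linearizing coordinates at a fixed point -/

section Charts

variable {n : ℕ} {M : Type*} [TopologicalSpace M] [ChartedSpace (EuclideanSpace ℝ (Fin n)) M]
  {E : Type*} [NormedAddCommGroup E] [NormedSpace ℝ E]

/-- `h` is a smooth diffeomorphism from a neighbourhood of `0` in `E` onto a neighbourhood of `p`
in `M`, which maps `0` to `p` and the linear vector field `q ↦ A q` to `V`. -/
structure IsLinearizingChart (V : (x : M) → TangentSpace (𝓡 n) x) (p : M) (A : E →L[ℝ] E)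
    (h : OpenPartialHomeomorph E M) : Prop where
  zero_mem : (0 : E) ∈ h.source
  map_zero : h 0 = p
  smooth : ContMDiffOn 𝓘(ℝ, E) (𝓡 n) ∞ h h.source
  smooth_symm : ContMDiffOn (𝓡 n) 𝓘(ℝ, E) ∞ h.symm h.target
  conj : ∀ q ∈ h.source, V (h q) = mfderiv 𝓘(ℝ, E) (𝓡 n) h q (A q)

/-- A real square matrix which is diagonalizable over the complex numbers. -/
def IsComplexDiagonalizable (A : Matrix (Fin n) (Fin n) ℝ) : Prop :=
  ∃ (P : Matrix (Fin n) (Fin n) ℂ) (D : Fin n → ℂ),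
    IsUnit P.det ∧ A.map (algebraMap ℝ ℂ) * P = P * Matrix.diagonal D

/-- The flow generated by `V` is smoothly diagonalizable at the fixed point `p`. -/
def IsSmoothlyDiagonalizableAt (V : (x : M) → TangentSpace (𝓡 n) x) (p : M) : Prop :=
  ∃ (A : Matrix (Fin n) (Fin n) ℝ) (h : OpenPartialHomeomorph (EuclideanSpace ℝ (Fin n)) M),
    IsComplexDiagonalizable A ∧
    IsLinearizingChart V p (Matrix.toEuclideanLin A).toContinuousLinearMap h

end Charts

/-- The numerical data of a block-diagonal hyperbolic real matrix: `a` stable real lines (the index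
set `L_s`), `b` stable real planes (`P_s`), `c` unstable real lines (`L_u`) and `d` unstable real
planes (`P_u`). A line carries the block `(χ)`, a plane the block `!![χ, ω; -ω, χ]`. -/
structure HyperbolicBlocks where
  (a b c d : ℕ)
  (χLs : Fin a → ℝ)
  (χPs omPs : Fin b → ℝ)
  (χLu : Fin c → ℝ)
  (χPu omPu : Fin d → ℝ)
  χLs_neg : ∀ j, χLs j < 0
  χPs_neg : ∀ j, χPs j < 0
  omPs_ne : ∀ j, omPs j ≠ 0
  χLu_pos : ∀ j, 0 < χLu j
  χPu_pos : ∀ j, 0 < χPu j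
  omPu_ne : ∀ j, omPu j ≠ 0

namespace HyperbolicBlocks

variable (B : HyperbolicBlocks)

/-- The stable coordinates `x`; a plane is identified with `ℂ` by `z = x₁ + i x₂`. -/
abbrev X : Type := (Fin B.a → ℝ) × (Fin B.b → ℂ)

/-- The unstable coordinates `y`; a plane is identified with `ℂ` by `w = y₁ + i y₂`. -/
abbrev Y : Type := (Fin B.c → ℝ) × (Fin B.d → ℂ)

/-- The coordinate space. -/
abbrev Coord : Type := B.X × B.Y

/-- The block `!![χ, ω; -ω, χ]` in the coordinate `z = x₁ + i x₂`. -/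
def planeBlock (χ om : ℝ) : ℂ →L[ℝ] ℂ :=
  χ • (Complex.reCLM.smulRight (1 : ℂ)) + om • (Complex.imCLM.smulRight (1 : ℂ))
    + (-om) • (Complex.reCLM.smulRight Complex.I) + χ • (Complex.imCLM.smulRight Complex.I)

/-- The block-diagonal matrix, as a linear vector field on the coordinate space. -/
def linearField : B.Coord →L[ℝ] B.Coord :=
  ((ContinuousLinearMap.pi fun j => B.χLs j • ContinuousLinearMap.proj j).prodMap
    (ContinuousLinearMap.pi fun j =>
      (planeBlock (B.χPs j) (B.omPs j)).comp (ContinuousLinearMap.proj j))).prodMap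
  ((ContinuousLinearMap.pi fun j => B.χLu j • ContinuousLinearMap.proj j).prodMap
    (ContinuousLinearMap.pi fun j =>
      (planeBlock (B.χPu j) (B.omPu j)).comp (ContinuousLinearMap.proj j)))

/-- Multi-indices `α = (α_x, α_y)`; in a plane there is one exponent for the complex coordinate
and one for its conjugate. -/
structure MultiIndex where
  s : Fin B.a → ℕ
  z : Fin B.b → ℕ
  zbar : Fin B.b → ℕ
  u : Fin B.c → ℕ
  w : Fin B.d → ℕ
  wbar : Fin B.d → ℕ

variable {B} in
/-- The numbers `λ_α`. The eigenvalue of the matrix paired with an exponent is the one of the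
corresponding factor of the model distribution: `[∂_z, V] = (χ + i ω) ∂_z` for
`∂_z = ∂₁ + i ∂₂`, and `V w = (χ - i ω) w`. -/
def resonance (α : B.MultiIndex) : ℂ :=
  - (∑ j, ((|B.χLs j| : ℝ) : ℂ)) - 2 * (∑ j, ((|B.χPs j| : ℝ) : ℂ))
  + ((∑ j, (α.s j : ℂ) * (B.χLs j : ℂ))
    + ∑ j, ((α.z j : ℂ) * ((B.χPs j : ℂ) + Complex.I * (B.omPs j : ℂ))
        + (α.zbar j : ℂ) * ((B.χPs j : ℂ) - Complex.I * (B.omPs j : ℂ))))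
  - ((∑ j, (α.u j : ℂ) * (B.χLu j : ℂ))
    + ∑ j, ((α.w j : ℂ) * ((B.χPu j : ℂ) - Complex.I * (B.omPu j : ℂ))
        + (α.wbar j : ℂ) * ((B.χPu j : ℂ) + Complex.I * (B.omPu j : ℂ))))

/-- The set of the `λ_α`. -/
def resonanceSet : Set ℂ := Set.range (resonance (B := B))

end HyperbolicBlocks

/-- Adapted local coordinates `(x, y)` at the fixed point `p`: a linearizing chart in which `V` is
given by a block-diagonal hyperbolic matrix. -/
structure AdaptedChart {n : ℕ} {M : Type*} [TopologicalSpace M]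
    [ChartedSpace (EuclideanSpace ℝ (Fin n)) M]
    (V : (x : M) → TangentSpace (𝓡 n) x) (p : M) where
  B : HyperbolicBlocks
  h : OpenPartialHomeomorph B.Coord M
  linearizing : IsLinearizingChart V p B.linearField h

/-! ### Distributions on an open subset of a real vector space -/

section Distrib

variable {E : Type*} [NormedAddCommGroup E] [NormedSpace ℝ E] {Ω : Opens E}

/-- Multiplication of a real test function by a smooth vector-valued function `g`. -/
def testMul {F : Type*} [NormedAddCommGroup F] [NormedSpace ℝ F]
    (g : E → F) (hg : ContDiff ℝ ∞ g) : 𝓓(Ω, ℝ) →L[ℝ] 𝓓(Ω, F) :=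
  TestFunction.limitCLM ℝ
    (fun ψ => ⟨fun x => ψ x • g x, ψ.contDiff.smul hg, ψ.hasCompactSupport.smul_right,
      (tsupport_smul_subset_left _ _).trans ψ.tsupport_subset⟩)
    (fun _ hK => TestFunction.ofSupportedInCLM ℝ hK ∘L
      ContDiffMapSupportedIn.bilinLeftCLM (ContinuousLinearMap.lsmul ℝ ℝ) hg)
    (fun _ _ _ => by ext; simp)

@[simp]
theorem testMul_apply {F : Type*} [NormedAddCommGroup F] [NormedSpace ℝ F]
    (g : E → F) (hg : ContDiff ℝ ∞ g) (ψ : 𝓓(Ω, ℝ)) (x : E) :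
    testMul g hg ψ x = ψ x • g x := rfl

/-- The divergence (trace of the derivative) of a compactly supported smooth vector field. -/
def testDiv [FiniteDimensional ℝ E] : 𝓓(Ω, E) →L[ℝ] 𝓓(Ω, ℝ) :=
  (TestFunction.postcompCLM (𝕜 := ℝ)
    (LinearMap.toContinuousLinearMap
      ((LinearMap.trace ℝ E).comp (ContinuousLinearMap.coeLM ℝ)) : (E →L[ℝ] E) →L[ℝ] ℝ)).comp
  (TestFunction.fderivCLM ℝ ⊤ ⊤)

theorem testDiv_apply [FiniteDimensional ℝ E] (W : 𝓓(Ω, E)) (x : E) :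
    testDiv W x = LinearMap.trace ℝ E (fderiv ℝ W x : E →L[ℝ] E).toLinearMap := by
  simp [testDiv]

/-- The Lie derivative of a (function-like) distribution along a smooth vector field `W`:
`⟨L_W u, ψ⟩ = - ⟨u, div (ψ W)⟩`. -/
def lieDerivative [FiniteDimensional ℝ E] (W : E → E) (hW : ContDiff ℝ ∞ W)
    (u : Distribution Ω ℂ ⊤) : Distribution Ω ℂ ⊤ :=
  - ContinuousLinearMap.precompCompactConvergenceCLM ℂ (testDiv.comp (testMul W hW)) u

theorem lieDerivative_apply [FiniteDimensional ℝ E] (W : E → E) (hW : ContDiff ℝ ∞ W)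
    (u : Distribution Ω ℂ ⊤) (ψ : 𝓓(Ω, ℝ)) :
    lieDerivative W hW u ψ = - u (testDiv (testMul W hW ψ)) := rfl

/-- Fourier transform of `χ u` at the covector `η`: `⟨u, χ e^{-iη}⟩`. -/
def localizedFourier (u : Distribution Ω ℂ ⊤) (χ : 𝓓(Ω, ℝ)) (η : E →L[ℝ] ℝ) : ℂ :=
  u (testMul (fun q => Real.cos (η q)) (Real.contDiff_cos.comp η.contDiff) χ)
    - Complex.I * u (testMul (fun q => Real.sin (η q)) (Real.contDiff_sin.comp η.contDiff) χ)

/-- The wavefront set: `(q, ξ)`, with `ξ ≠ 0`, is outside of it if the Fourier transform of some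
localization `χ u` with `χ q ≠ 0` decays rapidly in a conic neighbourhood of `ξ`. -/
def wavefrontSet (u : Distribution Ω ℂ ⊤) : Set (E × (E →L[ℝ] ℝ)) :=
  {q | q.1 ∈ Ω ∧ q.2 ≠ 0 ∧
    ¬ ∃ χ : 𝓓(Ω, ℝ), χ q.1 ≠ 0 ∧ ∃ Γ ∈ 𝓝 q.2, ∀ N : ℕ, ∃ C : ℝ, ∀ η ∈ Γ, ∀ t : ℝ, 0 < t →
      (1 + ‖t • η‖) ^ N * ‖localizedFourier u χ (t • η)‖ ≤ C}

/-- The derivative `∂_v + i ∂_w` of a distribution. -/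
def complexDeriv (v w : E) (u : Distribution Ω ℂ ⊤) : Distribution Ω ℂ ⊤ :=
  ∂_{v} u + Complex.I • ∂_{w} u

end Distrib

/-! ### The model distributions -/

namespace HyperbolicBlocks

variable {B : HyperbolicBlocks}

/-- The monomial `y ^ α_y`. -/
def monomial (α : B.MultiIndex) (y : B.Y) : ℂ :=
  (∏ j, (y.1 j : ℂ) ^ α.u j) *
    ∏ j, (y.2 j) ^ α.w j * ((starRingEnd ℂ) (y.2 j)) ^ α.wbar j

theorem continuous_monomial (α : B.MultiIndex) : Continuous (monomial α) := by
  unfold monomial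
  have h1 : ∀ j, Continuous fun y : B.Y => ((y.1 j : ℝ) : ℂ) := fun j => by fun_prop
  have h2 : ∀ j, Continuous fun y : B.Y => (starRingEnd ℂ) (y.2 j) := fun j =>
    Complex.continuous_conj.comp (by fun_prop)
  exact (continuous_finsetProd _ fun j _ => (h1 j).pow _).mul
    (continuous_finsetProd _ fun j _ =>
      (((continuous_apply j).comp continuous_snd).pow _).mul ((h2 j).pow _))

/-- The distribution `δ_0(x) y ^ α_y`, that is `ψ ↦ ∫ y ^ α_y ψ(0, y) dy`. -/
def diracMonomial (Ω : Opens B.Coord) (α : B.MultiIndex) : Distribution Ω ℂ ⊤ :=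
  TestFunction.integralAgainstBilinCLM (ContinuousLinearMap.lsmul ℝ ℝ : ℝ →L[ℝ] ℂ →L[ℝ] ℂ)
    ((volume : Measure B.Y).map fun y => ((0, y) : B.Coord)) (fun q => monomial α q.2)

theorem diracMonomial_apply (Ω : Opens B.Coord) (α : B.MultiIndex) (ψ : 𝓓(Ω, ℝ)) :
    diracMonomial Ω α ψ = ∫ y : B.Y, (ψ (0, y) : ℂ) * monomial α y := by
  have hemb : IsClosedEmbedding (fun y : B.Y => ((0, y) : B.Coord)) :=
    Topology.IsClosedEmbedding.of_continuous_injective_isClosedMap (by fun_prop)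
      (fun y₁ y₂ h => congrArg Prod.snd h) (fun S hS => by
        have hSet : (fun y : B.Y => ((0, y) : B.Coord)) '' S = {(0 : B.X)} ×ˢ S := by
          ext q
          constructor
          · rintro ⟨y, hy, rfl⟩
            exact ⟨rfl, hy⟩
          · rintro ⟨h1, h2⟩
            exact ⟨q.2, h2, Prod.ext (by simpa using h1.symm) rfl⟩
        rw [hSet]
        exact isClosed_singleton.prod hS)
  have : IsFiniteMeasureOnCompacts
      ((volume : Measure B.Y).map fun y => ((0, y) : B.Coord)) := by
    refine ⟨fun K hK => ?_⟩
    rw [hemb.measurableEmbedding.map_apply]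
    exact (hemb.isCompact_preimage hK).measure_lt_top
  have hloc : LocallyIntegrableOn (fun q : B.Coord => monomial α q.2) Ω
      ((volume : Measure B.Y).map fun y => ((0, y) : B.Coord)) :=
    (((continuous_monomial α).comp continuous_snd).locallyIntegrable).locallyIntegrableOn _
  refine (TestFunction.integralAgainstBilinCLM_eq_integral hloc (f := ψ)).trans ?_
  rw [hemb.integral_map]
  simp

/-- Composition of a list of operators. -/
def composeFin {T : Type*} {k : ℕ} (D : Fin k → T → T) (t : T) : T :=
  (List.finRange k).foldr D t

/-- The model distribution `u_α = δ_0^{(α_x)}(x) y ^ α_y`. In a stable plane the derivatives are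
`∂_z = ∂₁ + i ∂₂` and `∂_zbar = ∂₁ - i ∂₂`. -/
def model (Ω : Opens B.Coord) (α : B.MultiIndex) : Distribution Ω ℂ ⊤ :=
  composeFin (fun j => (fun u => ∂_{(((Pi.single j 1, 0), 0) : B.Coord)} u)^[α.s j])
    (composeFin (fun j =>
        (complexDeriv (((0, Pi.single j 1), 0) : B.Coord)
            (((0, Pi.single j Complex.I), 0) : B.Coord))^[α.z j] ∘
          (complexDeriv (((0, Pi.single j 1), 0) : B.Coord)
            (((0, Pi.single j (-Complex.I)), 0) : B.Coord))^[α.zbar j])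
      (diracMonomial Ω α))

end HyperbolicBlocks

namespace AdaptedChart

variable {n : ℕ} {M : Type*} [TopologicalSpace M] [ChartedSpace (EuclideanSpace ℝ (Fin n)) M]
  {V : (x : M) → TangentSpace (𝓡 n) x} {p : M}

/-- The operator `L_V + μ` on distributions on an open subset of the coordinate space. -/
def lieShift (κ : AdaptedChart V p) (μ : ℂ) {Ω : Opens κ.B.Coord} (u : Distribution Ω ℂ ⊤) :
    Distribution Ω ℂ ⊤ :=
  lieDerivative κ.B.linearField κ.B.linearField.contDiff u + μ • u

/-- The conormal bundle, in the coordinates, of the unstable manifold of `p`. -/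
def unstableConormal (κ : AdaptedChart V p) (φ : Flow ℝ M) (Ω : Opens κ.B.Coord) :
    Set (κ.B.Coord × (κ.B.Coord →L[ℝ] ℝ)) :=
  {q | q.1 ∈ Ω ∧ κ.h q.1 ∈ unstableManifold φ {p} ∧
    ∀ v : κ.B.Coord,
      (mfderiv 𝓘(ℝ, κ.B.Coord) (𝓡 n) κ.h q.1 v : TangentSpace (𝓡 n) (κ.h q.1)) ∈
        unstableTangent φ {p} (κ.h q.1) → q.2 v = 0}

end AdaptedChart

end

/-!
In adapted coordinates the flow is linear, `Φ t (x, y) = (S t x, R t y)`, where `S` contracts and `R`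
expands. Let `u` satisfy `(L_A + μ) ^ m u = 0`.

*Test functions along the flow.* For a test function `f` transported as a density by the flow, the
pairings of `u`, `(L_A + μ) u`, …, with `transport A Φ f t` solve a triangular linear system in `t`,
so that `⟨u, transport A Φ f t⟩ = e ^ (μ t) P t` with a polynomial `P`
(`exists_polynomial_of_cascade`). As a first consequence the support of `u` is invariant under the
flow (`flow_neg_mem_dsupport`).

*Where `u` lives.* Near the fixed point `u` is supported in `{x = 0}`: otherwise the backward flow
moves points of the support to a limit `(x, 0)` with `x ≠ 0`, which is on the stable manifold, and
on the unstable one because `u` is supported there. At such a homoclinic point transversality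
would make the two tangent spaces complementary, although both contain the vector field
(`AdaptedChart.notMem_unstableManifold`, `AdaptedChart.exists_nhds_ev_eq_zero`). Since the tangent
space of the unstable manifold contains all directions `(0, y)`, the wavefront set over the fixed
point has no covector which depends on `y` alone (`AdaptedChart.notMem_wavefrontSet`).

*Finitely many moments determine `u`.* Let all `x`-derivatives of `f` of order less than `n` have
vanishing moments of order at most `K` along `{x = 0}`. By the Hadamard lemma
`f = f(0, y) + ∑ ζ_i g_i`, and after a time `t` each coordinate `ζ_i` contributes a factor
`O(e ^ (-ε t))`; after `n` such steps this beats the exponential bound which the finite order of `u`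
gives. The terms which are functions of `y` alone become `h (R t y)`; by Fourier inversion their
pairing with `u` only involves the Fourier transform of `u` along the covectors in `y`, which
decays rapidly, while the vanishing moments make the Fourier transform of `h` small at low
frequencies: the pairing is `O(e ^ (-ε (K + 1) t))` (`exists_ev_expansion_le`,
`SaddleFlow.exists_ev_flow_decay`). For large `n` and `K` this is incompatible with `e ^ (μ t) P t`,
unless `⟨u, f⟩ = 0` (`exists_ev_eq_zero_of_momentsVanish`).

*Expansion.* The moments are linear combinations of pairings with finitely many model
distributions, so that `u` is locally in their span. The model distributions are eigenvectors of
`L_A` (`HyperbolicBlocks.ev_model_divField`), and a generalized eigenvector in the span of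
eigenvectors is a combination of those with the same eigenvalue
(`HyperbolicBlocks.exists_model_expansion`).

*Adapted coordinates exist.* Real and imaginary parts of complex eigenvectors give real lines and
planes which span the space; adding them one by one, and dropping those already contained in the
span, yields a block-diagonal form (`IsComplexDiagonalizable.exists_blockField`). A block with a
zero or purely imaginary coefficient would give a periodic vector of the linear flow, hence an
eigenvalue `1` of the differential of some `φ T` at the fixed point, against hyperbolicity
(`IsLinearizingChart.re_ne_zero_of_blockField`).

Distributions are tested on complex-valued functions through `ev`, the complex-linear extension of
the pairing with real test functions, which is zero by convention outside `testSpace Ω`.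
-/


set_option maxSynthPendingDepth 3
set_option linter.unusedSectionVars false

noncomputable section

/-! ### Parametric integrals of smooth functions -/

section ParametricIntegral

variable {W : Type*} [NormedAddCommGroup W] [NormedSpace ℝ W]
  {E : Type*} [NormedAddCommGroup E] [NormedSpace ℝ E]
  {F : Type*} [NormedAddCommGroup F] [NormedSpace ℝ F]

theorem iteratedFDeriv_partial {Ψ : W → E → F} (hΨ : ContDiff ℝ ∞ (Function.uncurry Ψ))
    (k : ℕ) (w : W) (x : E) :
    iteratedFDeriv ℝ k (Ψ w) x =
      (iteratedFDeriv ℝ k (Function.uncurry Ψ) (w, x)).compContinuousLinearMap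
        fun _ => ContinuousLinearMap.inr ℝ W E := by
  have h1 : Ψ w = (fun q => Function.uncurry Ψ ((w, 0) + q)) ∘ (ContinuousLinearMap.inr ℝ W E) := by
    ext y; simp
  have h2 : ContDiff ℝ ∞ (fun q => Function.uncurry Ψ ((w, 0) + q)) :=
    hΨ.comp (contDiff_const.add contDiff_id)
  rw [h1, ContinuousLinearMap.iteratedFDeriv_comp_right _ h2 x (i := k) (mod_cast le_top),
    iteratedFDeriv_comp_add_left]
  simp

theorem continuous_iteratedFDeriv_partial {Ψ : W → E → F}
    (hΨ : ContDiff ℝ ∞ (Function.uncurry Ψ)) (k : ℕ) :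
    Continuous fun q : W × E => iteratedFDeriv ℝ k (Ψ q.1) q.2 := by
  simp_rw [iteratedFDeriv_partial hΨ]
  have h1 : Continuous fun q : W × E => iteratedFDeriv ℝ k (Function.uncurry Ψ) (q.1, q.2) :=
    hΨ.continuous_iteratedFDeriv (mod_cast le_top)
  exact (ContinuousMultilinearMap.compContinuousLinearMapL 
    (fun _ : Fin k => ContinuousLinearMap.inr ℝ W E)).continuous.comp h1

theorem contDiff_partial {Ψ : W → E → F} (hΨ : ContDiff ℝ ∞ (Function.uncurry Ψ)) (w : W) :
    ContDiff ℝ ∞ (Ψ w) :=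
  hΨ.comp (contDiff_const.prodMk contDiff_id)

variable [FiniteDimensional ℝ W] [MeasurableSpace W] [BorelSpace W]
  [FiniteDimensional ℝ F]

/-- Differentiation under the integral sign, for a smooth family all of whose derivatives are
locally uniformly dominated. -/
theorem hasFTaylorSeriesUpTo_integral {Ψ : W → E → F}
    (hΨ : ContDiff ℝ ∞ (Function.uncurry Ψ)) (ν : Measure W)
    (hb : ∀ (k : ℕ) (x₀ : E), ∃ ε > 0, ∃ b : W → ℝ, Integrable b ν ∧
      ∀ᵐ w ∂ν, ∀ x ∈ Metric.ball x₀ ε, ‖iteratedFDeriv ℝ k (Ψ w) x‖ ≤ b w) :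
    HasFTaylorSeriesUpTo ∞ (fun x => ∫ w, Ψ w x ∂ν)
      (fun x k => ∫ w, iteratedFDeriv ℝ k (Ψ w) x ∂ν) := by
  have hmeas : ∀ (k : ℕ) (x : E), AEStronglyMeasurable (fun w => iteratedFDeriv ℝ k (Ψ w) x) ν := by
    intro k x
    have : Continuous fun w => iteratedFDeriv ℝ k (Ψ w) x :=
      (continuous_iteratedFDeriv_partial hΨ k).comp (continuous_id.prodMk continuous_const)
    exact this.aestronglyMeasurable
  have hint : ∀ (k : ℕ) (x : E), Integrable (fun w => iteratedFDeriv ℝ k (Ψ w) x) ν := by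
    intro k x
    obtain ⟨ε, hε, b, hbi, hbb⟩ := hb k x
    refine hbi.mono' (hmeas k x) ?_
    filter_upwards [hbb] with w hw using hw x (Metric.mem_ball_self hε)
  have hderiv : ∀ (k : ℕ) (x : E), HasFDerivAt (fun y => ∫ w, iteratedFDeriv ℝ k (Ψ w) y ∂ν)
      (∫ w, iteratedFDeriv ℝ (k + 1) (Ψ w) x ∂ν).curryLeft x := by
    intro k x
    obtain ⟨ε, hε, b, hbi, hbb⟩ := hb (k + 1) x
    have hF : ∀ w y, HasFDerivAt (fun y => iteratedFDeriv ℝ k (Ψ w) y)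
        (iteratedFDeriv ℝ (k + 1) (Ψ w) y).curryLeft y := by
      intro w y
      have hd := ((contDiff_partial hΨ w).differentiable_iteratedFDeriv (m := k)
        (by exact_mod_cast ENat.natCast_lt_top k)) y
      have := hd.hasFDerivAt
      rwa [fderiv_iteratedFDeriv] at this
    have hc : (∫ w, iteratedFDeriv ℝ (k + 1) (Ψ w) x ∂ν).curryLeft =
        ∫ w, (iteratedFDeriv ℝ (k + 1) (Ψ w) x).curryLeft ∂ν := by
      let J : (E [×(k + 1)]→L[ℝ] F) →L[ℝ] (E →L[ℝ] (E [×k]→L[ℝ] F)) :=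
        (continuousMultilinearCurryLeftEquiv ℝ
          (fun _ : Fin (k+1) => E) F).toContinuousLinearEquiv.toContinuousLinearMap
      exact (J.integral_comp_comm (hint (k + 1) x)).symm
    rw [hc]
    refine hasFDerivAt_integral_of_dominated_of_fderiv_le (bound := b)
      (F' := fun y w => (iteratedFDeriv ℝ (k + 1) (Ψ w) y).curryLeft)
      (Metric.ball_mem_nhds x hε) (Eventually.of_forall fun y => hmeas k y)
      (hint k x) ?_ ?_ hbi (Eventually.of_forall fun w y _ => hF w y)
    · exact (continuousMultilinearCurryLeftEquiv ℝ (fun _ : Fin (k+1) => E) F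
        ).continuous.comp_aestronglyMeasurable (hmeas (k + 1) x)
    · filter_upwards [hbb] with w hw y hy
      have := hw y hy
      rwa [← (continuousMultilinearCurryLeftEquiv ℝ (fun _ : Fin (k+1) => E) F
        ).norm_map] at this
  refine ⟨fun x => ?_, fun m _ x => hderiv m x, fun m _ => ?_⟩
  · have h0 := (continuousMultilinearCurryFin0 ℝ E F).toContinuousLinearEquiv.toContinuousLinearMap
      |>.integral_comp_comm (hint 0 x)
    have h1 : (∫ w, iteratedFDeriv ℝ 0 (Ψ w) x ∂ν).curry0 =
        continuousMultilinearCurryFin0 ℝ E F (∫ w, iteratedFDeriv ℝ 0 (Ψ w) x ∂ν) := rfl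
    rw [h1]
    exact h0.symm
  · exact continuous_iff_continuousAt.2 fun x => (hderiv m x).continuousAt

theorem contDiff_integral_of_dominated {Ψ : W → E → F}
    (hΨ : ContDiff ℝ ∞ (Function.uncurry Ψ)) (ν : Measure W)
    (hb : ∀ (k : ℕ) (x₀ : E), ∃ ε > 0, ∃ b : W → ℝ, Integrable b ν ∧
      ∀ᵐ w ∂ν, ∀ x ∈ Metric.ball x₀ ε, ‖iteratedFDeriv ℝ k (Ψ w) x‖ ≤ b w) :
    ContDiff ℝ ∞ (fun x => ∫ w, Ψ w x ∂ν) :=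
  (hasFTaylorSeriesUpTo_integral hΨ ν hb).contDiff

theorem iteratedFDeriv_integral_of_dominated {Ψ : W → E → F}
    (hΨ : ContDiff ℝ ∞ (Function.uncurry Ψ)) (ν : Measure W)
    (hb : ∀ (k : ℕ) (x₀ : E), ∃ ε > 0, ∃ b : W → ℝ, Integrable b ν ∧
      ∀ᵐ w ∂ν, ∀ x ∈ Metric.ball x₀ ε, ‖iteratedFDeriv ℝ k (Ψ w) x‖ ≤ b w) (k : ℕ) (x : E) :
    iteratedFDeriv ℝ k (fun x => ∫ w, Ψ w x ∂ν) x = ∫ w, iteratedFDeriv ℝ k (Ψ w) x ∂ν :=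
  ((hasFTaylorSeriesUpTo_integral hΨ ν hb).eq_iteratedFDeriv (mod_cast le_top) x).symm

end ParametricIntegral

/-! ### Distributions tested against complex functions -/

section ComplexTest

variable {E : Type*} [NormedAddCommGroup E] [NormedSpace ℝ E]

/-- Complex-valued smooth functions with compact support contained in `S`. Unlike `𝓓(Ω, ℂ)`, this
is a subspace of the space of all functions, and `S` need not be open. -/
def testSpace (S : Set E) : Submodule ℂ (E → ℂ) where
  carrier := {f | ContDiff ℝ ∞ f ∧ HasCompactSupport f ∧ tsupport f ⊆ S}
  add_mem' := by
    rintro f g ⟨hf, hf', hf''⟩ ⟨hg, hg', hg''⟩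
    exact ⟨hf.add hg, hf'.add hg', (tsupport_add f g).trans (union_subset hf'' hg'')⟩
  zero_mem' := ⟨contDiff_const, HasCompactSupport.zero, by simp [tsupport]⟩
  smul_mem' := by
    rintro c f ⟨hf, hf', hf''⟩
    have hs : tsupport (c • f) ⊆ tsupport f := closure_mono (Function.support_const_smul_subset c f)
    exact ⟨contDiff_const.smul hf, hf'.mono' ((subset_tsupport _).trans hs), hs.trans hf''⟩

theorem testSpace_mono {S T : Set E} (h : S ⊆ T) : testSpace S ≤ testSpace T :=
  fun _ hf => ⟨hf.1, hf.2.1, hf.2.2.trans h⟩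

theorem mem_testSpace_of_isCompact {K : Set E} (hK : IsCompact K) {f : E → ℂ}
    (hf : ContDiff ℝ ∞ f) (h0 : ∀ x ∉ K, f x = 0) : f ∈ testSpace K := by
  have h : Function.support f ⊆ K := fun x hx => by
    by_contra hxK
    exact hx (h0 x hxK)
  exact ⟨hf, HasCompactSupport.of_support_subset_isCompact hK h,
    closure_minimal h hK.isClosed⟩

theorem mul_mem_testSpace {S : Set E} {f g : E → ℂ} (hf : f ∈ testSpace S)
    (hg : ContDiff ℝ ∞ g) : (fun x => f x * g x) ∈ testSpace S :=
  ⟨hf.1.mul hg, hf.2.1.mul_right, (tsupport_mul_subset_left (f := f) (g := g)).trans hf.2.2⟩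

theorem fderiv_apply_mem_testSpace {S : Set E} {f : E → ℂ} (hf : f ∈ testSpace S)
    {W : E → E} (hW : ContDiff ℝ ∞ W) : (fun x => fderiv ℝ f x (W x)) ∈ testSpace S := by
  have h1 : Function.support (fun x => fderiv ℝ f x (W x)) ⊆ tsupport f := by
    intro x hx
    by_contra hxs
    have : fderiv ℝ f x = 0 := by
      have := support_fderiv_subset ℝ (f := f)
      by_contra h
      exact hxs (this h)
    simp [this] at hx
  refine ⟨(hf.1.fderiv_right (m := ∞) (by simp)).clm_apply hW, hf.2.1.mono' h1, ?_⟩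
  exact (closure_minimal h1 (isClosed_tsupport f)).trans hf.2.2

variable {Ω : Opens E}

/-- The real part of a complex test function. -/
def reTest (f : testSpace (Ω : Set E)) : 𝓓(Ω, ℝ) :=
  ⟨fun x => (f.1 x).re, Complex.reCLM.contDiff.comp f.2.1, f.2.2.1.comp_left Complex.zero_re,
    (tsupport_comp_subset Complex.zero_re f.1).trans f.2.2.2⟩

/-- The imaginary part of a complex test function. -/
def imTest (f : testSpace (Ω : Set E)) : 𝓓(Ω, ℝ) :=
  ⟨fun x => (f.1 x).im, Complex.imCLM.contDiff.comp f.2.1, f.2.2.1.comp_left Complex.zero_im,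
    (tsupport_comp_subset Complex.zero_im f.1).trans f.2.2.2⟩

/-- The `ℂ`-linear extension of a distribution to complex test functions. -/
def complexExt (u : Distribution Ω ℂ ⊤) : testSpace (Ω : Set E) →ₗ[ℂ] ℂ where
  toFun f := u (reTest f) + Complex.I * u (imTest f)
  map_add' f g := by
    have h1 : reTest (f + g) = reTest f + reTest g := by ext x; rfl
    have h2 : imTest (f + g) = imTest f + imTest g := by ext x; rfl
    rw [h1, h2, map_add, map_add]; ring
  map_smul' c f := by
    have h1 : reTest (c • f) = c.re • reTest f - c.im • imTest f := by
      ext x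
      exact Complex.mul_re c (f.1 x)
    have h2 : imTest (c • f) = c.re • imTest f + c.im • reTest f := by
      ext x
      exact Complex.mul_im c (f.1 x)
    rw [h1, h2, map_add, map_sub, map_smul, map_smul, map_smul, map_smul]
    simp only [Complex.real_smul, RingHom.id_apply, smul_eq_mul]
    have hc : c = c.re + c.im * Complex.I := (Complex.re_add_im c).symm
    conv_rhs => rw [hc]
    linear_combination (-c.im * u (imTest f)) * Complex.I_mul_I

open Classical in
/-- The value of a distribution at a complex function, set to `0` if the function is not a test
function on the domain. -/
def ev (u : Distribution Ω ℂ ⊤) (f : E → ℂ) : ℂ :=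
  if h : f ∈ testSpace (Ω : Set E) then complexExt u ⟨f, h⟩ else 0

theorem ev_of_mem (u : Distribution Ω ℂ ⊤) {f : E → ℂ} (h : f ∈ testSpace (Ω : Set E)) :
    ev u f = complexExt u ⟨f, h⟩ := dif_pos h

theorem ev_add (u : Distribution Ω ℂ ⊤) {f g : E → ℂ} (hf : f ∈ testSpace (Ω : Set E))
    (hg : g ∈ testSpace (Ω : Set E)) : ev u (f + g) = ev u f + ev u g := by
  rw [ev_of_mem u hf, ev_of_mem u hg, ev_of_mem u (add_mem hf hg), ← map_add]
  rfl

theorem ev_smul (u : Distribution Ω ℂ ⊤) (c : ℂ) {f : E → ℂ} (hf : f ∈ testSpace (Ω : Set E)) :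
    ev u (c • f) = c * ev u f := by
  rw [ev_of_mem u hf, ev_of_mem u (Submodule.smul_mem _ c hf), ← smul_eq_mul, ← map_smul]
  rfl

@[simp]
theorem ev_zero (u : Distribution Ω ℂ ⊤) : ev u (0 : E → ℂ) = 0 := by
  rw [ev_of_mem u (zero_mem _)]
  exact map_zero _

theorem ev_sum (u : Distribution Ω ℂ ⊤) {ι : Type*} (s : Finset ι) {f : ι → E → ℂ}
    (hf : ∀ i ∈ s, f i ∈ testSpace (Ω : Set E)) : ev u (∑ i ∈ s, f i) = ∑ i ∈ s, ev u (f i) := by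
  classical
  induction s using Finset.induction_on with
  | empty => simp
  | insert i s hi ih =>
    rw [Finset.sum_insert hi, Finset.sum_insert hi, ev_add, ih]
    · exact fun j hj => hf j (Finset.mem_insert_of_mem hj)
    · exact hf i (Finset.mem_insert_self _ _)
    · exact sum_mem fun j hj => hf j (Finset.mem_insert_of_mem hj)

theorem ofReal_comp_mem_testSpace (ψ : 𝓓(Ω, ℝ)) {S : Set E} (hS : tsupport ψ ⊆ S) :
    (fun x => (ψ x : ℂ)) ∈ testSpace S := by
  refine ⟨Complex.ofRealCLM.contDiff.comp ψ.contDiff,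
    ψ.hasCompactSupport.comp_left Complex.ofReal_zero, ?_⟩
  exact (tsupport_comp_subset Complex.ofReal_zero ψ).trans hS

theorem ev_ofReal (u : Distribution Ω ℂ ⊤) (ψ : 𝓓(Ω, ℝ)) : ev u (fun x => (ψ x : ℂ)) = u ψ := by
  have h := ofReal_comp_mem_testSpace ψ ψ.tsupport_subset
  rw [ev_of_mem u h]
  have h1 : reTest ⟨_, h⟩ = ψ := by ext x; rfl
  have h2 : imTest ⟨_, h⟩ = (0 : 𝓓(Ω, ℝ)) := by ext x; rfl
  change u (reTest ⟨_, h⟩) + Complex.I * u (imTest ⟨_, h⟩) = u ψ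
  rw [h1, h2, map_zero, mul_zero, add_zero]

theorem ev_eq_zero_of_forall_re_im (u : Distribution Ω ℂ ⊤) {f : E → ℂ}
    (h : ∀ ψ : 𝓓(Ω, ℝ), tsupport ψ ⊆ tsupport f → u ψ = 0) : ev u f = 0 := by
  by_cases hf : f ∈ testSpace (Ω : Set E)
  · rw [ev_of_mem u hf]
    change u (reTest ⟨f, hf⟩) + Complex.I * u (imTest ⟨f, hf⟩) = 0
    rw [h _ (tsupport_comp_subset Complex.zero_re f), h _ (tsupport_comp_subset Complex.zero_im f)]
    simp
  · exact dif_neg hf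

/-! ### The order of a distribution on a compact set -/

/-- The jet of order `N` of a smooth function along a compact set, as an element of a Banach
space. -/
def jet {F : Type*} [NormedAddCommGroup F] [NormedSpace ℝ F] (K : Set E) (N : ℕ) (f : E → F)
    (hf : ContDiff ℝ ∞ f) :
    (k : Fin (N + 1)) → C(K, E [×(k : ℕ)]→L[ℝ] F) :=
  fun k => ⟨fun x => iteratedFDeriv ℝ k f x,
    (hf.continuous_iteratedFDeriv (mod_cast le_top)).comp continuous_subtype_val⟩

/-- The jet, as a linear map on the test functions supported in `K`. -/
def jetLM (K : Set E) (N : ℕ) :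
    testSpace K →ₗ[ℂ] ((k : Fin (N + 1)) → C(K, E [×(k : ℕ)]→L[ℝ] ℂ)) where
  toFun f := jet K N f.1 f.2.1
  map_add' f g := by
    ext k x : 2
    exact iteratedFDeriv_add_apply (f.2.1.contDiffAt.of_le (mod_cast le_top))
      (g.2.1.contDiffAt.of_le (mod_cast le_top))
  map_smul' c f := by
    ext k x : 2
    exact iteratedFDeriv_const_smul_apply (f.2.1.contDiffAt.of_le (mod_cast le_top))

theorem jetLM_injective (K : Set E) (N : ℕ) : Function.Injective (jetLM K N) := by
  rw [← LinearMap.ker_eq_bot, LinearMap.ker_eq_bot']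
  intro f hf
  ext x
  by_cases hx : x ∈ K
  · have h1 : iteratedFDeriv ℝ 0 f.1 x = 0 := by
      have := congrArg (fun J => J 0 ⟨x, hx⟩) hf
      exact this
    have := congrArg (fun m => m 0) h1
    simpa using this
  · exact image_eq_zero_of_notMem_tsupport fun h => hx (f.2.2.2 h)

theorem exists_order_bound (u : Distribution Ω ℂ ⊤) {K : Set E} (hK : IsCompact K)
    (hKΩ : K ⊆ Ω) : ∃ (N : ℕ) (C : ℝ), 0 ≤ C ∧ ∀ f ∈ testSpace K, ∀ M : ℝ, 0 ≤ M →
      (∀ k ≤ N, ∀ x ∈ K, ‖iteratedFDeriv ℝ k f x‖ ≤ M) → ‖ev u f‖ ≤ C * M := by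
  let Kc : Compacts E := ⟨K, hK⟩
  let T : 𝓓^{⊤}_{Kc}(E, ℝ) →ₗ[ℝ] ℂ :=
    { toFun := fun f => u (TestFunction.ofSupportedIn hKΩ f)
      map_add' := fun f g => map_add u (TestFunction.ofSupportedIn hKΩ f) (TestFunction.ofSupportedIn hKΩ g)
      map_smul' := fun c f => map_smul u c (TestFunction.ofSupportedIn hKΩ f) }
  have hT : Continuous T :=
    (map_continuous u).comp (TestFunction.continuous_ofSupportedIn (K := Kc) hKΩ)
  obtain ⟨s, C, -, hC⟩ := Seminorm.bound_of_continuous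
    (ContDiffMapSupportedIn.withSeminorms ℝ E ℝ ⊤ Kc) ((normSeminorm ℝ ℂ).comp T)
    (continuous_norm.comp hT)
  refine ⟨s.sup id, 2 * C, by positivity, fun f hf M hM0 hM => ?_⟩
  have key : ∀ g : 𝓓(Ω, ℝ), (∀ x, ‖g x‖ ≤ ‖f x‖) →
      (∀ k x, ‖iteratedFDeriv ℝ k g x‖ ≤ ‖iteratedFDeriv ℝ k f x‖) → ‖u g‖ ≤ C * M := by
    intro g hg0 hg
    have hgK : Function.support g ⊆ K := fun x hx => by
      refine hf.2.2 (subset_tsupport f ?_)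
      intro h0
      have := hg0 x
      rw [h0, norm_zero] at this
      exact hx (norm_le_zero_iff.1 this)
    let gK : 𝓓^{⊤}_{Kc}(E, ℝ) := .of_support_subset (K := Kc) g.contDiff hgK
    have h1 := hC gK
    have h2 : (s.sup (ContDiffMapSupportedIn.seminorm ℝ E ℝ ⊤ Kc)) gK ≤ M := by
      refine Seminorm.finset_sup_apply_le hM0 fun k hk => ?_
      rw [ContDiffMapSupportedIn.seminorm_top_le_iff ℝ hM0]
      intro x hx
      exact (hg k x).trans (hM k (Finset.le_sup (f := id) hk) x hx)
    have h3 : ((normSeminorm ℝ ℂ).comp T) gK = ‖u g‖ := rfl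
    rw [h3] at h1
    refine h1.trans ?_
    rw [smul_apply]
    exact mul_le_mul_of_nonneg_left h2 C.2
  have hfΩ : f ∈ testSpace (Ω : Set E) := testSpace_mono hKΩ hf
  rw [ev_of_mem u hfΩ]
  change ‖u (reTest ⟨f, hfΩ⟩) + Complex.I * u (imTest ⟨f, hfΩ⟩)‖ ≤ _
  have hre := key (reTest ⟨f, hfΩ⟩) (fun x => Complex.abs_re_le_norm (f x)) (fun k x => by
    refine (ContinuousLinearMap.norm_iteratedFDeriv_comp_left Complex.reCLM hf.1.contDiffAt
      (mod_cast le_top)).trans ?_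
    rw [Complex.reCLM_norm, one_mul])
  have him := key (imTest ⟨f, hfΩ⟩) (fun x => Complex.abs_im_le_norm (f x)) (fun k x => by
    refine (ContinuousLinearMap.norm_iteratedFDeriv_comp_left Complex.imCLM hf.1.contDiffAt
      (mod_cast le_top)).trans ?_
    rw [Complex.imCLM_norm, one_mul])
  refine (norm_add_le _ _).trans ?_
  rw [norm_mul, Complex.norm_I, one_mul]
  linarith

/-- On the test functions supported in a compact set, a distribution factors through a jet space:
it is a continuous functional of finitely many derivatives. -/
theorem exists_jet_functional (u : Distribution Ω ℂ ⊤) {K : Set E} (hK : IsCompact K)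
    (hKΩ : K ⊆ Ω) : ∃ (N : ℕ)
      (ℓ : ((k : Fin (N + 1)) → C(K, E [×(k : ℕ)]→L[ℝ] ℂ)) →L[ℂ] ℂ),
      ∀ (f : E → ℂ) (hf : f ∈ testSpace K), ev u f = ℓ (jet K N f hf.1) := by
  obtain ⟨N, C, hC0, hC⟩ := exists_order_bound u hK hKΩ
  have : CompactSpace K := isCompact_iff_compactSpace.1 hK
  let e := LinearEquiv.ofInjective (jetLM K N) (jetLM_injective K N)
  let v : testSpace K →ₗ[ℂ] ℂ :=
    complexExt u ∘ₗ Submodule.inclusion (testSpace_mono hKΩ)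
  have hv : ∀ f : testSpace K, v f = ev u f.1 := fun f => (ev_of_mem u _).symm
  let g₀ : LinearMap.range (jetLM K N) →ₗ[ℂ] ℂ := v ∘ₗ e.symm.toLinearMap
  let g : StrongDual ℂ (LinearMap.range (jetLM K N)) := g₀.mkContinuous C (by
    intro y
    obtain ⟨f, rfl⟩ := e.surjective y
    have : g₀ (e f) = ev u f.1 := by
      rw [← hv]
      change v (e.symm (e f)) = v f
      rw [e.symm_apply_apply]
    rw [this]
    refine hC f.1 f.2 _ (norm_nonneg _) fun k hk x hx => ?_
    have h1 : ‖jetLM K N f ⟨k, Nat.lt_succ_of_le hk⟩‖ ≤ ‖jetLM K N f‖ := norm_le_pi_norm _ _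
    exact (ContinuousMap.norm_coe_le_norm (jetLM K N f ⟨k, Nat.lt_succ_of_le hk⟩) ⟨x, hx⟩).trans h1)
  obtain ⟨ℓ, hℓ, -⟩ := exists_extension_norm_eq (LinearMap.range (jetLM K N)) g
  refine ⟨N, ℓ, fun f hf => ?_⟩
  have h1 := hℓ (e ⟨f, hf⟩)
  have h2 : g (e ⟨f, hf⟩) = ev u f := by
    rw [← hv ⟨f, hf⟩]
    change v (e.symm (e ⟨f, hf⟩)) = v ⟨f, hf⟩
    rw [e.symm_apply_apply]
  rw [← h2, ← h1]
  rfl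

end ComplexTest

/-! ### Distributions and parametric integrals -/

section Interchange

variable {W : Type*} [NormedAddCommGroup W] [NormedSpace ℝ W]
  {E : Type*} [NormedAddCommGroup E] [NormedSpace ℝ E] {Ω : Opens E}

theorem continuous_jet {Ψ : W → E → ℂ} (hΨ : ContDiff ℝ ∞ (Function.uncurry Ψ)) (K : Set E)
    (N : ℕ) : Continuous fun w => jet K N (Ψ w) (contDiff_partial hΨ w) := by
  refine continuous_pi fun k => ?_
  have h : Continuous fun q : W × K => iteratedFDeriv ℝ (k : ℕ) (Ψ q.1) (q.2 : E) :=
    (continuous_iteratedFDeriv_partial hΨ k).comp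
      (continuous_fst.prodMk (continuous_subtype_val.comp continuous_snd))
  exact (ContinuousMap.curry ⟨_, h⟩).continuous

theorem continuous_jet_functional {Ψ : W → E → ℂ} (hΨ : ContDiff ℝ ∞ (Function.uncurry Ψ))
    {K : Set E} [CompactSpace K] {N : ℕ}
    (ℓ : ((k : Fin (N + 1)) → C(K, E [×(k : ℕ)]→L[ℝ] ℂ)) →L[ℂ] ℂ) :
    Continuous fun w => ℓ (jet K N (Ψ w) (contDiff_partial hΨ w)) :=
  ℓ.continuous.comp (continuous_jet hΨ K N)

variable [FiniteDimensional ℝ W] [MeasurableSpace W] [BorelSpace W]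

/-- A distribution commutes with the integration of a smooth family of test functions. -/
theorem ev_integral (u : Distribution Ω ℂ ⊤) {K : Set E} (hK : IsCompact K) (hKΩ : K ⊆ Ω)
    {Ψ : W → E → ℂ} (hΨ : ContDiff ℝ ∞ (Function.uncurry Ψ)) (ν : Measure W)
    (hs : ∀ᵐ w ∂ν, Ψ w ∈ testSpace K)
    (hb : ∀ k : ℕ, ∃ b : W → ℝ, Integrable b ν ∧
      ∀ᵐ w ∂ν, ∀ x ∈ K, ‖iteratedFDeriv ℝ k (Ψ w) x‖ ≤ b w) :
    (fun x => ∫ w, Ψ w x ∂ν) ∈ testSpace K ∧ Integrable (fun w => ev u (Ψ w)) ν ∧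
      ev u (fun x => ∫ w, Ψ w x ∂ν) = ∫ w, ev u (Ψ w) ∂ν := by
  have hcpt : CompactSpace K := isCompact_iff_compactSpace.1 hK
  have hb' : ∀ k : ℕ, ∃ b : W → ℝ, Integrable b ν ∧
      ∀ᵐ w ∂ν, ∀ x, ‖iteratedFDeriv ℝ k (Ψ w) x‖ ≤ b w := by
    intro k
    obtain ⟨b, hbi, hbb⟩ := hb k
    refine ⟨fun w => ‖b w‖, hbi.norm, ?_⟩
    filter_upwards [hbb, hs] with w hw hsw x
    by_cases hx : x ∈ K
    · exact (hw x hx).trans (le_abs_self _)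
    · have h0 : iteratedFDeriv ℝ k (Ψ w) x = 0 := by
        by_contra h
        exact hx (hsw.2.2 (support_iteratedFDeriv_subset (𝕜 := ℝ) k h))
      rw [h0, norm_zero]
      exact norm_nonneg _
  have hb'' : ∀ (k : ℕ) (x₀ : E), ∃ ε > 0, ∃ b : W → ℝ, Integrable b ν ∧
      ∀ᵐ w ∂ν, ∀ x ∈ Metric.ball x₀ ε, ‖iteratedFDeriv ℝ k (Ψ w) x‖ ≤ b w := by
    intro k x₀
    obtain ⟨b, hbi, hbb⟩ := hb' k
    exact ⟨1, one_pos, b, hbi, hbb.mono fun w hw x _ => hw x⟩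
  have hθ : (fun x => ∫ w, Ψ w x ∂ν) ∈ testSpace K := by
    refine mem_testSpace_of_isCompact hK (contDiff_integral_of_dominated hΨ ν hb'') fun x hx => ?_
    refine integral_eq_zero_of_ae ?_
    filter_upwards [hs] with w hw
    exact image_eq_zero_of_notMem_tsupport fun h => hx (hw.2.2 h)
  obtain ⟨N, ℓ, hℓ⟩ := exists_jet_functional u hK hKΩ
  have hJint : Integrable (fun w => jet K N (Ψ w) (contDiff_partial hΨ w)) ν := by
    choose b hbi hbb using hb
    have hbN : Integrable (fun w => ∑ k : Fin (N + 1), ‖b k w‖) ν :=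
      integrable_finsetSum _ fun k _ => (hbi k).norm
    have hW : SecondCountableTopology W :=
      have := FiniteDimensional.proper ℝ W
      inferInstance
    have := secondCountableTopologyEither_of_left W ((k : Fin (N + 1)) → C(K, E [×(k : ℕ)]→L[ℝ] ℂ))
    refine hbN.mono' (continuous_jet hΨ K N).aestronglyMeasurable ?_
    have hall : ∀ᵐ w ∂ν, ∀ k : Fin (N + 1), ∀ x ∈ K,
        ‖iteratedFDeriv ℝ (k : ℕ) (Ψ w) x‖ ≤ b k w := ae_all_iff.2 fun k => hbb k
    filter_upwards [hall] with w hw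
    have hnn : 0 ≤ ∑ k : Fin (N + 1), ‖b k w‖ := Finset.sum_nonneg fun k _ => norm_nonneg _
    refine (pi_norm_le_iff_of_nonneg hnn).2 fun k => ?_
    refine (ContinuousMap.norm_le _ hnn).2 fun x => ?_
    refine ((hw k x x.2).trans (le_abs_self _)).trans ?_
    exact Finset.single_le_sum (f := fun k : Fin (N + 1) => ‖b k w‖)
      (fun k _ => norm_nonneg _) (Finset.mem_univ k)
  have hev : (fun w => ev u (Ψ w)) =ᵐ[ν] fun w => ℓ (jet K N (Ψ w) (contDiff_partial hΨ w)) := by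
    filter_upwards [hs] with w hw using hℓ _ hw
  refine ⟨hθ, (ℓ.integrable_comp hJint).congr hev.symm, ?_⟩
  rw [integral_congr_ae hev, ℓ.integral_comp_comm hJint, hℓ _ hθ]
  congr 1
  ext k x : 2
  have h1 : (∫ w, jet K N (Ψ w) (contDiff_partial hΨ w) ∂ν) k x =
      ∫ w, jet K N (Ψ w) (contDiff_partial hΨ w) k x ∂ν := by
    have e1 := (ContinuousLinearMap.proj (R := ℂ)
      (φ := fun k : Fin (N + 1) => C(K, E [×(k : ℕ)]→L[ℝ] ℂ)) k).integral_comp_comm hJint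
    have hint2 := (ContinuousLinearMap.proj (R := ℂ)
      (φ := fun k : Fin (N + 1) => C(K, E [×(k : ℕ)]→L[ℝ] ℂ)) k).integrable_comp hJint
    have e2 := (ContinuousMap.evalCLM ℂ (M := E [×(k : ℕ)]→L[ℝ] ℂ) x).integral_comp_comm hint2
    exact (congrArg (fun f => f x) e1.symm).trans e2.symm
  rw [h1]
  exact iteratedFDeriv_integral_of_dominated hΨ ν hb'' k x

end Interchange

section TimeFamily

variable {E : Type*} [NormedAddCommGroup E] [NormedSpace ℝ E] {Ω : Opens E}

/-- A distribution evaluated along a smooth one-parameter family of test functions with supports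
in a fixed compact set can be differentiated in the parameter. -/
theorem ev_family (u : Distribution Ω ℂ ⊤) {K : Set E} (hK : IsCompact K) (hKΩ : K ⊆ Ω)
    {Ψ : ℝ → E → ℂ} (hΨ : ContDiff ℝ ∞ (Function.uncurry Ψ)) {a b : ℝ} (hab : a < b)
    (hs : ∀ t ∈ Icc a b, Ψ t ∈ testSpace K) :
    (∀ t ∈ Icc a b, (fun x => deriv (fun s => Ψ s x) t) ∈ testSpace K) ∧
    ContinuousOn (fun t => ev u (Ψ t)) (Icc a b) ∧
    ∀ t ∈ Ico a b, HasDerivWithinAt (fun t => ev u (Ψ t))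
      (ev u (fun x => deriv (fun s => Ψ s x) t)) (Ici t) t := by
  have hcpt : CompactSpace K := isCompact_iff_compactSpace.1 hK
  set Ψ' : ℝ → E → ℂ := fun t x => deriv (fun s => Ψ s x) t with hΨ'def
  have hd : ∀ t x, HasDerivAt (fun s => Ψ s x)
      (fderiv ℝ (Function.uncurry Ψ) (t, x) (1, 0)) t := by
    intro t x
    have h1 : HasFDerivAt (Function.uncurry Ψ) (fderiv ℝ (Function.uncurry Ψ) (t, x)) (t, x) :=
      (hΨ.differentiable (by simp) (t, x)).hasFDerivAt
    have h2 : HasDerivAt (fun s : ℝ => (s, x)) ((1 : ℝ), (0 : E)) t :=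
      (hasDerivAt_id t).prodMk (hasDerivAt_const t x)
    exact h1.comp_hasDerivAt t h2
  have hΨ'eq : Function.uncurry Ψ' =
      fun q => fderiv ℝ (Function.uncurry Ψ) q ((1 : ℝ), (0 : E)) := by
    ext ⟨t, x⟩
    exact (hd t x).deriv
  have hΨ' : ContDiff ℝ ∞ (Function.uncurry Ψ') := by
    rw [hΨ'eq]
    exact (hΨ.fderiv_right (m := ∞) (by simp)).clm_apply contDiff_const
  have hs' : ∀ t ∈ Icc a b, Ψ' t ∈ testSpace K := by
    intro t ht
    refine mem_testSpace_of_isCompact hK (contDiff_partial hΨ' t) fun x hx => ?_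
    have h0 : ∀ s ∈ Icc a b, Ψ s x = 0 := fun s hs₁ =>
      image_eq_zero_of_notMem_tsupport fun h => hx ((hs s hs₁).2.2 h)
    have h1 : HasDerivWithinAt (fun s => Ψ s x) (Ψ' t x) (Icc a b) t := by
      have := (hd t x).hasDerivWithinAt (s := Icc a b)
      rwa [← (hd t x).deriv] at this
    have h2 : HasDerivWithinAt (fun s => Ψ s x) 0 (Icc a b) t :=
      (hasDerivWithinAt_const t (Icc a b) (0 : ℂ)).congr h0 (h0 t ht)
    exact (uniqueDiffOn_Icc hab t ht).eq_deriv _ h1 h2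
  obtain ⟨N, ℓ, hℓ⟩ := exists_jet_functional u hK hKΩ
  set g : ℝ → ℂ := fun t => ℓ (jet K N (Ψ' t) (contDiff_partial hΨ' t)) with hg
  have hgc : Continuous g := continuous_jet_functional hΨ' ℓ
  have hFTC : ∀ t ∈ Icc a b, ev u (Ψ t) = ev u (Ψ a) + ∫ s in a..t, g s := by
    intro t ht
    have hsub : Ioc a t ⊆ Icc a b := fun s hs => ⟨hs.1.le, hs.2.trans ht.2⟩
    have key := ev_integral u hK hKΩ hΨ' (volume.restrict (Ioc a t))
      ((ae_restrict_iff' measurableSet_Ioc).2 (Eventually.of_forall fun s hs₁ => hs' s (hsub hs₁)))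
      (fun k => by
        have hc := continuous_iteratedFDeriv_partial hΨ' k
        obtain ⟨C, hC⟩ := (isCompact_Icc.prod hK).exists_bound_of_continuousOn
          (s := Icc a t ×ˢ K) hc.continuousOn
        refine ⟨fun _ => C, integrable_const C, ?_⟩
        refine (ae_restrict_iff' measurableSet_Ioc).2 (Eventually.of_forall fun s hs₁ x hx => ?_)
        exact hC (s, x) ⟨⟨hs₁.1.le, hs₁.2⟩, hx⟩)
    have hΨt : Ψ t = Ψ a + fun x => ∫ s in Ioc a t, Ψ' s x := by
      ext x
      have h1 : ∫ s in a..t, Ψ' s x = Ψ t x - Ψ a x := by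
        refine intervalIntegral.integral_eq_sub_of_hasDerivAt (f := fun s => Ψ s x)
          (fun s _ => ?_) ?_
        · have := hd s x
          rwa [← (hd s x).deriv] at this
        · have : Continuous fun s => Ψ' s x :=
            hΨ'.continuous.comp (continuous_id.prodMk continuous_const)
          exact this.intervalIntegrable _ _
      rw [intervalIntegral.integral_of_le ht.1] at h1
      rw [Pi.add_apply, h1]; ring
    have hac : ∫ s in a..t, g s = ∫ s in Ioc a t, ev u (Ψ' s) := by
      rw [intervalIntegral.integral_of_le ht.1]
      exact setIntegral_congr_fun measurableSet_Ioc fun s hs₁ => (hℓ _ (hs' s (hsub hs₁))).symm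
    rw [hac, ← key.2.2, ← ev_add u (testSpace_mono hKΩ (hs a ⟨le_rfl, hab.le⟩))
      (testSpace_mono hKΩ key.1), ← hΨt]
  have hG : ∀ t, HasDerivAt (fun t => ev u (Ψ a) + ∫ s in a..t, g s) (g t) t := fun t =>
    (intervalIntegral.integral_hasDerivAt_right (hgc.intervalIntegrable _ _)
      (hgc.stronglyMeasurableAtFilter _ _) hgc.continuousAt).const_add _
  refine ⟨hs', ?_, fun t ht => ?_⟩
  · refine ContinuousOn.congr (f := fun t => ev u (Ψ a) + ∫ s in a..t, g s) ?_ hFTC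
    exact fun t _ => (hG t).continuousAt.continuousWithinAt
  · have h1 : g t = ev u (Ψ' t) := (hℓ _ (hs' t ⟨ht.1, ht.2.le⟩)).symm
    rw [← h1]
    refine ((hG t).hasDerivWithinAt (s := Ici t)).congr_of_eventuallyEq ?_ (hFTC t ⟨ht.1, ht.2.le⟩)
    filter_upwards [self_mem_nhdsWithin, mem_nhdsWithin_of_mem_nhds (Iio_mem_nhds ht.2)] with s h2 h3
    exact hFTC s ⟨ht.1.trans h2, le_of_lt h3⟩

end TimeFamily

section Cascade

/-- Solutions of the triangular linear system `G_j' = μ G_j - G_{j+1}` which terminates are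
exponential polynomials. -/
theorem exists_polynomial_of_cascade {μ : ℂ} {a b : ℝ} (G : ℕ → ℝ → ℂ)
    (hc : ∀ j, ContinuousOn (G j) (Icc a b))
    (hd : ∀ j, ∀ t ∈ Ico a b, HasDerivWithinAt (G j) (μ * G j t - G (j + 1) t) (Ici t) t)
    (m : ℕ) (hm : ∀ t ∈ Icc a b, G m t = 0) :
    ∃ P : Polynomial ℂ, ∀ t ∈ Icc a b, G 0 t = Complex.exp (μ * t) * P.eval (t : ℂ) := by
  induction m generalizing G with
  | zero => exact ⟨0, fun t ht => by simp [hm t ht]⟩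
  | succ m ih =>
    obtain ⟨P, hP⟩ := ih (fun j => G (j + 1)) (fun j => hc _) (fun j => hd _) hm
    obtain ⟨Q, hQ⟩ : ∃ Q : Polynomial ℂ, Polynomial.derivative Q = P := by
      refine ⟨P.sum fun n c => Polynomial.monomial (n + 1) (c / (n + 1)), ?_⟩
      rw [Polynomial.sum, Polynomial.derivative_sum]
      conv_rhs => rw [P.as_sum_support]
      refine Finset.sum_congr rfl fun n _ => ?_
      rw [Polynomial.derivative_monomial]
      have : ((n : ℂ) + 1) ≠ 0 := Nat.cast_add_one_ne_zero n
      simp only [Nat.add_sub_cancel, Nat.cast_add, Nat.cast_one]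
      rw [div_mul_cancel₀ _ this]
    set H : ℝ → ℂ := fun t => Complex.exp (-(μ * t)) * G 0 t + Q.eval (t : ℂ) with hH
    have hexp : ∀ t : ℝ, HasDerivAt (fun t : ℝ => Complex.exp (-(μ * t)))
        (Complex.exp (-(μ * t)) * (-μ)) t := by
      intro t
      have h0 := ((Complex.ofRealCLM.hasDerivAt (x := t)).const_mul μ).neg
      rw [Complex.ofRealCLM_apply, Complex.ofReal_one, mul_one] at h0
      have h1 : HasDerivAt (fun t : ℝ => -(μ * (t : ℂ))) (-μ) t := h0
      exact h1.cexp
    have hQd : ∀ t : ℝ, HasDerivAt (fun t : ℝ => Q.eval (t : ℂ)) (P.eval (t : ℂ)) t := by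
      intro t
      have := (Q.hasDerivAt (t : ℂ)).comp_ofReal
      rwa [hQ] at this
    have hconst : ∀ t ∈ Icc a b, H t = H a := by
      refine constant_of_has_deriv_right_zero ?_ ?_
      · refine ContinuousOn.add (ContinuousOn.mul ?_ (hc 0)) ?_
        · exact fun t _ => (hexp t).continuousAt.continuousWithinAt
        · exact fun t _ => (hQd t).continuousAt.continuousWithinAt
      · intro t ht
        have h1 := ((hexp t).hasDerivWithinAt (s := Ici t)).mul (hd 0 t ht)
        have h2 := h1.add ((hQd t).hasDerivWithinAt (s := Ici t))
        refine h2.congr_deriv ?_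
        have h3 : G 1 t = _ := hP t ⟨ht.1, ht.2.le⟩
        have h4 : Complex.exp (-(μ * t)) * Complex.exp (μ * t) = 1 := by
          rw [← Complex.exp_add, neg_add_cancel, Complex.exp_zero]
        rw [zero_add, h3]
        linear_combination (-P.eval (t : ℂ)) * h4
    refine ⟨Polynomial.C (H a) - Q, fun t ht => ?_⟩
    have h4 : Complex.exp (μ * t) * Complex.exp (-(μ * t)) = 1 := by
      rw [← Complex.exp_add, add_neg_cancel, Complex.exp_zero]
    rw [← hconst t ht, Polynomial.eval_sub, Polynomial.eval_C]
    simp only [hH]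
    linear_combination (-G 0 t) * h4

/-- If a terminating system `G_j' = μ G_j - G_{j+1}` on the half-line starts with a function which
decays faster than `exp (μ t)`, this function vanishes. -/
theorem cascade_eq_zero {μ : ℂ} (G : ℕ → ℝ → ℂ)
    (hc : ∀ j, ContinuousOn (G j) (Ici 0))
    (hd : ∀ j, ∀ t, 0 ≤ t → HasDerivWithinAt (G j) (μ * G j t - G (j + 1) t) (Ici t) t)
    (m : ℕ) (hm : ∀ t, 0 ≤ t → G m t = 0)
    (hlim : Tendsto (fun t : ℝ => Complex.exp (-(μ * t)) * G 0 t) atTop (𝓝 0)) :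
    ∀ t, 0 ≤ t → G 0 t = 0 := by
  have h : ∀ b : ℝ, ∃ P : Polynomial ℂ, ∀ t ∈ Icc 0 b,
      G 0 t = Complex.exp (μ * t) * P.eval (t : ℂ) := fun b =>
    exists_polynomial_of_cascade G (fun j => (hc j).mono Icc_subset_Ici_self)
      (fun j t ht => hd j t ht.1) m (fun t ht => hm t ht.1)
  have hexp : ∀ t : ℝ, Complex.exp (-(μ * t)) * Complex.exp (μ * t) = 1 := fun t => by
    rw [← Complex.exp_add, neg_add_cancel, Complex.exp_zero]
  choose P hP using h
  have hPeq : ∀ b : ℝ, 1 ≤ b → P b = P 1 := by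
    intro b hb
    refine Polynomial.eq_of_infinite_eval_eq _ _ ?_
    have hinf : ((fun t : ℝ => (t : ℂ)) '' Icc (0 : ℝ) 1).Infinite :=
      (Icc_infinite zero_lt_one).image (Complex.ofReal_injective.injOn)
    refine hinf.mono ?_
    rintro _ ⟨t, ht, rfl⟩
    have h1 := hP 1 t ht
    rw [hP b t ⟨ht.1, ht.2.trans hb⟩] at h1
    exact mul_left_cancel₀ (Complex.exp_ne_zero _) h1
  have hall : ∀ t : ℝ, 0 ≤ t → G 0 t = Complex.exp (μ * t) * (P 1).eval (t : ℂ) := by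
    intro t ht
    have := hP (max t 1) t ⟨ht, le_max_left _ _⟩
    rwa [hPeq _ (le_max_right _ _)] at this
  have hlim' : Tendsto (fun t : ℝ => (P 1).eval (t : ℂ)) atTop (𝓝 0) := by
    refine hlim.congr' ?_
    filter_upwards [eventually_ge_atTop 0] with t ht
    rw [hall t ht, ← mul_assoc, hexp, one_mul]
  have hP0 : P 1 = 0 := by
    by_contra hne
    by_cases hdeg : 0 < (P 1).degree
    · have := (P 1).tendsto_norm_atTop hdeg (l := atTop) (z := fun t : ℝ => (t : ℂ))
        (by simpa using tendsto_abs_atTop_atTop)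
      exact not_tendsto_nhds_of_tendsto_atTop this _ hlim'.norm
    · rw [Polynomial.eq_C_of_degree_le_zero (not_lt.1 hdeg)] at hlim' hne
      simp only [Polynomial.eval_C] at hlim'
      exact hne (by rw [tendsto_nhds_unique tendsto_const_nhds hlim', Polynomial.C_0])
  intro t ht
  rw [hall t ht, hP0]
  simp

end Cascade

/-! ### Plane waves and the Fourier representation of test functions -/

section PlaneWaves

variable {E : Type*} [NormedAddCommGroup E] [NormedSpace ℝ E]

/-- The plane wave `q ↦ exp (i ζ(q))`. -/
def wave (ζ : E →L[ℝ] ℝ) (q : E) : ℂ := Complex.exp (Complex.I * (ζ q : ℂ))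

theorem norm_wave (ζ : E →L[ℝ] ℝ) (q : E) : ‖wave ζ q‖ = 1 := by
  rw [wave, mul_comm, Complex.norm_exp_ofReal_mul_I]

theorem wave_add (ζ ξ : E →L[ℝ] ℝ) (q : E) : wave (ζ + ξ) q = wave ζ q * wave ξ q := by
  rw [wave, wave, wave, ← Complex.exp_add]
  congr 1
  push_cast [add_apply]
  ring

theorem contDiff_wave_uncurry :
    ContDiff ℝ ∞ (fun p : (E →L[ℝ] ℝ) × E => wave p.1 p.2) := by
  have h1 : ContDiff ℝ ∞ (fun p : (E →L[ℝ] ℝ) × E => p.1 p.2) := by fun_prop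
  exact (contDiff_const.mul (Complex.ofRealCLM.contDiff.comp h1)).cexp

theorem contDiff_wave (ζ : E →L[ℝ] ℝ) : ContDiff ℝ ∞ (wave ζ) :=
  contDiff_wave_uncurry.comp (contDiff_const.prodMk contDiff_id)

theorem norm_iteratedFDeriv_wave_le (ζ : E →L[ℝ] ℝ) (k : ℕ) (q : E) :
    ‖iteratedFDeriv ℝ k (wave ζ) q‖ ≤ ‖ζ‖ ^ k := by
  set g : ℝ → ℂ := fun s => Complex.exp (Complex.I * (s : ℂ)) with hg
  have hgs : ContDiff ℝ ∞ g := (contDiff_const.mul Complex.ofRealCLM.contDiff).cexp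
  have hgd : ∀ n : ℕ, iteratedDeriv n g = fun s => Complex.I ^ n * g s := by
    intro n
    induction n with
    | zero => ext s; simp
    | succ n ih =>
      rw [iteratedDeriv_succ, ih]
      ext s
      have h1 : HasDerivAt (fun s : ℝ => Complex.I * (s : ℂ)) (Complex.I * 1) s :=
        (Complex.ofRealCLM.hasDerivAt (x := s)).const_mul Complex.I
      have h2 := (h1.cexp.const_mul (Complex.I ^ n)).deriv
      refine h2.trans ?_
      simp only [hg]
      ring
  have h1 : wave ζ = g ∘ ζ := rfl
  rw [h1, ContinuousLinearMap.iteratedFDeriv_comp_right ζ hgs q (i := k) (mod_cast le_top)]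
  refine (ContinuousMultilinearMap.norm_compContinuousLinearMap_le _ _).trans ?_
  rw [norm_iteratedFDeriv_eq_norm_iteratedDeriv, hgd]
  simp only [norm_mul, norm_pow, Complex.norm_I, one_pow, one_mul, Finset.prod_const,
    Finset.card_univ, Fintype.card_fin]
  have : ‖g (ζ q)‖ = 1 := norm_wave ζ q
  rw [this, one_mul]

theorem norm_iteratedFDeriv_mul_le_of_le {f g : E → ℂ} (hf : ContDiff ℝ ∞ f)
    (hg : ContDiff ℝ ∞ g) {n : ℕ} {A B : ℝ} (hA : 0 ≤ A) (q : E)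
    (hfA : ∀ k ≤ n, ‖iteratedFDeriv ℝ k f q‖ ≤ A) (hgB : ∀ k ≤ n, ‖iteratedFDeriv ℝ k g q‖ ≤ B) :
    ‖iteratedFDeriv ℝ n (fun x => f x * g x) q‖ ≤ 2 ^ n * (A * B) := by
  refine (norm_iteratedFDeriv_mul_le hf hg q (n := n) (mod_cast le_top)).trans ?_
  have : ((2 : ℝ) ^ n * (A * B)) = ∑ i ∈ Finset.range (n + 1), (n.choose i : ℝ) * (A * B) := by
    rw [← Finset.sum_mul]
    congr 1
    exact_mod_cast (Nat.sum_range_choose n).symm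
  rw [this]
  refine Finset.sum_le_sum fun i hi => ?_
  rw [mul_assoc]
  have hin : i ≤ n := Nat.lt_succ_iff.1 (Finset.mem_range.1 hi)
  gcongr
  · exact hfA i hin
  · exact hgB _ (Nat.sub_le n i)

theorem exists_bound_iteratedFDeriv {F : Type*} [NormedAddCommGroup F] [NormedSpace ℝ F]
    {f : E → F} (hf : ContDiff ℝ ∞ f) {K : Set E} (hK : IsCompact K)
    (N : ℕ) : ∃ A : ℝ, 0 ≤ A ∧ ∀ k ≤ N, ∀ x ∈ K, ‖iteratedFDeriv ℝ k f x‖ ≤ A := by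
  have h : ∀ k : ℕ, ∃ C : ℝ, ∀ x ∈ K, ‖iteratedFDeriv ℝ k f x‖ ≤ C := fun k =>
    hK.exists_bound_of_continuousOn (hf.continuous_iteratedFDeriv (mod_cast le_top)).continuousOn
  choose C hC using h
  refine ⟨∑ k ∈ Finset.range (N + 1), |C k|, Finset.sum_nonneg fun _ _ => abs_nonneg _, ?_⟩
  intro k hk x hx
  refine ((hC k x hx).trans (le_abs_self _)).trans ?_
  exact Finset.single_le_sum (f := fun k => |C k|) (fun _ _ => abs_nonneg _)
    (Finset.mem_range.2 (Nat.lt_succ_of_le hk))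

theorem norm_iteratedFDeriv_mul_wave_le {f : E → ℂ} (hf : ContDiff ℝ ∞ f) {K : Set E}
    (hK : IsCompact K) (N : ℕ) : ∃ A : ℝ, 0 ≤ A ∧ ∀ k ≤ N, ∀ x ∈ K, ∀ ζ : E →L[ℝ] ℝ,
      ‖iteratedFDeriv ℝ k (fun q => f q * wave ζ q) x‖ ≤ A * (1 + ‖ζ‖) ^ k := by
  obtain ⟨A, hA0, hA⟩ := exists_bound_iteratedFDeriv hf hK N
  refine ⟨2 ^ N * A, by positivity, fun k hk x hx ζ => ?_⟩
  refine (norm_iteratedFDeriv_mul_le_of_le hf (contDiff_wave ζ) hA0 x (B := (1 + ‖ζ‖) ^ k)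
    (fun j hj => hA j (hj.trans hk) x hx) (fun j hj => ?_)).trans ?_
  · refine (norm_iteratedFDeriv_wave_le ζ j x).trans ?_
    calc ‖ζ‖ ^ j ≤ (1 + ‖ζ‖) ^ j := by gcongr; linarith
      _ ≤ (1 + ‖ζ‖) ^ k := pow_le_pow_right₀ (by linarith [norm_nonneg ζ]) hj
  · rw [mul_assoc]
    gcongr
    norm_num

variable {Ω : Opens E}

/-- The Fourier transform of a localized distribution grows at most polynomially. -/
theorem exists_ev_wave_le (u : Distribution Ω ℂ ⊤) {f : E → ℂ} (hf : f ∈ testSpace (Ω : Set E)) :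
    ∃ (N : ℕ) (C : ℝ), 0 ≤ C ∧ ∀ ζ : E →L[ℝ] ℝ,
      ‖ev u (fun q => f q * wave ζ q)‖ ≤ C * (1 + ‖ζ‖) ^ N := by
  have hfK : f ∈ testSpace (tsupport f) := ⟨hf.1, hf.2.1, subset_rfl⟩
  obtain ⟨N, C, hC0, hC⟩ := exists_order_bound u hf.2.1 hf.2.2
  obtain ⟨A, hA0, hA⟩ := norm_iteratedFDeriv_mul_wave_le hf.1 hf.2.1.isCompact N
  refine ⟨N, C * A, by positivity, fun ζ => ?_⟩
  rw [mul_assoc]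
  refine hC _ (mul_mem_testSpace hfK (contDiff_wave ζ)) _ (by positivity) fun k hk x hx => ?_
  refine (hA k hk x hx ζ).trans ?_
  gcongr
  · linarith [norm_nonneg ζ]

variable {V : Type*} [NormedAddCommGroup V] [InnerProductSpace ℝ V]

/-- The covector `q ↦ 2π ⟪w, L q⟫`. -/
def waveCovector (L : E ≃L[ℝ] V) : V →L[ℝ] (E →L[ℝ] ℝ) :=
  ((ContinuousLinearMap.compL ℝ E V ℝ).flip (L : E →L[ℝ] V)).comp ((2 * Real.pi) • innerSL ℝ)

theorem waveCovector_apply (L : E ≃L[ℝ] V) (w : V) (q : E) :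
    waveCovector L w q = 2 * Real.pi * inner ℝ w (L q) := rfl

theorem norm_le_waveCovector (L : E ≃L[ℝ] V) :
    ∃ c : ℝ, 0 < c ∧ ∀ w : V, c * ‖w‖ ≤ ‖waveCovector L w‖ := by
  set b : ℝ := ‖(L.symm : V →L[ℝ] E)‖ + 1 with hb
  have hb0 : 0 < b := by positivity
  refine ⟨2 * Real.pi / b, by positivity, fun w => ?_⟩
  rcases eq_or_ne w 0 with rfl | hw
  · simp
  have hw0 : 0 < ‖w‖ := norm_pos_iff.2 hw
  have h1 : waveCovector L w (L.symm w) = 2 * Real.pi * ‖w‖ ^ 2 := by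
    rw [waveCovector_apply, L.apply_symm_apply, real_inner_self_eq_norm_sq]
  have h2 : 2 * Real.pi * ‖w‖ ^ 2 ≤ ‖waveCovector L w‖ * (b * ‖w‖) := by
    rw [← h1]
    refine (le_abs_self _).trans (((waveCovector L w).le_opNorm _).trans ?_)
    gcongr
    refine ((L.symm : V →L[ℝ] E).le_opNorm w).trans ?_
    gcongr
    linarith
  have h3 : 2 * Real.pi * ‖w‖ ≤ ‖waveCovector L w‖ * b := by
    refine le_of_mul_le_mul_right ?_ hw0
    nlinarith
  rw [div_mul_eq_mul_div, div_le_iff₀ hb0]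
  exact h3

variable [FiniteDimensional ℝ V] [MeasurableSpace V] [BorelSpace V]

open scoped FourierTransform in
/-- Fourier inversion for test functions on a finite-dimensional space, which is identified with
an inner product space. -/
theorem exists_fourier_representation (L : E ≃L[ℝ] V) {h : E → ℂ} (hs : ContDiff ℝ ∞ h)
    (hc : HasCompactSupport h) : ∃ a : SchwartzMap V ℂ,
      (∀ w, a w = ∫ v, wave (-(waveCovector L w)) (L.symm v) * h (L.symm v)) ∧
      ∀ q, h q = ∫ w, a w * wave (waveCovector L w) q := by
  have hc' : HasCompactSupport (h ∘ L.symm) := hc.comp_homeomorph L.symm.toHomeomorph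
  have hs' : ContDiff ℝ ∞ (h ∘ L.symm) := hs.comp L.symm.contDiff
  set f : SchwartzMap V ℂ := hc'.toSchwartzMap hs' with hf
  refine ⟨𝓕 f, fun w => ?_, fun q => ?_⟩
  · rw [SchwartzMap.fourier_coe, Real.fourier_eq']
    refine integral_congr_ae (Eventually.of_forall fun v => ?_)
    simp only [smul_eq_mul]
    congr 1
    rw [wave]
    congr 1
    rw [neg_apply, waveCovector_apply, L.apply_symm_apply, real_inner_comm]
    push_cast
    ring
  · have h1 : h q = f (L q) := by
      change h q = h (L.symm (L q))
      rw [L.symm_apply_apply]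
    have h2 : f (L q) = (𝓕⁻ (𝓕 f)) (L q) := by rw [FourierTransform.fourierInv_fourier_eq]
    rw [h1, h2, SchwartzMap.fourierInv_coe, Real.fourierInv_eq']
    refine integral_congr_ae (Eventually.of_forall fun w => ?_)
    simp only [smul_eq_mul]
    rw [mul_comm]
    congr 1
    rw [wave]
    congr 1
    rw [waveCovector_apply]
    push_cast
    ring

theorem integrable_schwartz_mul_pow (a : SchwartzMap V ℂ) {c : ℝ} (hc : 0 ≤ c) (k : ℕ) :
    Integrable (fun w : V => ‖a w‖ * (1 + c * ‖w‖) ^ k) := by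
  have h1 : Integrable (fun w : V => 2 ^ (k - 1) * (‖w‖ ^ 0 * ‖a w‖ + c ^ k * (‖w‖ ^ k * ‖a w‖))) :=
    ((a.integrable_pow_mul volume 0).add ((a.integrable_pow_mul volume k).const_mul _)).const_mul _
  refine h1.mono' ?_ (Eventually.of_forall fun w => ?_)
  · have : Continuous fun w : V => ‖a w‖ * (1 + c * ‖w‖) ^ k := by
      have := a.continuous
      fun_prop
    exact this.aestronglyMeasurable
  · rw [Real.norm_of_nonneg (by positivity)]
    have := add_pow_le (zero_le_one) (by positivity : 0 ≤ c * ‖w‖) k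
    calc ‖a w‖ * (1 + c * ‖w‖) ^ k ≤ ‖a w‖ * (2 ^ (k - 1) * (1 ^ k + (c * ‖w‖) ^ k)) := by gcongr
      _ = _ := by rw [mul_pow, one_pow]; ring

/-- A distribution commutes with a superposition of plane waves with Schwartz coefficients. -/
theorem ev_integral_wave (u : Distribution Ω ℂ ⊤) {f : E → ℂ} (hf : f ∈ testSpace (Ω : Set E))
    (a : SchwartzMap V ℂ) (ζ : E →L[ℝ] ℝ) (T : V →L[ℝ] (E →L[ℝ] ℝ)) :
    Integrable (fun w => a w * ev u (fun q => f q * wave (ζ + T w) q)) ∧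
    ev u (fun q => f q * wave ζ q * ∫ w, a w * wave (T w) q) =
      ∫ w, a w * ev u (fun q => f q * wave (ζ + T w) q) := by
  have hfK : f ∈ testSpace (tsupport f) := ⟨hf.1, hf.2.1, subset_rfl⟩
  set Ψ : V → E → ℂ := fun w q => a w * (f q * wave (ζ + T w) q) with hΨ
  have hΨs : ContDiff ℝ ∞ (Function.uncurry Ψ) := by
    have h1 : ContDiff ℝ ∞ fun p : V × E => a p.1 := (a.smooth ⊤).comp contDiff_fst
    have h2 : ContDiff ℝ ∞ fun p : V × E => f p.2 := hf.1.comp contDiff_snd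
    have h3 : ContDiff ℝ ∞ fun p : V × E => wave (ζ + T p.1) p.2 :=
      contDiff_wave_uncurry.comp
        ((contDiff_const.add (T.contDiff.comp contDiff_fst)).prodMk contDiff_snd)
    exact h1.mul (h2.mul h3)
  have hmem : ∀ w, (fun q => f q * wave (ζ + T w) q) ∈ testSpace (tsupport f) := fun w =>
    mul_mem_testSpace hfK (contDiff_wave _)
  have hmem' : ∀ w, Ψ w ∈ testSpace (tsupport f) := fun w => Submodule.smul_mem _ (a w) (hmem w)
  have key := ev_integral u hf.2.1.isCompact hf.2.2 hΨs volume (Eventually.of_forall hmem') (by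
    intro k
    obtain ⟨A, hA0, hA⟩ := norm_iteratedFDeriv_mul_wave_le hf.1 hf.2.1.isCompact k
    refine ⟨fun w => (A * (1 + ‖ζ‖) ^ k) * (‖a w‖ * (1 + ‖T‖ * ‖w‖) ^ k),
      (integrable_schwartz_mul_pow a (norm_nonneg T) k).const_mul _,
      Eventually.of_forall fun w x hx => ?_⟩
    have h1 : iteratedFDeriv ℝ k (Ψ w) x =
        a w • iteratedFDeriv ℝ k (fun q => f q * wave (ζ + T w) q) x := by
      have h0 : Ψ w = a w • fun q => f q * wave (ζ + T w) q := rfl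
      rw [h0]
      exact iteratedFDeriv_const_smul_apply ((hmem w).1.contDiffAt.of_le (mod_cast le_top))
    rw [h1, norm_smul]
    have h2 : 1 + ‖ζ + T w‖ ≤ (1 + ‖ζ‖) * (1 + ‖T‖ * ‖w‖) := by
      have := norm_add_le ζ (T w)
      have := T.le_opNorm w
      have : 0 ≤ ‖ζ‖ * (‖T‖ * ‖w‖) := by positivity
      nlinarith
    calc ‖a w‖ * ‖iteratedFDeriv ℝ k (fun q => f q * wave (ζ + T w) q) x‖
        ≤ ‖a w‖ * (A * (1 + ‖ζ + T w‖) ^ k) := by gcongr; exact hA k le_rfl x hx _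
      _ ≤ ‖a w‖ * (A * ((1 + ‖ζ‖) * (1 + ‖T‖ * ‖w‖)) ^ k) := by gcongr
      _ = _ := by rw [mul_pow]; ring)
  have hev : ∀ w, ev u (Ψ w) = a w * ev u (fun q => f q * wave (ζ + T w) q) := fun w =>
    ev_smul u (a w) (testSpace_mono hf.2.2 (hmem w))
  refine ⟨key.2.1.congr (Eventually.of_forall hev), ?_⟩
  have h3 : (fun q => f q * wave ζ q * ∫ w, a w * wave (T w) q) = fun q => ∫ w, Ψ w q := by
    ext q
    rw [← integral_const_mul]
    refine integral_congr_ae (Eventually.of_forall fun w => ?_)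
    simp only [hΨ, wave_add]
    ring
  rw [h3, key.2.2]
  exact integral_congr_ae (Eventually.of_forall hev)

end PlaneWaves

/-! ### Microlocal regularity in a direction -/

section Microlocal

variable {E : Type*} [NormedAddCommGroup E] [NormedSpace ℝ E] {Ω : Opens E}

/-- The Fourier transform of `f u` decays rapidly in a conic neighbourhood of the covector `η₀`. -/
def RapidDecayNear (u : Distribution Ω ℂ ⊤) (f : E → ℂ) (η₀ : E →L[ℝ] ℝ) : Prop :=
  ∃ Γ ∈ 𝓝 η₀, ∀ N : ℕ, ∃ C : ℝ, ∀ η ∈ Γ, ∀ t : ℝ, 0 < t →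
    (1 + ‖t • η‖) ^ N * ‖ev u (fun q => f q * wave (t • η) q)‖ ≤ C

theorem ev_eq_localizedFourier (u : Distribution Ω ℂ ⊤) (χ : 𝓓(Ω, ℝ)) (η : E →L[ℝ] ℝ) :
    ev u (fun q => (χ q : ℂ) * wave (-η) q) = localizedFourier u χ η := by
  set c : 𝓓(Ω, ℝ) := testMul (fun q => Real.cos (η q)) (Real.contDiff_cos.comp η.contDiff) χ
  set s : 𝓓(Ω, ℝ) := testMul (fun q => Real.sin (η q)) (Real.contDiff_sin.comp η.contDiff) χ
  have h1 : (fun q => (χ q : ℂ) * wave (-η) q) =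
      (fun q => (c q : ℂ)) + (-Complex.I) • (fun q => (s q : ℂ)) := by
    ext q
    simp only [wave, neg_apply, Pi.add_apply, Pi.smul_apply, smul_eq_mul, c, s, testMul_apply]
    rw [mul_comm Complex.I, Complex.exp_mul_I]
    push_cast
    rw [Complex.cos_neg, Complex.sin_neg]
    ring
  have hc := ofReal_comp_mem_testSpace c c.tsupport_subset
  have hs := ofReal_comp_mem_testSpace s s.tsupport_subset
  rw [h1, ev_add u hc (Submodule.smul_mem _ _ hs), ev_smul u _ hs, ev_ofReal, ev_ofReal,
    localizedFourier]
  ring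

theorem rapidDecayNear_of_notMem_wavefrontSet {u : Distribution Ω ℂ ⊤} {q : E} (hq : q ∈ Ω)
    {η : E →L[ℝ] ℝ} (hη : η ≠ 0) (h : (q, -η) ∉ wavefrontSet u) :
    ∃ χ ∈ testSpace (Ω : Set E), χ q ≠ 0 ∧ RapidDecayNear u χ η := by
  have h1 : ∃ χ : 𝓓(Ω, ℝ), χ q ≠ 0 ∧ ∃ Γ ∈ 𝓝 (-η), ∀ N : ℕ, ∃ C : ℝ, ∀ η ∈ Γ, ∀ t : ℝ, 0 < t →
      (1 + ‖t • η‖) ^ N * ‖localizedFourier u χ (t • η)‖ ≤ C := by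
    by_contra hcon
    exact h ⟨hq, neg_ne_zero.2 hη, hcon⟩
  obtain ⟨χ, hχ, Γ, hΓ, hdec⟩ := h1
  refine ⟨fun q => (χ q : ℂ), ofReal_comp_mem_testSpace χ χ.tsupport_subset,
    Complex.ofReal_ne_zero.2 hχ, -Γ, ?_, fun N => ?_⟩
  · have := (continuous_neg (G := E →L[ℝ] ℝ)).continuousAt (x := η) hΓ
    exact this
  · obtain ⟨C, hC⟩ := hdec N
    refine ⟨C, fun ξ hξ t ht => ?_⟩
    have h2 := hC (-ξ) hξ t ht
    rw [smul_neg, norm_neg] at h2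
    have h3 : wave (t • ξ) = wave (-(-(t • ξ))) := by rw [neg_neg]
    rw [h3, ev_eq_localizedFourier]
    exact h2

theorem RapidDecayNear.eventually {u : Distribution Ω ℂ ⊤} {f : E → ℂ} {η₀ : E →L[ℝ] ℝ}
    (h : RapidDecayNear u f η₀) : ∀ᶠ η in 𝓝 η₀, RapidDecayNear u f η := by
  obtain ⟨Γ, hΓ, hdec⟩ := h
  obtain ⟨U, hU, hUo, hη₀⟩ := mem_nhds_iff.1 hΓ
  filter_upwards [hUo.mem_nhds hη₀] with η hη
  exact ⟨Γ, mem_of_superset (hUo.mem_nhds hη) hU, hdec⟩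

variable [FiniteDimensional ℝ E]

/-- Microlocal regularity in a direction is not affected by the multiplication with a smooth
function: the Fourier transform of the product is a superposition of translates of the original
one, weighted by a rapidly decreasing function. -/
theorem RapidDecayNear.mul {u : Distribution Ω ℂ ⊤} {f g : E → ℂ}
    (hf : f ∈ testSpace (Ω : Set E)) (hg : ContDiff ℝ ∞ g) (hgc : HasCompactSupport g)
    {η₀ : E →L[ℝ] ℝ} (h : RapidDecayNear u f η₀) :
    RapidDecayNear u (fun q => f q * g q) η₀ := by
  obtain ⟨Γ, hΓ, hdec⟩ := h
  obtain ⟨ε, hε, hball⟩ := Metric.mem_nhds_iff.1 hΓ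
  let V := EuclideanSpace ℝ (Fin (Module.finrank ℝ E))
  let L : E ≃L[ℝ] V := ContinuousLinearEquiv.ofFinrankEq (by simp [V])
  obtain ⟨a, -, ha⟩ := exists_fourier_representation L hg hgc
  set T := waveCovector L
  obtain ⟨N₀, C₀, hC₀, hpoly⟩ := exists_ev_wave_le u hf
  refine ⟨Metric.ball η₀ (ε / 2), Metric.ball_mem_nhds _ (half_pos hε), fun N => ?_⟩
  obtain ⟨C₁, hC₁⟩ := hdec N
  set D : ℝ := 1 + 2 * (‖η₀‖ + ε) / ε with hD
  have hD1 : 1 ≤ D := by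
    have : 0 ≤ 2 * (‖η₀‖ + ε) / ε := by positivity
    linarith
  set C₂ : ℝ := |C₁| + D ^ N * (C₀ * (D + 1) ^ N₀) with hC₂
  have hpt : ∀ η ∈ Metric.ball η₀ (ε / 2), ∀ t : ℝ, 0 < t → ∀ w : V,
      (1 + ‖t • η‖) ^ N * ‖ev u (fun q => f q * wave (t • η + T w) q)‖ ≤
        C₂ * (1 + ‖T‖ * ‖w‖) ^ (N + N₀) := by
    intro η hη t ht w
    have hTw : ‖T w‖ ≤ ‖T‖ * ‖w‖ := T.le_opNorm w
    suffices hs : (1 + ‖t • η‖) ^ N * ‖ev u (fun q => f q * wave (t • η + T w) q)‖ ≤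
        C₂ * (1 + ‖T w‖) ^ (N + N₀) by
      refine hs.trans ?_
      have : 0 ≤ C₂ := by positivity
      gcongr
    have h1le : 1 ≤ 1 + ‖T w‖ := by linarith [norm_nonneg (T w)]
    have hC₂nn : 0 ≤ D ^ N * (C₀ * (D + 1) ^ N₀) := by positivity
    -- a translation by less than `t ε / 2` stays in the cone where the decay is rapid; a larger one
    -- dominates `‖t • η‖`, and there the polynomial bound is enough
    rcases lt_or_ge ‖T w‖ (t * (ε / 2)) with hlt | hge
    · set ξ := η + t⁻¹ • T w with hξ
      have hξΓ : ξ ∈ Γ := by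
        refine hball ?_
        rw [Metric.mem_ball, dist_eq_norm] at hη ⊢
        have h1 : ‖t⁻¹ • T w‖ < ε / 2 := by
          rw [norm_smul, norm_inv, Real.norm_of_nonneg ht.le, inv_mul_lt_iff₀ ht]
          exact hlt
        calc ‖ξ - η₀‖ = ‖(η - η₀) + t⁻¹ • T w‖ := by rw [hξ]; congr 1; abel
          _ ≤ ‖η - η₀‖ + ‖t⁻¹ • T w‖ := norm_add_le _ _
          _ < ε := by linarith
      have htξ : t • ξ = t • η + T w := by
        rw [hξ, smul_add, smul_smul, mul_inv_cancel₀ ht.ne', one_smul]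
      have h2 := hC₁ ξ hξΓ t ht
      rw [htξ] at h2
      have h3 : 1 + ‖t • η‖ ≤ (1 + ‖t • η + T w‖) * (1 + ‖T w‖) := by
        have := norm_sub_le (t • η + T w) (T w)
        rw [add_sub_cancel_right] at this
        have : 0 ≤ ‖t • η + T w‖ * ‖T w‖ := by positivity
        nlinarith
      calc (1 + ‖t • η‖) ^ N * ‖ev u (fun q => f q * wave (t • η + T w) q)‖
          ≤ ((1 + ‖t • η + T w‖) * (1 + ‖T w‖)) ^ N *
            ‖ev u (fun q => f q * wave (t • η + T w) q)‖ := by gcongr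
        _ = ((1 + ‖t • η + T w‖) ^ N * ‖ev u (fun q => f q * wave (t • η + T w) q)‖) *
            (1 + ‖T w‖) ^ N := by rw [mul_pow]; ring
        _ ≤ |C₁| * (1 + ‖T w‖) ^ N := by gcongr; exact h2.trans (le_abs_self _)
        _ ≤ C₂ * (1 + ‖T w‖) ^ (N + N₀) := by
          gcongr
          · rw [hC₂]; linarith
          · omega
    · have hηn : ‖η‖ ≤ ‖η₀‖ + ε := by
        rw [Metric.mem_ball, dist_eq_norm] at hη
        have := norm_sub_norm_le η η₀
        linarith
      have htη : ‖t • η‖ ≤ 2 * (‖η₀‖ + ε) / ε * ‖T w‖ := by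
        rw [norm_smul, Real.norm_of_nonneg ht.le]
        have h4 : t ≤ 2 / ε * ‖T w‖ := by
          rw [div_mul_eq_mul_div, le_div_iff₀ hε]
          linarith
        calc t * ‖η‖ ≤ (2 / ε * ‖T w‖) * (‖η₀‖ + ε) := by gcongr
          _ = _ := by ring
      have h5 : 1 + ‖t • η‖ ≤ D * (1 + ‖T w‖) := by
        rw [hD]
        have : 0 ≤ 2 * (‖η₀‖ + ε) / ε := by positivity
        nlinarith [norm_nonneg (T w)]
      have h6 : 1 + ‖t • η + T w‖ ≤ (D + 1) * (1 + ‖T w‖) := by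
        have := norm_add_le (t • η) (T w)
        nlinarith [norm_nonneg (T w)]
      calc (1 + ‖t • η‖) ^ N * ‖ev u (fun q => f q * wave (t • η + T w) q)‖
          ≤ (D * (1 + ‖T w‖)) ^ N * (C₀ * ((D + 1) * (1 + ‖T w‖)) ^ N₀) := by
            gcongr
            refine (hpoly _).trans ?_
            gcongr
        _ = (D ^ N * (C₀ * (D + 1) ^ N₀)) * (1 + ‖T w‖) ^ (N + N₀) := by
            rw [mul_pow, mul_pow, pow_add]; ring
        _ ≤ C₂ * (1 + ‖T w‖) ^ (N + N₀) := by
            gcongr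
            rw [hC₂]; linarith [abs_nonneg C₁]
  set I : ℝ := ∫ w : V, C₂ * (‖a w‖ * (1 + ‖T‖ * ‖w‖) ^ (N + N₀)) with hI
  refine ⟨I, fun η hη t ht => ?_⟩
  obtain ⟨hint, heq⟩ := ev_integral_wave u hf a (t • η) T
  have h7 : (fun q => f q * g q * wave (t • η) q) =
      fun q => f q * wave (t • η) q * ∫ w, a w * wave (T w) q := by
    ext q
    rw [← ha q]; ring
  rw [h7, heq]
  calc (1 + ‖t • η‖) ^ N * ‖∫ w, a w * ev u (fun q => f q * wave (t • η + T w) q)‖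
      ≤ (1 + ‖t • η‖) ^ N * ∫ w, ‖a w * ev u (fun q => f q * wave (t • η + T w) q)‖ := by
        gcongr
        exact norm_integral_le_integral_norm _
    _ = ∫ w, (1 + ‖t • η‖) ^ N * ‖a w * ev u (fun q => f q * wave (t • η + T w) q)‖ := by
        rw [integral_const_mul]
    _ ≤ I := by
        refine integral_mono (hint.norm.const_mul _)
          ((integrable_schwartz_mul_pow a (norm_nonneg T) _).const_mul _) fun w => ?_
        simp only [norm_mul]
        have := hpt η hη t ht w
        calc _ = ‖a w‖ * ((1 + ‖t • η‖) ^ N *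
              ‖ev u (fun q => f q * wave (t • η + T w) q)‖) := by ring
          _ ≤ ‖a w‖ * (C₂ * (1 + ‖T‖ * ‖w‖) ^ (N + N₀)) := by gcongr
          _ = _ := by ring

/-- If a distribution is microlocally regular at a point in all the directions of a subspace of
covectors, then all its localizations near this point have a Fourier transform which decays
rapidly along this subspace. -/
theorem exists_uniform_decay {W : Type*} [NormedAddCommGroup W] [NormedSpace ℝ W]
    [FiniteDimensional ℝ W] (u : Distribution Ω ℂ ⊤) {q₀ : E} (hq₀ : q₀ ∈ Ω)
    (J : W →L[ℝ] (E →L[ℝ] ℝ)) {c : ℝ} (hc : 0 < c) (hJ : ∀ w, c * ‖w‖ ≤ ‖J w‖)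
    (h : ∀ w, w ≠ 0 → ∃ χ ∈ testSpace (Ω : Set E), χ q₀ ≠ 0 ∧ RapidDecayNear u χ (J w)) :
    ∃ U : Set E, IsOpen U ∧ q₀ ∈ U ∧ U ⊆ Ω ∧ ∀ f ∈ testSpace U, ∀ N : ℕ, ∃ C : ℝ, ∀ w : W,
      (1 + ‖w‖) ^ N * ‖ev u (fun q => f q * wave (J w) q)‖ ≤ C := by
  have hsph : IsCompact (Metric.sphere (0 : W) 1) := isCompact_sphere _ _
  have hne : ∀ w ∈ Metric.sphere (0 : W) 1, w ≠ 0 := fun w hw h0 => by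
    rw [mem_sphere_zero_iff_norm, h0, norm_zero] at hw
    exact zero_ne_one hw
  choose! χ hχΩ hχ0 hχ using h
  have hev : ∀ w ∈ Metric.sphere (0 : W) 1, ∀ᶠ w' in 𝓝 w, RapidDecayNear u (χ w) (J w') :=
    fun w hw => J.continuous.continuousAt.eventually (hχ w (hne w hw)).eventually
  obtain ⟨s, hs, hcov⟩ := hsph.elim_nhds_subcover
    (fun w => {w' | RapidDecayNear u (χ w) (J w')}) hev
  refine ⟨(Ω : Set E) ∩ ⋂ w ∈ s, {q | χ w q ≠ 0}, ?_, ?_, inter_subset_left, ?_⟩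
  · refine Ω.isOpen.inter (isOpen_biInter_finset fun w hw => ?_)
    exact isOpen_ne_fun (hχΩ w (hne w (hs w hw))).1.continuous continuous_const
  · exact ⟨hq₀, mem_iInter₂.2 fun w hw => hχ0 w (hne w (hs w hw))⟩
  intro f hf N
  have hfΩ : f ∈ testSpace (Ω : Set E) := testSpace_mono inter_subset_left hf
  -- a cutoff without zeros on the support of `f` can be divided out
  have hdecf : ∀ w ∈ Metric.sphere (0 : W) 1, RapidDecayNear u f (J w) := by
    intro w hw
    obtain ⟨w', hw's, hw'⟩ := mem_iUnion₂.1 (hcov hw)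
    have hχ' := (hχΩ w' (hne w' (hs w' hw's)))
    have hnz : ∀ q ∈ tsupport f, χ w' q ≠ 0 := fun q hq => by
      have := (hf.2.2 hq).2
      exact mem_iInter₂.1 this w' hw's
    have hquot : ContDiff ℝ ∞ (fun q => f q / χ w' q) := by
      refine contDiff_iff_contDiffAt.2 fun q => ?_
      by_cases hq : q ∈ tsupport f
      · simp only [div_eq_mul_inv]
        exact hf.1.contDiffAt.mul (hχ'.1.contDiffAt.inv (hnz q hq))
      · have h0 : (fun q => f q / χ w' q) =ᶠ[𝓝 q] fun _ => 0 := by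
          filter_upwards [(isClosed_tsupport f).isOpen_compl.mem_nhds hq] with x hx
          rw [image_eq_zero_of_notMem_tsupport hx, zero_div]
        exact contDiffAt_const.congr_of_eventuallyEq h0
    have hquotc : HasCompactSupport (fun q => f q / χ w' q) := by
      refine hf.2.1.mono fun q hq => ?_
      intro h0
      exact hq (by simp only [h0, zero_div])
    have h1 := RapidDecayNear.mul hχ' hquot hquotc hw'
    have h2 : (fun q => χ w' q * (f q / χ w' q)) = f := by
      ext q
      by_cases hq : q ∈ tsupport f
      · rw [mul_div_cancel₀ _ (hnz q hq)]
      · rw [image_eq_zero_of_notMem_tsupport hq, zero_div, mul_zero]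
    rwa [h2] at h1
  have hloc : ∀ w ∈ Metric.sphere (0 : W) 1, ∃ Γ ∈ 𝓝 w, ∃ C : ℝ, ∀ w' ∈ Γ, ∀ t : ℝ, 0 < t →
      (1 + ‖J (t • w')‖) ^ N * ‖ev u (fun q => f q * wave (J (t • w')) q)‖ ≤ C := by
    intro w hw
    obtain ⟨Γ, hΓ, hdec⟩ := hdecf w hw
    obtain ⟨C, hC⟩ := hdec N
    refine ⟨J ⁻¹' Γ, J.continuous.continuousAt hΓ, C, fun w' hw' t ht => ?_⟩
    rw [map_smul]
    exact hC (J w') hw' t ht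
  choose! Γ hΓ C hC using hloc
  obtain ⟨s', hs', hcov'⟩ := hsph.elim_nhds_subcover Γ hΓ
  set M : ℝ := max 1 c⁻¹ with hM
  have hM1 : 1 ≤ M := le_max_left _ _
  have hMc : ∀ w : W, 1 + ‖w‖ ≤ M * (1 + ‖J w‖) := by
    intro w
    have h1 : ‖w‖ ≤ c⁻¹ * ‖J w‖ := by
      rw [inv_mul_eq_div, le_div_iff₀ hc, mul_comm]
      exact hJ w
    have h2 : c⁻¹ * ‖J w‖ ≤ M * ‖J w‖ := by gcongr; exact le_max_right _ _
    linarith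
  refine ⟨‖ev u (fun q => f q * wave (J 0) q)‖ + M ^ N * ∑ w ∈ s', |C w|, fun w => ?_⟩
  have hsum : 0 ≤ ∑ w ∈ s', |C w| := Finset.sum_nonneg fun _ _ => abs_nonneg _
  rcases eq_or_ne w 0 with rfl | hw
  · rw [norm_zero, add_zero, one_pow, one_mul]
    have : 0 ≤ M ^ N * ∑ w ∈ s', |C w| := by positivity
    linarith
  · have hwn : 0 < ‖w‖ := norm_pos_iff.2 hw
    have hunit : ‖w‖⁻¹ • w ∈ Metric.sphere (0 : W) 1 := by
      rw [mem_sphere_zero_iff_norm, norm_smul, norm_inv, norm_norm, inv_mul_cancel₀ hwn.ne']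
    obtain ⟨w', hw's, hw'⟩ := mem_iUnion₂.1 (hcov' hunit)
    have h1 := hC w' (hs' w' hw's) _ hw' ‖w‖ hwn
    rw [smul_smul, mul_inv_cancel₀ hwn.ne', one_smul] at h1
    have h2 : |C w'| ≤ ∑ w ∈ s', |C w| :=
      Finset.single_le_sum (f := fun w => |C w|) (fun _ _ => abs_nonneg _) hw's
    have h3 : (1 + ‖w‖) ^ N ≤ (M * (1 + ‖J w‖)) ^ N := by gcongr; exact hMc w
    calc (1 + ‖w‖) ^ N * ‖ev u (fun q => f q * wave (J w) q)‖
        ≤ (M * (1 + ‖J w‖)) ^ N * ‖ev u (fun q => f q * wave (J w) q)‖ := by gcongr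
      _ = M ^ N * ((1 + ‖J w‖) ^ N * ‖ev u (fun q => f q * wave (J w) q)‖) := by
          rw [mul_pow]; ring
      _ ≤ M ^ N * ∑ w ∈ s', |C w| := by
          gcongr
          exact h1.trans ((le_abs_self _).trans h2)
      _ ≤ _ := by linarith [norm_nonneg (ev u (fun q => f q * wave (J 0) q))]

end Microlocal

/-! ### Decay under expansions -/

section Expansion

variable {Y : Type*} [NormedAddCommGroup Y] [NormedSpace ℝ Y] [FiniteDimensional ℝ Y]
  [MeasurableSpace Y] [BorelSpace Y]
  {V : Type*} [NormedAddCommGroup V] [InnerProductSpace ℝ V] [FiniteDimensional ℝ V]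
  [MeasurableSpace V] [BorelSpace V]

theorem exists_integral_comp_symm_eq (ν : Measure Y) [ν.IsAddHaarMeasure] (L : Y ≃L[ℝ] V) :
    ∃ c : NNReal, ∀ g : Y → ℂ, ∫ v, g (L.symm v) = (c : ℝ) • ∫ y, g y ∂ν := by
  have : (Measure.map L.symm (volume : Measure V)).IsAddHaarMeasure :=
    L.symm.isAddHaarMeasure_map volume
  have hme : MeasurableEmbedding (L.symm : V → Y) :=
    L.symm.toHomeomorph.measurableEmbedding
  refine ⟨Measure.addHaarScalarFactor (Measure.map L.symm (volume : Measure V)) ν, fun g => ?_⟩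
  rw [← hme.integral_map]
  have e := Measure.isAddLeftInvariant_eq_smul (Measure.map L.symm (volume : Measure V)) ν
  exact (congrArg (fun m => ∫ y, g y ∂m) e).trans (integral_smul_nnreal_measure _ _)

/-- If all the moments of order at most `K` of a test function vanish, its Fourier transform
vanishes at the origin to the order `K + 1`. -/
theorem exists_fourier_le_pow (ν : Measure Y) [ν.IsAddHaarMeasure] (L : Y ≃L[ℝ] V) {h : Y → ℂ}
    (hs : ContDiff ℝ ∞ h) (hc : HasCompactSupport h) (K : ℕ)
    (hmom : ∀ ℓ : Y →L[ℝ] ℝ, ∀ k ≤ K, ∫ y, h y * (ℓ y : ℂ) ^ k ∂ν = 0) {a : SchwartzMap V ℂ}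
    (ha : ∀ w, a w = ∫ v, wave (-(waveCovector L w)) (L.symm v) * h (L.symm v)) :
    ∃ C : ℝ, 0 ≤ C ∧ ∀ w, ‖a w‖ ≤ C * ‖w‖ ^ (K + 1) := by
  obtain ⟨c, hcint⟩ := exists_integral_comp_symm_eq ν L
  set T := waveCovector L
  have hint : ∀ g : Y → ℂ, Continuous g → Integrable (fun y => h y * g y) ν := fun g hg =>
    (hs.continuous.mul hg).integrable_of_hasCompactSupport hc.mul_right
  obtain ⟨R, hR⟩ : ∃ R : ℝ, ∀ y ∈ tsupport h, ‖y‖ ≤ R := hc.isCompact.isBounded.exists_norm_le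
  set R' : ℝ := ‖T‖ * |R| with hR'
  have hR'0 : 0 ≤ R' := by positivity
  set I : ℝ := ∫ y, ‖h y‖ ∂ν with hI
  have hI0 : 0 ≤ I := integral_nonneg fun _ => norm_nonneg _
  have hsmall : ∀ w, ‖w‖ ≤ 1 → ‖a w‖ ≤ (c * (R' ^ (K + 1) * Real.exp R' * I)) * ‖w‖ ^ (K + 1) := by
    intro w hw
    have h1 : a w = (c : ℝ) • ∫ y, h y * (wave (-(T w)) y -
        ∑ m ∈ Finset.range (K + 1), (Complex.I * ((-(T w)) y : ℂ)) ^ m / m.factorial) ∂ν := by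
      rw [ha w, hcint (fun y => wave (-(T w)) y * h y)]
      congr 1
      simp_rw [mul_sub]
      rw [integral_sub (hint _ (contDiff_wave _).continuous)
        (hint _ (by fun_prop))]
      have h2 : ∫ y, h y * ∑ m ∈ Finset.range (K + 1),
          (Complex.I * ((-(T w)) y : ℂ)) ^ m / m.factorial ∂ν = 0 := by
        simp_rw [Finset.mul_sum]
        rw [integral_finsetSum _ fun m _ => hint _ (by fun_prop)]
        refine Finset.sum_eq_zero fun m hm => ?_
        have h3 : ∀ y, h y * ((Complex.I * ((-(T w)) y : ℂ)) ^ m / m.factorial) =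
            (Complex.I ^ m / m.factorial) * (h y * ((-(T w)) y : ℂ) ^ m) := fun y => by
          rw [mul_pow]; ring
        simp_rw [h3]
        rw [integral_const_mul, hmom _ m (Nat.lt_succ_iff.1 (Finset.mem_range.1 hm)), mul_zero]
      rw [h2, sub_zero]
      simp_rw [mul_comm]
    rw [h1, norm_smul]
    have h4 : ‖∫ y, h y * (wave (-(T w)) y -
        ∑ m ∈ Finset.range (K + 1), (Complex.I * ((-(T w)) y : ℂ)) ^ m / m.factorial) ∂ν‖ ≤
        ∫ y, ‖h y‖ * ((R' * ‖w‖) ^ (K + 1) * Real.exp R') ∂ν := by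
      refine norm_integral_le_of_norm_le ?_ (Eventually.of_forall fun y => ?_)
      · exact (hs.continuous.integrable_of_hasCompactSupport hc).norm.mul_const _
      · rw [norm_mul]
        by_cases hy : y ∈ tsupport h
        · have h5 := Complex.norm_exp_sub_sum_le_norm_mul_exp (Complex.I * ((-(T w)) y : ℂ)) (K + 1)
          have h6 : ‖Complex.I * ((-(T w)) y : ℂ)‖ ≤ R' * ‖w‖ := by
            rw [norm_mul, Complex.norm_I, one_mul, Complex.norm_real, neg_apply, norm_neg]
            calc ‖T w y‖ ≤ ‖T w‖ * ‖y‖ := (T w).le_opNorm y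
              _ ≤ (‖T‖ * ‖w‖) * |R| := by
                gcongr
                · exact T.le_opNorm w
                · exact (hR y hy).trans (le_abs_self _)
              _ = _ := by rw [hR']; ring
          have h7 : R' * ‖w‖ ≤ R' := by nlinarith
          refine mul_le_mul_of_nonneg_left (h5.trans ?_) (norm_nonneg _)
          gcongr
          exact h6.trans h7
        · rw [image_eq_zero_of_notMem_tsupport hy, norm_zero, zero_mul, zero_mul]
    rw [integral_mul_const] at h4
    rw [Real.norm_of_nonneg (NNReal.coe_nonneg c)]
    calc _ ≤ (c : ℝ) * (I * ((R' * ‖w‖) ^ (K + 1) * Real.exp R')) := by gcongr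
      _ = _ := by rw [mul_pow]; ring
  obtain ⟨A, hA0, hA⟩ := a.decay 0 0
  refine ⟨max A (c * (R' ^ (K + 1) * Real.exp R' * I)), hA0.le.trans (le_max_left _ _), fun w => ?_⟩
  rcases le_or_gt ‖w‖ 1 with hw | hw
  · refine (hsmall w hw).trans ?_
    gcongr
    exact le_max_right _ _
  · have h8 := hA w
    rw [pow_zero, one_mul, norm_iteratedFDeriv_zero] at h8
    have h9 : 1 ≤ ‖w‖ ^ (K + 1) := one_le_pow₀ hw.le
    have h10 := le_max_left A (c * (R' ^ (K + 1) * Real.exp R' * I))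
    nlinarith [hA0.le.trans h10]

variable {E : Type*} [NormedAddCommGroup E] [NormedSpace ℝ E] {Ω : Opens E}

/-- Let the Fourier transform of `f u` decay rapidly along the covectors which factor through
`π : E → Y`. If the moments of order at most `K` of a test function `h` on `Y` vanish, the pairing
of `f u` with the concentrated functions `h ∘ A ∘ π`, where the linear map `A` expands by at least
`ρ`, is of order `ρ ^ -(K + 1)`. -/
theorem exists_ev_expansion_le (ν : Measure Y) [ν.IsAddHaarMeasure] (u : Distribution Ω ℂ ⊤)
    {f : E → ℂ} (hf : f ∈ testSpace (Ω : Set E)) (π : E →L[ℝ] Y)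
    (hdec : ∀ N : ℕ, ∃ C : ℝ, ∀ ℓ : Y →L[ℝ] ℝ,
      (1 + ‖ℓ‖) ^ N * ‖ev u (fun q => f q * wave (ℓ.comp π) q)‖ ≤ C)
    {h : Y → ℂ} (hs : ContDiff ℝ ∞ h) (hc : HasCompactSupport h) (K : ℕ)
    (hmom : ∀ ℓ : Y →L[ℝ] ℝ, ∀ k ≤ K, ∫ y, h y * (ℓ y : ℂ) ^ k ∂ν = 0) :
    ∃ C : ℝ, ∀ (A : Y →L[ℝ] Y) (ρ : ℝ), 1 ≤ ρ → (∀ ℓ : Y →L[ℝ] ℝ, ρ * ‖ℓ‖ ≤ ‖ℓ.comp A‖) →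
      ρ ^ (K + 1) * ‖ev u (fun q => f q * h (A (π q)))‖ ≤ C := by
  let V := EuclideanSpace ℝ (Fin (Module.finrank ℝ Y))
  let L : Y ≃L[ℝ] V := ContinuousLinearEquiv.ofFinrankEq (by simp [V])
  obtain ⟨a, ha, hrep⟩ := exists_fourier_representation L hs hc
  set T := waveCovector L
  obtain ⟨C₁, hC₁0, hC₁⟩ := exists_fourier_le_pow ν L hs hc K hmom ha
  obtain ⟨b, hb0, hb⟩ := norm_le_waveCovector L
  -- `K + 1` powers of the rapid decay absorb the expansion, the other `d` make the integral converge
  set d := Module.finrank ℝ V + 1 with hd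
  obtain ⟨C₂, hC₂⟩ := hdec (K + 1 + d)
  set b' := min 1 b with hb'
  have hb'0 : 0 < b' := lt_min one_pos hb0
  have hint1 : Integrable (fun w : V => (1 + ‖w‖) ^ (-(d : ℝ))) :=
    integrable_one_add_norm (by rw [hd]; push_cast; linarith)
  have hC₂0 : 0 ≤ C₂ := le_trans (by positivity) (hC₂ 0)
  refine ⟨∫ w : V, (C₁ * C₂ / (b ^ (K + 1) * b' ^ d)) * (1 + ‖w‖) ^ (-(d : ℝ)),
    fun A ρ hρ hA => ?_⟩
  set S : V →L[ℝ] (E →L[ℝ] ℝ) :=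
    ((ContinuousLinearMap.compL ℝ E Y ℝ).flip (A.comp π)).comp T with hS
  have hSw : ∀ w, S w = ((T w).comp A).comp π := fun w => rfl
  obtain ⟨hint, heq⟩ := ev_integral_wave u hf a 0 S
  have h1 : (fun q => f q * h (A (π q))) =
      fun q => f q * wave 0 q * ∫ w, a w * wave (S w) q := by
    ext q
    have h0 : wave (0 : E →L[ℝ] ℝ) q = 1 := by simp [wave]
    rw [h0, mul_one, hrep (A (π q))]
    rfl
  rw [h1, heq]
  simp only [zero_add] at hint ⊢
  calc ρ ^ (K + 1) * ‖∫ w, a w * ev u (fun q => f q * wave (S w) q)‖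
      ≤ ρ ^ (K + 1) * ∫ w, ‖a w * ev u (fun q => f q * wave (S w) q)‖ := by
        gcongr
        exact norm_integral_le_integral_norm _
    _ = ∫ w, ρ ^ (K + 1) * ‖a w * ev u (fun q => f q * wave (S w) q)‖ := by
        rw [integral_const_mul]
    _ ≤ _ := by
        refine integral_mono (hint.norm.const_mul _) (hint1.const_mul _) fun w => ?_
        have h2 := hC₂ ((T w).comp A)
        rw [← hSw] at h2
        set ℓ := (T w).comp A
        set e := ‖ev u (fun q => f q * wave (S w) q)‖
        have hℓ : ρ * (b * ‖w‖) ≤ ‖ℓ‖ := le_trans (by gcongr; exact hb w) (hA (T w))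
        have hℓ2 : b' * (1 + ‖w‖) ≤ 1 + ‖ℓ‖ := by
          have h3 : b' * 1 ≤ 1 := by rw [mul_one]; exact min_le_left _ _
          have h4 : b' * ‖w‖ ≤ b * ‖w‖ := by gcongr; exact min_le_right _ _
          have h5 : b * ‖w‖ ≤ ρ * (b * ‖w‖) := le_mul_of_one_le_left (by positivity) hρ
          linarith
        have h6 : (ρ * (b * ‖w‖)) ^ (K + 1) * (b' * (1 + ‖w‖)) ^ d * e ≤ C₂ := by
          refine le_trans ?_ h2
          rw [pow_add _ (K + 1) d]
          gcongr
          linarith [hℓ]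
        have hrp : (1 + ‖w‖) ^ (-(d : ℝ)) = ((1 + ‖w‖) ^ d)⁻¹ := by
          rw [Real.rpow_neg (by positivity), Real.rpow_natCast]
        simp only [norm_mul]
        rw [hrp, ← div_eq_mul_inv, le_div_iff₀ (by positivity), le_div_iff₀ (by positivity)]
        calc ρ ^ (K + 1) * (‖a w‖ * e) * (1 + ‖w‖) ^ d * (b ^ (K + 1) * b' ^ d)
            ≤ ρ ^ (K + 1) * ((C₁ * ‖w‖ ^ (K + 1)) * e) * (1 + ‖w‖) ^ d *
                (b ^ (K + 1) * b' ^ d) := by gcongr; exact hC₁ w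
          _ = C₁ * ((ρ * (b * ‖w‖)) ^ (K + 1) * (b' * (1 + ‖w‖)) ^ d * e) := by
              simp only [mul_pow]; ring
          _ ≤ C₁ * C₂ := by gcongr

end Expansion

/-! ### Supports and Lie derivatives along linear fields -/

section LinearField

variable {E : Type*} [NormedAddCommGroup E] [NormedSpace ℝ E] [FiniteDimensional ℝ E] {Ω : Opens E}

/-- A distribution vanishes on the test functions whose support avoids its support. -/
theorem ev_eq_zero_of_disjoint_dsupport (u : Distribution Ω ℂ ⊤) {f : E → ℂ}
    (hf : f ∈ testSpace (Ω : Set E)) (hd : Disjoint (tsupport f) (Distribution.dsupport u)) :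
    ev u f = 0 := by
  have hloc : ∀ x : tsupport f, ∃ s : Set E, Distribution.IsVanishingOn u s ∧ IsOpen s ∧
      (x : E) ∈ s := fun x =>
    Distribution.notMem_dsupport_iff _ |>.1 fun hx => (Set.disjoint_left.1 hd x.2 hx)
  choose s hs hso hxs using hloc
  obtain ⟨ρ, hρ⟩ := SmoothPartitionOfUnity.exists_isSubordinate 𝓘(ℝ, E) (s := tsupport f)
    (isClosed_tsupport f) s hso (fun x hx => mem_iUnion.2 ⟨⟨x, hx⟩, hxs _⟩)
  have hfin := ρ.locallyFinite.finite_nonempty_inter_compact hf.2.1.isCompact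
  have hsmooth : ∀ i, ContDiff ℝ ∞ fun x => ((ρ i x : ℝ) : ℂ) := fun i =>
    Complex.ofRealCLM.contDiff.comp (ρ i).contMDiff.contDiff
  have hsum : f = ∑ i ∈ hfin.toFinset, fun x => f x * ((ρ i x : ℝ) : ℂ) := by
    ext x
    rw [Finset.sum_apply, ← Finset.mul_sum]
    by_cases hx : x ∈ tsupport f
    · have h1 := ρ.sum_eq_one hx
      rw [finsum_eq_sum_of_support_subset (s := hfin.toFinset)] at h1
      · rw [← Complex.ofReal_sum, h1, Complex.ofReal_one, mul_one]
      · intro i hi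
        simp only [Finite.coe_toFinset, mem_ofPred_eq]
        exact ⟨x, hi, hx⟩
    · rw [image_eq_zero_of_notMem_tsupport hx, zero_mul]
  rw [hsum, ev_sum u _ fun i _ => mul_mem_testSpace hf (hsmooth i)]
  refine Finset.sum_eq_zero fun i _ => ?_
  refine ev_eq_zero_of_forall_re_im u fun ψ hψ => hs i ψ (hψ.trans ?_)
  refine subset_trans ?_ (hρ i)
  refine (tsupport_mul_subset_right (f := f)).trans ?_
  exact tsupport_comp_subset (g := fun r : ℝ => (r : ℂ)) Complex.ofReal_zero _

/-- Conversely, points around which a distribution annihilates all complex test functions are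
outside of its support. -/
theorem notMem_dsupport_of_ev (u : Distribution Ω ℂ ⊤) {x : E} {s : Set E} (hs : s ∈ 𝓝 x)
    (h : ∀ f ∈ testSpace (Ω : Set E), tsupport f ⊆ s → ev u f = 0) :
    x ∉ Distribution.dsupport u := by
  rw [Distribution.notMem_dsupport_iff]
  refine ⟨interior s, fun ψ hψ => ?_, isOpen_interior, mem_interior_iff_mem_nhds.2 hs⟩
  rw [← ev_ofReal]
  refine h _ (ofReal_comp_mem_testSpace ψ ψ.tsupport_subset) ?_
  exact (tsupport_comp_subset Complex.ofReal_zero ψ).trans (hψ.trans interior_subset)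

theorem ev_add_left (u v : Distribution Ω ℂ ⊤) (f : E → ℂ) : ev (u + v) f = ev u f + ev v f := by
  by_cases hf : f ∈ testSpace (Ω : Set E)
  · rw [ev_of_mem _ hf, ev_of_mem _ hf, ev_of_mem _ hf]
    change (u + v) _ + Complex.I * (u + v) _ = u _ + Complex.I * u _ + (v _ + Complex.I * v _)
    rw [add_apply, add_apply]
    ring
  · simp [ev, hf]

theorem ev_smul_left (c : ℂ) (u : Distribution Ω ℂ ⊤) (f : E → ℂ) : ev (c • u) f = c * ev u f := by
  by_cases hf : f ∈ testSpace (Ω : Set E)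
  · rw [ev_of_mem _ hf, ev_of_mem _ hf]
    change (c • u) _ + Complex.I * (c • u) _ = c * (u _ + Complex.I * u _)
    rw [smul_apply, smul_apply, smul_eq_mul, smul_eq_mul]
    ring
  · simp [ev, hf]

@[simp]
theorem ev_zero_left (f : E → ℂ) : ev (0 : Distribution Ω ℂ ⊤) f = 0 := by
  simpa using ev_smul_left 0 (0 : Distribution Ω ℂ ⊤) f

/-- The divergence of `f A`, where `A` is the linear field `q ↦ A q`. -/
def divField (A : E →L[ℝ] E) (f : E → ℂ) (q : E) : ℂ :=
  fderiv ℝ f q (A q) + ((LinearMap.trace ℝ E A.toLinearMap : ℝ) : ℂ) * f q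

theorem divField_eq (A : E →L[ℝ] E) (f : E → ℂ) :
    divField A f = (fun q => fderiv ℝ f q (A q)) +
      ((LinearMap.trace ℝ E A.toLinearMap : ℝ) : ℂ) • f := rfl

theorem divField_mem_testSpace (A : E →L[ℝ] E) {S : Set E} {f : E → ℂ} (hf : f ∈ testSpace S) :
    divField A f ∈ testSpace S := by
  rw [divField_eq]
  exact add_mem (fderiv_apply_mem_testSpace hf A.contDiff) (Submodule.smul_mem _ _ hf)

theorem testDiv_testMul_apply (A : E →L[ℝ] E) (ψ : 𝓓(Ω, ℝ)) (q : E) :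
    testDiv (testMul A A.contDiff ψ) q =
      fderiv ℝ ψ q (A q) + LinearMap.trace ℝ E A.toLinearMap * ψ q := by
  rw [testDiv_apply]
  have h1 : HasFDerivAt (testMul A A.contDiff ψ)
      (ψ q • A + (fderiv ℝ ψ q).smulRight (A q)) q :=
    ((ψ.contDiff.differentiable (by simp)) q).hasFDerivAt.smul A.hasFDerivAt
  rw [h1.fderiv]
  have h2 : (ψ q • A + (fderiv ℝ ψ q).smulRight (A q)).toLinearMap =
      ψ q • A.toLinearMap + (fderiv ℝ ψ q).toLinearMap.smulRight (A q) := rfl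
  rw [h2, map_add, map_smul, LinearMap.trace_smulRight, smul_eq_mul]
  change _ + fderiv ℝ ψ q (A q) = _
  ring

theorem ev_lieDerivative (A : E →L[ℝ] E) (u : Distribution Ω ℂ ⊤) {f : E → ℂ}
    (hf : f ∈ testSpace (Ω : Set E)) :
    ev (lieDerivative A A.contDiff u) f = - ev u (divField A f) := by
  have hg := divField_mem_testSpace A hf
  rw [ev_of_mem _ hf, ev_of_mem _ hg]
  have h1 : testDiv (testMul A A.contDiff (reTest ⟨f, hf⟩)) = reTest ⟨_, hg⟩ := by
    ext q
    rw [testDiv_testMul_apply]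
    have h : HasFDerivAt (fun x => (f x).re) (Complex.reCLM.comp (fderiv ℝ f q)) q :=
      Complex.reCLM.hasFDerivAt.comp q ((hf.1.differentiable (by simp)) q).hasFDerivAt
    have e : fderiv ℝ (reTest ⟨f, hf⟩) q = Complex.reCLM.comp (fderiv ℝ f q) := h.fderiv
    rw [e]
    change _ = (divField A f q).re
    simp only [divField, Complex.add_re, Complex.re_ofReal_mul]
    rfl
  have h2 : testDiv (testMul A A.contDiff (imTest ⟨f, hf⟩)) = imTest ⟨_, hg⟩ := by
    ext q
    rw [testDiv_testMul_apply]
    have h : HasFDerivAt (fun x => (f x).im) (Complex.imCLM.comp (fderiv ℝ f q)) q :=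
      Complex.imCLM.hasFDerivAt.comp q ((hf.1.differentiable (by simp)) q).hasFDerivAt
    have e : fderiv ℝ (imTest ⟨f, hf⟩) q = Complex.imCLM.comp (fderiv ℝ f q) := h.fderiv
    rw [e]
    change _ = (divField A f q).im
    simp only [divField, Complex.add_im, Complex.im_ofReal_mul]
    rfl
  change lieDerivative A A.contDiff u _ + Complex.I * lieDerivative A A.contDiff u _ =
    -(u _ + Complex.I * u _)
  rw [lieDerivative_apply, lieDerivative_apply, h1, h2]
  ring

/-- The operator `L_A + μ` on distributions, for the linear field `A`. -/
def shiftedLie (A : E →L[ℝ] E) (μ : ℂ) (u : Distribution Ω ℂ ⊤) : Distribution Ω ℂ ⊤ :=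
  lieDerivative A A.contDiff u + μ • u

theorem ev_shiftedLie (A : E →L[ℝ] E) (μ : ℂ) (u : Distribution Ω ℂ ⊤) {f : E → ℂ}
    (hf : f ∈ testSpace (Ω : Set E)) :
    ev (shiftedLie A μ u) f = μ * ev u f - ev u (divField A f) := by
  rw [shiftedLie, ev_add_left, ev_smul_left, ev_lieDerivative A u hf]
  ring

/-- `shiftedLie` is local. -/
theorem ev_shiftedLie_iterate_eq_zero (A : E →L[ℝ] E) (μ : ℂ) (u : Distribution Ω ℂ ⊤) (s : Set E)
    (h : ∀ f ∈ testSpace (Ω : Set E), tsupport f ⊆ s → ev u f = 0) (j : ℕ) :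
    ∀ f ∈ testSpace (Ω : Set E), tsupport f ⊆ s → ev ((shiftedLie A μ)^[j] u) f = 0 := by
  induction j with
  | zero => exact h
  | succ j ih =>
    intro f hf hs
    rw [Function.iterate_succ_apply', ev_shiftedLie A μ _ hf, ih f hf hs, ih _
      (divField_mem_testSpace A hf) ((divField_mem_testSpace A
        (⟨hf.1, hf.2.1, hs⟩ : f ∈ testSpace s)).2.2)]
    simp

end LinearField

/-! ### Linear flows and the evolution of generalized eigendistributions -/

section LinearFlow

variable {E : Type*} [NormedAddCommGroup E] [NormedSpace ℝ E]

/-- `Φ` is the linear flow `t ↦ exp (t A)` of the linear field `A`. -/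
structure IsLinearFlow (A : E →L[ℝ] E) (Φ : ℝ → E →L[ℝ] E) : Prop where
  smooth : ContDiff ℝ ∞ fun p : ℝ × E => Φ p.1 p.2
  zero : ∀ q, Φ 0 q = q
  add : ∀ s t q, Φ (s + t) q = Φ s (Φ t q)
  deriv : ∀ t q, HasDerivAt (fun s => Φ s q) (A (Φ t q)) t

namespace IsLinearFlow

variable {A : E →L[ℝ] E} {Φ : ℝ → E →L[ℝ] E} (hΦ : IsLinearFlow A Φ)

include hΦ

theorem neg_apply_apply (t : ℝ) (q : E) : Φ (-t) (Φ t q) = q := by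
  rw [← hΦ.add, neg_add_cancel, hΦ.zero]

theorem apply_neg_apply (t : ℝ) (q : E) : Φ t (Φ (-t) q) = q := by
  rw [← hΦ.add, add_neg_cancel, hΦ.zero]

theorem commute (t : ℝ) (q : E) : A (Φ t q) = Φ t (A q) := by
  have h1 : HasDerivAt (fun s => Φ t (Φ s q)) (Φ t (A q)) 0 := by
    have := (Φ t).hasFDerivAt.comp_hasDerivAt 0 (hΦ.deriv 0 q)
    rwa [hΦ.zero] at this
  have h2 : HasDerivAt (fun s => Φ (t + s) q) (A (Φ t q)) 0 := by
    have h : HasDerivAt (fun s => Φ s q) (A (Φ t q)) (t + 0) := by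
      rw [add_zero]; exact hΦ.deriv t q
    exact h.comp_const_add t 0
  simp_rw [hΦ.add] at h2
  exact h2.unique h1

theorem continuous : Continuous fun p : ℝ × E => Φ p.1 p.2 := hΦ.smooth.continuous

end IsLinearFlow

variable [FiniteDimensional ℝ E] {Ω : Opens E}

/-- The transport of densities by a linear flow: `f ↦ e^{t tr A} f ∘ Φ_t`. -/
def transport (A : E →L[ℝ] E) (Φ : ℝ → E →L[ℝ] E) (f : E → ℂ) (t : ℝ) (q : E) : ℂ :=
  Complex.exp (t * ((LinearMap.trace ℝ E A.toLinearMap : ℝ) : ℂ)) * f (Φ t q)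

theorem contDiff_transport {A : E →L[ℝ] E} {Φ : ℝ → E →L[ℝ] E} (hΦ : IsLinearFlow A Φ)
    {f : E → ℂ} (hf : ContDiff ℝ ∞ f) :
    ContDiff ℝ ∞ (Function.uncurry (transport A Φ f)) := by
  have h1 : ContDiff ℝ ∞ fun p : ℝ × E =>
      Complex.exp ((p.1 : ℂ) * ((LinearMap.trace ℝ E A.toLinearMap : ℝ) : ℂ)) :=
    ((Complex.ofRealCLM.contDiff.comp contDiff_fst).mul contDiff_const).cexp
  exact h1.mul (hf.comp hΦ.smooth)

theorem transport_zero {A : E →L[ℝ] E} {Φ : ℝ → E →L[ℝ] E} (hΦ : IsLinearFlow A Φ) (f : E → ℂ) :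
    transport A Φ f 0 = f := by
  ext q
  simp [transport, hΦ.zero]

theorem deriv_transport {A : E →L[ℝ] E} {Φ : ℝ → E →L[ℝ] E} (hΦ : IsLinearFlow A Φ)
    {f : E → ℂ} (hf : ContDiff ℝ ∞ f) (t : ℝ) (q : E) :
    HasDerivAt (fun s => transport A Φ f s q) (divField A (transport A Φ f t) q) t := by
  set τ : ℂ := ((LinearMap.trace ℝ E A.toLinearMap : ℝ) : ℂ) with hτ
  have hfd : ∀ x, HasFDerivAt f (fderiv ℝ f x) x := fun x =>
    ((hf.differentiable (by simp)) x).hasFDerivAt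
  have h1 : HasDerivAt (fun s : ℝ => Complex.exp (s * τ)) (Complex.exp (t * τ) * τ) t := by
    have h : HasDerivAt (fun s : ℝ => (s : ℂ) * τ) (1 * τ) t :=
      (Complex.ofRealCLM.hasDerivAt (x := t)).mul_const τ
    simpa using h.cexp
  have h2 : HasDerivAt (fun s => f (Φ s q)) (fderiv ℝ f (Φ t q) (A (Φ t q))) t :=
    (hfd _).comp_hasDerivAt t (hΦ.deriv t q)
  have h3 := h1.mul h2
  have h4 : fderiv ℝ (transport A Φ f t) q =
      Complex.exp (t * τ) • (fderiv ℝ f (Φ t q)).comp (Φ t) :=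
    (((hfd (Φ t q)).comp q (Φ t).hasFDerivAt).const_mul (Complex.exp (t * τ))).fderiv
  refine h3.congr_deriv ?_
  rw [divField, h4, hΦ.commute]
  simp only [transport, smul_apply, ContinuousLinearMap.comp_apply, smul_eq_mul, ← hτ]
  ring

/-- The values of `u`, `(L_A + μ) u`, `(L_A + μ)² u`, … along a family of test functions which is
transported, up to terms which these distributions do not see, satisfy a triangular linear
system. -/
theorem ev_iterate_family {A : E →L[ℝ] E} (μ : ℂ) (u : Distribution Ω ℂ ⊤) {K : Set E}
    (hK : IsCompact K) (hKΩ : K ⊆ Ω) {Ψ : ℝ → E → ℂ} (hΨ : ContDiff ℝ ∞ (Function.uncurry Ψ))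
    {a b : ℝ} (hab : a < b) (hs : ∀ t ∈ Icc a b, Ψ t ∈ testSpace K)
    (hd : ∀ j, ∀ t ∈ Icc a b, ev ((shiftedLie A μ)^[j] u) (fun x => deriv (fun s => Ψ s x) t) =
      ev ((shiftedLie A μ)^[j] u) (divField A (Ψ t))) (j : ℕ) :
    ContinuousOn (fun t => ev ((shiftedLie A μ)^[j] u) (Ψ t)) (Icc a b) ∧
    ∀ t ∈ Ico a b, HasDerivWithinAt (fun t => ev ((shiftedLie A μ)^[j] u) (Ψ t))
      (μ * ev ((shiftedLie A μ)^[j] u) (Ψ t) - ev ((shiftedLie A μ)^[j + 1] u) (Ψ t)) (Ici t) t := by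
  obtain ⟨-, h1, h2⟩ := ev_family ((shiftedLie A μ)^[j] u) hK hKΩ hΨ hab hs
  refine ⟨h1, fun t ht => ?_⟩
  have h3 := h2 t ht
  have ht' := Ico_subset_Icc_self ht
  rw [hd j t ht'] at h3
  rw [Function.iterate_succ_apply', ev_shiftedLie A μ _ (testSpace_mono hKΩ (hs t ht')), sub_sub_cancel]
  exact h3

end LinearFlow

/-! ### Complex derivatives and the Hadamard lemma -/

section ComplexDerivative

variable {E : Type*} [NormedAddCommGroup E] [NormedSpace ℝ E]

/-- The derivative `∂_v + i ∂_w` of a function. -/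
def cDeriv (v w : E) (f : E → ℂ) (q : E) : ℂ := fderiv ℝ f q v + Complex.I * fderiv ℝ f q w

theorem contDiff_cDeriv (v w : E) {f : E → ℂ} (hf : ContDiff ℝ ∞ f) :
    ContDiff ℝ ∞ (cDeriv v w f) := by
  have h := hf.fderiv_right (m := ∞) (by simp)
  exact (h.clm_apply contDiff_const).add (contDiff_const.mul (h.clm_apply contDiff_const))

theorem support_cDeriv_subset (v w : E) (f : E → ℂ) :
    Function.support (cDeriv v w f) ⊆ tsupport f := by
  intro x hx
  by_contra hxs
  have h : fderiv ℝ f x = 0 := by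
    by_contra h
    exact hxs (support_fderiv_subset ℝ h)
  simp [cDeriv, h] at hx

theorem cDeriv_mem_testSpace (v w : E) {S : Set E} {f : E → ℂ} (hf : f ∈ testSpace S) :
    cDeriv v w f ∈ testSpace S :=
  ⟨contDiff_cDeriv v w hf.1, hf.2.1.mono' (support_cDeriv_subset v w f),
    (closure_minimal (support_cDeriv_subset v w f) (isClosed_tsupport f)).trans hf.2.2⟩

theorem cDeriv_smul (v w : E) (c : ℂ) {f : E → ℂ} (hf : ContDiff ℝ ∞ f) :
    cDeriv v w (c • f) = c • cDeriv v w f := by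
  ext q
  simp only [cDeriv, Pi.smul_apply]
  rw [fderiv_const_smul (hf.differentiable (by simp) q)]
  simp only [smul_apply, smul_eq_mul]
  ring

theorem cDeriv_comm (v w v' w' : E) {f : E → ℂ} (hf : ContDiff ℝ ∞ f) :
    cDeriv v w (cDeriv v' w' f) = cDeriv v' w' (cDeriv v w f) := by
  ext q
  have hd : HasFDerivAt (fderiv ℝ f) (fderiv ℝ (fderiv ℝ f) q) q :=
    ((hf.fderiv_right (m := ∞) (by simp)).differentiable (by simp) q).hasFDerivAt
  have h : ∀ a b : E, fderiv ℝ (cDeriv a b f) q =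
      (fderiv ℝ (fderiv ℝ f) q).flip a + Complex.I • (fderiv ℝ (fderiv ℝ f) q).flip b := by
    intro a b
    have ha : HasFDerivAt (fun x => fderiv ℝ f x a) ((fderiv ℝ (fderiv ℝ f) q).flip a) q := by
      have := hd.clm_apply (hasFDerivAt_const a q)
      refine this.congr_fderiv ?_
      ext; simp
    have hb : HasFDerivAt (fun x => fderiv ℝ f x b) ((fderiv ℝ (fderiv ℝ f) q).flip b) q := by
      have := hd.clm_apply (hasFDerivAt_const b q)
      refine this.congr_fderiv ?_
      ext; simp
    exact (ha.add (hb.const_mul Complex.I)).fderiv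
  have hsym : IsSymmSndFDerivAt ℝ f q := by
    refine ContDiffAt.isSymmSndFDerivAt (n := ∞) hf.contDiffAt ?_
    simpa using (mod_cast le_top : ((2 : ℕ∞) : WithTop ℕ∞) ≤ ∞)
  have hs : ∀ a b : E, fderiv ℝ (fderiv ℝ f) q a b = fderiv ℝ (fderiv ℝ f) q b a := fun a b =>
    hsym.eq a b
  rw [cDeriv, cDeriv, h, h]
  simp only [add_apply, smul_apply, ContinuousLinearMap.flip_apply, smul_eq_mul]
  rw [hs v v', hs v w', hs w v', hs w w']
  ring

end ComplexDerivative

section Hadamard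

variable {X Y : Type*} [NormedAddCommGroup X] [NormedSpace ℝ X] [NormedAddCommGroup Y]
  [NormedSpace ℝ Y]

/-- The weighted mean `∫₀¹ sⁿ g (s x, y) ds` along the rays in the first variable. -/
def radialMean (n : ℕ) (g : X × Y → ℂ) (q : X × Y) : ℂ :=
  ∫ s in Icc (0 : ℝ) 1, (s : ℂ) ^ n * g (s • q.1, q.2)

variable {n : ℕ} {g : X × Y → ℂ}

theorem contDiff_radialMean_integrand (hg : ContDiff ℝ ∞ g) (n : ℕ) :
    ContDiff ℝ ∞ (Function.uncurry fun (s : ℝ) (q : X × Y) => (s : ℂ) ^ n * g (s • q.1, q.2)) := by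
  refine ContDiff.mul ((Complex.ofRealCLM.contDiff.comp contDiff_fst).pow n) (hg.comp ?_)
  fun_prop

theorem norm_iteratedFDeriv_radialMean_integrand_le [FiniteDimensional ℝ X] [FiniteDimensional ℝ Y]
    (hg : ContDiff ℝ ∞ g) (n k : ℕ)
    (q₀ : X × Y) : ∃ ε > 0, ∃ b : ℝ → ℝ, Integrable b (volume.restrict (Icc (0 : ℝ) 1)) ∧
      ∀ᵐ s : ℝ ∂(volume.restrict (Icc (0 : ℝ) 1)), ∀ q ∈ Metric.ball q₀ ε,
        ‖iteratedFDeriv ℝ k (fun q : X × Y => (s : ℂ) ^ n * g (s • q.1, q.2)) q‖ ≤ b s := by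
  have hc := continuous_iteratedFDeriv_partial (contDiff_radialMean_integrand hg n) k
  obtain ⟨C, hC⟩ := ((isCompact_Icc (a := (0 : ℝ)) (b := 1)).prod
    (isCompact_closedBall q₀ 1)).exists_bound_of_continuousOn hc.continuousOn
  refine ⟨1, one_pos, fun _ => C, integrable_const _, ?_⟩
  filter_upwards [ae_restrict_mem measurableSet_Icc] with s hs q hq
  exact hC (s, q) ⟨hs, Metric.ball_subset_closedBall hq⟩

variable [FiniteDimensional ℝ X] [FiniteDimensional ℝ Y]

theorem contDiff_radialMean (hg : ContDiff ℝ ∞ g) (n : ℕ) : ContDiff ℝ ∞ (radialMean n g) :=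
  contDiff_integral_of_dominated (contDiff_radialMean_integrand hg n) _
    (norm_iteratedFDeriv_radialMean_integrand_le hg n)

theorem fderiv_radialMean (hg : ContDiff ℝ ∞ g) (n : ℕ) (q : X × Y) (v : X) :
    fderiv ℝ (radialMean n g) q (v, 0) =
      radialMean (n + 1) (fun q => fderiv ℝ g q (v, 0)) q := by
  have h1 := iteratedFDeriv_integral_of_dominated (contDiff_radialMean_integrand hg n) _
    (norm_iteratedFDeriv_radialMean_integrand_le hg n) 1 q
  have h2 := congrArg (fun m => m fun _ => ((v, 0) : X × Y)) h1
  have hint : Integrable (fun s : ℝ => iteratedFDeriv ℝ 1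
      (fun q : X × Y => (s : ℂ) ^ n * g (s • q.1, q.2)) q) (volume.restrict (Icc (0 : ℝ) 1)) := by
    have hc := (continuous_iteratedFDeriv_partial (contDiff_radialMean_integrand hg n) 1).comp
      (continuous_id.prodMk (continuous_const (y := q)))
    exact hc.continuousOn.integrableOn_compact isCompact_Icc
  have h3 := (ContinuousMultilinearMap.apply ℝ (fun _ : Fin 1 => X × Y) ℂ
    (fun _ => ((v, 0) : X × Y))).integral_comp_comm hint
  have h4 : fderiv ℝ (radialMean n g) q (v, 0) = ∫ s in Icc (0 : ℝ) 1, iteratedFDeriv ℝ 1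
      (fun q : X × Y => (s : ℂ) ^ n * g (s • q.1, q.2)) q (fun _ => ((v, 0) : X × Y)) := by
    refine Eq.trans ?_ (h2.trans h3.symm)
    exact (iteratedFDeriv_one_apply (𝕜 := ℝ) (f := radialMean n g) (x := q)
      (fun _ => ((v, 0) : X × Y))).symm
  rw [h4, radialMean]
  congr 1
  ext s
  rw [iteratedFDeriv_one_apply]
  have h5 : HasFDerivAt (fun q : X × Y => (s • q.1, q.2))
      ((s • ContinuousLinearMap.fst ℝ X Y).prod (ContinuousLinearMap.snd ℝ X Y)) q :=
    ((ContinuousLinearMap.fst ℝ X Y).hasFDerivAt.const_smul s).prodMk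
      (ContinuousLinearMap.snd ℝ X Y).hasFDerivAt
  have h6 : HasFDerivAt g (fderiv ℝ g (s • q.1, q.2)) (s • q.1, q.2) :=
    (hg.differentiable (by simp) _).hasFDerivAt
  have h7 := (HasFDerivAt.comp q h6 h5).const_mul ((s : ℂ) ^ n)
  have h8 : HasFDerivAt (fun q : X × Y => (s : ℂ) ^ n * g (s • q.1, q.2)) _ q := h7
  rw [h8.fderiv]
  simp only [smul_apply, ContinuousLinearMap.comp_apply, ContinuousLinearMap.prod_apply,
    ContinuousLinearMap.coe_fst', ContinuousLinearMap.coe_snd', smul_eq_mul]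
  have h9 : ((s • v, (0 : Y)) : X × Y) = s • ((v, 0) : X × Y) := by simp
  rw [h9, map_smul, Complex.real_smul]
  ring

theorem integrableOn_radialMean_integrand (hg : Continuous g) (n : ℕ) (q : X × Y) :
    IntegrableOn (fun s : ℝ => (s : ℂ) ^ n * g (s • q.1, q.2)) (Icc (0 : ℝ) 1) := by
  have : Continuous (fun s : ℝ => (s : ℂ) ^ n * g (s • q.1, q.2)) := by fun_prop
  exact this.continuousOn.integrableOn_compact isCompact_Icc

theorem cDeriv_radialMean (hg : ContDiff ℝ ∞ g) (n : ℕ) (v w : X) :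
    cDeriv ((v, 0) : X × Y) (w, 0) (radialMean n g) =
      radialMean (n + 1) (cDeriv ((v, 0) : X × Y) (w, 0) g) := by
  ext q
  have hc : ∀ v : X, Continuous fun q => fderiv ℝ g q ((v, 0) : X × Y) := fun v =>
    ((hg.fderiv_right (m := ∞) (by simp)).clm_apply contDiff_const).continuous
  rw [cDeriv, fderiv_radialMean hg, fderiv_radialMean hg, radialMean, radialMean, radialMean,
    ← integral_const_mul, ← integral_add (integrableOn_radialMean_integrand (hc v) _ q)
      ((integrableOn_radialMean_integrand (hc w) _ q).const_mul _)]
  congr 1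
  ext s
  simp only [cDeriv]
  ring

theorem radialMean_zero_left (n : ℕ) (g : X × Y → ℂ) (y : Y) :
    radialMean n g (0, y) = g (0, y) / (n + 1) := by
  have h1 : ∫ s in Icc (0 : ℝ) 1, (s : ℂ) ^ n = 1 / (n + 1) := by
    rw [integral_Icc_eq_integral_Ioc, ← intervalIntegral.integral_of_le zero_le_one]
    have h2 : ∀ s : ℝ, (s : ℂ) ^ n = ((s ^ n : ℝ) : ℂ) := fun s => by push_cast; rfl
    simp_rw [h2]
    rw [intervalIntegral.integral_ofReal, integral_pow]
    push_cast
    simp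
  simp only [radialMean, smul_zero]
  rw [integral_mul_const, h1]
  ring

theorem radialMean_eq_zero (n : ℕ) {q : X × Y} (h : ∀ x, g (x, q.2) = 0) :
    radialMean n g q = 0 := by
  simp [radialMean, h]

theorem eq_add_radialMean (hg : ContDiff ℝ ∞ g) (q : X × Y) :
    g q = g (0, q.2) + radialMean 0 (fun r => fderiv ℝ g r (q.1, 0)) q := by
  have h1 : ∀ s : ℝ, HasDerivAt (fun s : ℝ => g (s • q.1, q.2))
      (fderiv ℝ g (s • q.1, q.2) (q.1, 0)) s := by
    intro s
    have h2 : HasFDerivAt g (fderiv ℝ g (s • q.1, q.2)) (s • q.1, q.2) :=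
      (hg.differentiable (by simp) _).hasFDerivAt
    have h3 : HasDerivAt (fun s : ℝ => (s • q.1, q.2)) (q.1, 0) s := by
      have := ((hasDerivAt_id s).smul_const q.1).prodMk (hasDerivAt_const s q.2)
      simpa using this
    exact h2.comp_hasDerivAt s h3
  have hc : Continuous fun s : ℝ => fderiv ℝ g (s • q.1, q.2) (q.1, 0) := by
    have := (hg.fderiv_right (m := ∞) (by simp)).continuous
    fun_prop
  have h4 := intervalIntegral.integral_eq_sub_of_hasDerivAt (a := 0) (b := 1) (fun s _ => h1 s)
    (hc.intervalIntegrable _ _)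
  rw [intervalIntegral.integral_of_le zero_le_one, ← integral_Icc_eq_integral_Ioc] at h4
  simp only [radialMean, pow_zero, one_mul]
  rw [h4]
  simp

end Hadamard

/-! ### The main decay estimate -/

section MainEstimate

variable {X Y : Type*} [NormedAddCommGroup X] [NormedSpace ℝ X] [NormedAddCommGroup Y]
  [NormedSpace ℝ Y]

/-- A linear flow `S × R` on `X × Y` for which, in the future, `S` contracts and `R` expands, with
complex coordinates `ζ i` on `X` (and dual complex directions `v i + I w i`) which diagonalize `S`
with exponents `ν i`; `ε` is a lower bound of all rates, and `bound` an upper bound of the expansion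
rate. -/
structure SaddleFlow (X Y ι : Type*) [NormedAddCommGroup X] [NormedSpace ℝ X]
    [NormedAddCommGroup Y] [NormedSpace ℝ Y] [Fintype ι] where
  S : ℝ → X →L[ℝ] X
  R : ℝ → Y →L[ℝ] Y
  ε : ℝ
  bound : ℝ
  v : ι → X
  w : ι → X
  ζ : ι → X →L[ℝ] ℂ
  ν : ι → ℂ
  ε_pos : 0 < ε
  bound_nonneg : 0 ≤ bound
  norm_S_le : ∀ t, 0 ≤ t → ∀ x, ‖S t x‖ ≤ ‖x‖
  norm_R_le : ∀ t, 0 ≤ t → ∀ y, ‖R t y‖ ≤ Real.exp (bound * t) * ‖y‖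
  le_norm_R : ∀ t, 0 ≤ t → ∀ y, Real.exp (ε * t) * ‖y‖ ≤ ‖R t y‖
  le_norm_comp_R : ∀ t, 0 ≤ t → ∀ ℓ : Y →L[ℝ] ℝ, Real.exp (ε * t) * ‖ℓ‖ ≤ ‖ℓ.comp (R t)‖
  ζ_S : ∀ i t x, ζ i (S t x) = Complex.exp (t * ν i) * ζ i x
  re_ν_le : ∀ i, (ν i).re ≤ -ε
  expand : ∀ (L : X →L[ℝ] ℂ) (x : X), L x = ∑ i, ζ i x * (L (v i) + Complex.I * L (w i))

namespace SaddleFlow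

variable {ι : Type*} [Fintype ι] (F : SaddleFlow X Y ι)

/-- The flow on the product. -/
def flow (t : ℝ) : X × Y →L[ℝ] X × Y := (F.S t).prodMap (F.R t)

theorem flow_apply (t : ℝ) (q : X × Y) : F.flow t q = (F.S t q.1, F.R t q.2) := rfl

/-- The complex derivative in the `i`-th direction of `X`. -/
def partialX (i : ι) (f : X × Y → ℂ) : X × Y → ℂ := cDeriv (F.v i, 0) (F.w i, 0) f

/-- The iterated complex derivative along a word of directions. -/
def partialWord (σ : List ι) (f : X × Y → ℂ) : X × Y → ℂ := σ.foldr F.partialX f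

theorem contDiff_partialX (i : ι) {f : X × Y → ℂ} (hf : ContDiff ℝ ∞ f) :
    ContDiff ℝ ∞ (F.partialX i f) := contDiff_cDeriv _ _ hf

theorem contDiff_partialWord (σ : List ι) {f : X × Y → ℂ} (hf : ContDiff ℝ ∞ f) :
    ContDiff ℝ ∞ (F.partialWord σ f) := by
  induction σ with
  | nil => exact hf
  | cons i σ ih => exact F.contDiff_partialX i ih

theorem norm_flow_le (t : ℝ) (ht : 0 ≤ t) : ‖F.flow t‖ ≤ Real.exp (F.bound * t) := by
  refine ContinuousLinearMap.opNorm_le_bound _ (by positivity) fun q => ?_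
  rw [flow_apply, Prod.norm_def]
  have h1 : 1 ≤ Real.exp (F.bound * t) := Real.one_le_exp (mul_nonneg F.bound_nonneg ht)
  refine max_le ?_ ?_
  · refine (F.norm_S_le t ht _).trans ((norm_fst_le q).trans ?_)
    exact le_mul_of_one_le_left (norm_nonneg _) h1
  · refine (F.norm_R_le t ht _).trans ?_
    gcongr
    exact norm_snd_le q

variable [FiniteDimensional ℝ X] [FiniteDimensional ℝ Y]

theorem partialWord_radialMean (σ : List ι) (n : ℕ) {g : X × Y → ℂ} (hg : ContDiff ℝ ∞ g) :
    F.partialWord σ (radialMean n g) = radialMean (n + σ.length) (F.partialWord σ g) := by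
  induction σ with
  | nil => rfl
  | cons i σ ih =>
    change F.partialX i (F.partialWord σ (radialMean n g)) = _
    rw [ih, partialX, cDeriv_radialMean (F.contDiff_partialWord σ hg)]
    rfl

/-- The Hadamard expansion in the diagonalizing coordinates. -/
theorem hadamard {f : X × Y → ℂ} (hf : ContDiff ℝ ∞ f) (q : X × Y) :
    f q = f (0, q.2) + ∑ i, F.ζ i q.1 * radialMean 0 (F.partialX i f) q := by
  rw [eq_add_radialMean hf q]
  congr 1
  have hc : ∀ i, Continuous (F.partialX i f) := fun i => (F.contDiff_partialX i hf).continuous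
  have h1 : ∀ r : X × Y, fderiv ℝ f r (q.1, 0) = ∑ i, F.ζ i q.1 * F.partialX i f r := fun r =>
    F.expand ((fderiv ℝ f r).comp (ContinuousLinearMap.inl ℝ X Y)) q.1
  simp only [radialMean]
  simp_rw [h1, Finset.mul_sum]
  rw [integral_finsetSum]
  · refine Finset.sum_congr rfl fun i _ => ?_
    rw [← integral_const_mul]
    congr 1
    ext s
    ring
  · intro i _
    have := (integrableOn_radialMean_integrand (hc i) 0 q).const_mul (F.ζ i q.1)
    refine this.congr (Eventually.of_forall fun s => ?_)
    simp only
    ring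

variable [MeasurableSpace Y] [BorelSpace Y]

/-- The transversal derivatives of `f` of order less than `n` have vanishing moments of order at
most `K` along `{0} × Y`. -/
def MomentsVanish (m : Measure Y) (n K : ℕ) (f : X × Y → ℂ) : Prop :=
  ∀ σ : List ι, σ.length < n → ∀ ℓ : Y →L[ℝ] ℝ, ∀ k ≤ K,
    ∫ y, F.partialWord σ f (0, y) * (ℓ y : ℂ) ^ k ∂m = 0

variable {F} in
theorem MomentsVanish.radialMean {m : Measure Y} {n K : ℕ} {f : X × Y → ℂ} (hf : ContDiff ℝ ∞ f)
    (h : F.MomentsVanish m (n + 1) K f) (i : ι) :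
    F.MomentsVanish m n K (radialMean 0 (F.partialX i f)) := by
  intro σ hσ ℓ k hk
  rw [F.partialWord_radialMean σ 0 (F.contDiff_partialX i hf)]
  simp_rw [radialMean_zero_left]
  have h1 : F.partialWord σ (F.partialX i f) = F.partialWord (σ ++ [i]) f := by
    simp [partialWord, List.foldr_append]
  rw [h1]
  have h2 := h (σ ++ [i]) (by simpa using hσ) ℓ k hk
  have h3 : ∀ y, F.partialWord (σ ++ [i]) f (0, y) / (((0 + σ.length : ℕ) : ℂ) + 1) *
      (ℓ y : ℂ) ^ k = (((0 + σ.length : ℕ) : ℂ) + 1)⁻¹ *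
        (F.partialWord (σ ++ [i]) f (0, y) * (ℓ y : ℂ) ^ k) := fun y => by
    rw [div_eq_mul_inv]; ring
  simp_rw [h3]
  rw [integral_const_mul, h2, mul_zero]

variable {Ω : Opens (X × Y)}

/-- The a priori exponential bound which follows from the finite order of `u`. -/
theorem exists_ev_flow_le (u : Distribution Ω ℂ ⊤) {K₀ : Set (X × Y)} (hK : IsCompact K₀)
    (hKΩ : K₀ ⊆ Ω) : ∃ M₀ : ℝ, ∀ (f : X × Y → ℂ), ContDiff ℝ ∞ f →
      (∃ r : ℝ, ∀ q : X × Y, r < ‖q.2‖ → f q = 0) → ∀ Θ ∈ testSpace K₀,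
      ∃ C : ℝ, 0 ≤ C ∧ ∀ t : ℝ, 0 ≤ t →
        ‖ev u (fun q => Θ q * f (F.flow t q))‖ ≤ C * Real.exp (M₀ * t) := by
  obtain ⟨N, C₀, hC₀, hN⟩ := exists_order_bound u hK hKΩ
  refine ⟨F.bound * N, fun f hf ⟨r, hr⟩ Θ hΘ => ?_⟩
  obtain ⟨A, hA0, hA⟩ := exists_bound_iteratedFDeriv hΘ.1 hK N
  obtain ⟨ρ, hρ⟩ := hK.isBounded.exists_norm_le
  obtain ⟨D, hD0, hD⟩ := exists_bound_iteratedFDeriv hf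
    ((isCompact_closedBall (0 : X) ρ).prod (isCompact_closedBall (0 : Y) r)) N
  have hball : tsupport f ⊆ {q : X × Y | ‖q.2‖ ≤ r} := by
    refine closure_minimal (fun q hq => ?_) (isClosed_le (by fun_prop) (by fun_prop))
    by_contra hlt
    exact hq (hr q (not_le.1 hlt))
  refine ⟨C₀ * (2 ^ N * (A * D)), by positivity, fun t ht => ?_⟩
  set e := Real.exp (F.bound * t) with he
  have he1 : 1 ≤ e := Real.one_le_exp (mul_nonneg F.bound_nonneg ht)
  have heN : Real.exp (F.bound * N * t) = e ^ N := by
    rw [he, ← Real.exp_nat_mul]; ring_nf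
  rw [heN, mul_assoc]
  have hft : ContDiff ℝ ∞ (fun q => f (F.flow t q)) := hf.comp (F.flow t).contDiff
  refine hN _ (mul_mem_testSpace hΘ hft) _ (by positivity) fun k hk q hq => ?_
  have hB : ∀ j ≤ k, ‖iteratedFDeriv ℝ j (fun q => f (F.flow t q)) q‖ ≤ D * e ^ N := by
    intro j hj
    have h1 : iteratedFDeriv ℝ j (f ∘ F.flow t) q =
        (iteratedFDeriv ℝ j f (F.flow t q)).compContinuousLinearMap fun _ => F.flow t :=
      (F.flow t).iteratedFDeriv_comp_right hf q (i := j) (mod_cast le_top)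
    change ‖iteratedFDeriv ℝ j (f ∘ F.flow t) q‖ ≤ _
    rw [h1]
    refine (ContinuousMultilinearMap.norm_compContinuousLinearMap_le _ _).trans ?_
    rw [Finset.prod_const, Finset.card_univ, Fintype.card_fin]
    have h2 : ‖iteratedFDeriv ℝ j f (F.flow t q)‖ ≤ D := by
      by_cases hqs : F.flow t q ∈ tsupport f
      · refine hD j (hj.trans hk) _ ⟨?_, ?_⟩
        · rw [mem_closedBall_zero_iff]
          exact (F.norm_S_le t ht _).trans ((norm_fst_le q).trans (hρ q hq))
        · rw [mem_closedBall_zero_iff]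
          exact hball hqs
      · have h3 : iteratedFDeriv ℝ j f (F.flow t q) = 0 := by
          by_contra h
          exact hqs (support_iteratedFDeriv_subset (𝕜 := ℝ) j h)
        rw [h3, norm_zero]
        exact hD0
    have h4 : ‖F.flow t‖ ^ j ≤ e ^ N :=
      (pow_le_pow_left₀ (norm_nonneg _) (F.norm_flow_le t ht) j).trans
        (pow_le_pow_right₀ he1 (hj.trans hk))
    gcongr
  refine (norm_iteratedFDeriv_mul_le_of_le hΘ.1 hft hA0 q
    (fun j hj => hA j (hj.trans hk) q hq) hB).trans ?_
  have h5 : (2 : ℝ) ^ k ≤ 2 ^ N := pow_le_pow_right₀ one_le_two hk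
  calc (2 : ℝ) ^ k * (A * (D * e ^ N)) ≤ 2 ^ N * (A * (D * e ^ N)) := by gcongr
    _ = _ := by ring

/-- The decay, along the flow, of the pairing of `u` with functions whose transversal jet at
`{0} × Y` has vanishing moments. Each step of the induction on the order of the jet gains a
factor `e^{-ε t}` from the contraction in `X`; the contributions of the jet itself decay because
the wavefront set of `u` has no direction which is conormal to `X × {0}`. -/
theorem exists_ev_flow_decay (m : Measure Y) [m.IsAddHaarMeasure] (u : Distribution Ω ℂ ⊤)
    {U K₀ : Set (X × Y)} (hK : IsCompact K₀)
    (hKΩ : K₀ ⊆ Ω) (hUK : U ⊆ K₀)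
    (hdec : ∀ f ∈ testSpace U, ∀ N : ℕ, ∃ C : ℝ, ∀ ℓ : Y →L[ℝ] ℝ, (1 + ‖ℓ‖) ^ N *
      ‖ev u (fun q => f q * wave (ℓ.comp (ContinuousLinearMap.snd ℝ X Y)) q)‖ ≤ C) :
    ∃ M₀ : ℝ, ∀ (K n : ℕ) (f : X × Y → ℂ), ContDiff ℝ ∞ f →
      (∃ r : ℝ, ∀ q : X × Y, r < ‖q.2‖ → f q = 0) → F.MomentsVanish m n K f → ∀ Θ ∈ testSpace U,
      ∃ C : ℝ, 0 ≤ C ∧ ∀ t : ℝ, 0 ≤ t → ‖ev u (fun q => Θ q * f (F.flow t q))‖ ≤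
        C * (Real.exp ((M₀ - F.ε * n) * t) + Real.exp (-(F.ε * (K + 1)) * t)) := by
  obtain ⟨M₀, hM₀⟩ := F.exists_ev_flow_le u hK hKΩ
  refine ⟨M₀, fun K n => ?_⟩
  induction n with
  | zero =>
    intro f hf hr _ Θ hΘ
    obtain ⟨C, hC0, hC⟩ := hM₀ f hf hr Θ (testSpace_mono hUK hΘ)
    refine ⟨C, hC0, fun t ht => (hC t ht).trans ?_⟩
    gcongr
    simp only [CharP.cast_eq_zero, mul_zero, sub_zero]
    linarith [Real.exp_pos (-(F.ε * (K + 1)) * t)]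
  | succ n ih =>
    rintro f hf ⟨r, hr⟩ hmom Θ hΘ
    have hUΩ : U ⊆ Ω := hUK.trans hKΩ
    have hζ : ∀ i, ContDiff ℝ ∞ fun q : X × Y => F.ζ i q.1 := fun i =>
      (F.ζ i).contDiff.comp contDiff_fst
    have hi : ∀ i, ∃ C : ℝ, 0 ≤ C ∧ ∀ t : ℝ, 0 ≤ t →
        ‖ev u (fun q => (Θ q * F.ζ i q.1) * radialMean 0 (F.partialX i f) (F.flow t q))‖ ≤
        C * (Real.exp ((M₀ - F.ε * n) * t) + Real.exp (-(F.ε * (K + 1)) * t)) := by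
      intro i
      refine ih _ (contDiff_radialMean (F.contDiff_partialX i hf) 0) ⟨r, fun q hq => ?_⟩
        (hmom.radialMean hf i) _ (mul_mem_testSpace hΘ (hζ i))
      refine radialMean_eq_zero 0 fun x => ?_
      have h0 : f =ᶠ[𝓝 (x, q.2)] fun _ => 0 := by
        have : {q : X × Y | r < ‖q.2‖} ∈ 𝓝 (x, q.2) :=
          (isOpen_lt (by fun_prop) (by fun_prop)).mem_nhds hq
        filter_upwards [this] with q' hq' using hr q' hq'
      simp [partialX, cDeriv, h0.fderiv_eq]
    choose C hC0 hC using hi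
    have hf0 : ContDiff ℝ ∞ fun y : Y => f (0, y) := hf.comp (contDiff_const.prodMk contDiff_id)
    have hf0c : HasCompactSupport fun y : Y => f (0, y) := by
      refine HasCompactSupport.of_support_subset_isCompact (isCompact_closedBall (0 : Y) r) ?_
      intro y hy
      rw [mem_closedBall_zero_iff]
      by_contra hlt
      exact hy (hr (0, y) (not_le.1 hlt))
    obtain ⟨C₁, hC₁⟩ := exists_ev_expansion_le m u (testSpace_mono hUΩ hΘ)
      (ContinuousLinearMap.snd ℝ X Y) (hdec Θ hΘ) hf0 hf0c K
      (fun ℓ k hk => hmom [] (by simp) ℓ k hk)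
    refine ⟨|C₁| + ∑ i, C i, add_nonneg (abs_nonneg _) (Finset.sum_nonneg fun i _ => hC0 i),
      fun t ht => ?_⟩
    set a := Real.exp ((M₀ - F.ε * n) * t) with ha
    set b := Real.exp (-(F.ε * (K + 1)) * t) with hb
    set d := Real.exp (-(F.ε * t)) with hd
    have hd1 : d ≤ 1 := Real.exp_le_one_iff.2 (neg_nonpos.2 (mul_nonneg F.ε_pos.le ht))
    have hda : Real.exp ((M₀ - F.ε * ((n + 1 : ℕ) : ℝ)) * t) = d * a := by
      rw [ha, hd, ← Real.exp_add]
      push_cast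
      ring_nf
    rw [hda]
    -- the Hadamard lemma at the time `t`: `f` on `{0} × Y`, plus terms carrying the contracted
    -- coordinates `e^{ν i t} ζ i`, whose other factors have one order of vanishing moments less
    have hsplit : (fun q => Θ q * f (F.flow t q)) =
        (fun q => Θ q * (fun y : Y => f (0, y)) (F.R t (ContinuousLinearMap.snd ℝ X Y q))) +
        ∑ i, Complex.exp (t * F.ν i) • fun q =>
          (Θ q * F.ζ i q.1) * radialMean 0 (F.partialX i f) (F.flow t q) := by
      ext q
      rw [F.hadamard hf (F.flow t q), Pi.add_apply, Finset.sum_apply]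
      simp only [flow_apply, F.ζ_S, Pi.smul_apply, smul_eq_mul, mul_add, Finset.mul_sum,
        ContinuousLinearMap.coe_snd']
      congr 1
      exact Finset.sum_congr rfl fun i _ => by ring
    have hmem1 : (fun q => Θ q * (fun y : Y => f (0, y))
        (F.R t (ContinuousLinearMap.snd ℝ X Y q))) ∈ testSpace (Ω : Set (X × Y)) :=
      mul_mem_testSpace (testSpace_mono hUΩ hΘ)
        (hf0.comp ((F.R t).comp (ContinuousLinearMap.snd ℝ X Y)).contDiff)
    have hmem2 : ∀ i, (fun q => (Θ q * F.ζ i q.1) *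
        radialMean 0 (F.partialX i f) (F.flow t q)) ∈ testSpace (Ω : Set (X × Y)) := fun i =>
      mul_mem_testSpace (mul_mem_testSpace (testSpace_mono hUΩ hΘ) (hζ i))
        ((contDiff_radialMean (F.contDiff_partialX i hf) 0).comp (F.flow t).contDiff)
    rw [hsplit, ev_add u hmem1 (sum_mem fun i _ => Submodule.smul_mem _ _ (hmem2 i)),
      ev_sum u _ fun i _ => Submodule.smul_mem _ _ (hmem2 i)]
    simp_rw [ev_smul u _ (hmem2 _)]
    have hfirst : ‖ev u (fun q => Θ q * (fun y : Y => f (0, y))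
        (F.R t (ContinuousLinearMap.snd ℝ X Y q)))‖ ≤ |C₁| * b := by
      have h1 := hC₁ (F.R t) (Real.exp (F.ε * t))
        (Real.one_le_exp (mul_nonneg F.ε_pos.le ht)) (F.le_norm_comp_R t ht)
      have h2 : Real.exp (F.ε * t) ^ (K + 1) * b = 1 := by
        rw [hb, ← Real.exp_nat_mul, ← Real.exp_add, Real.exp_eq_one_iff]
        push_cast
        ring
      have hbpos : 0 < b := Real.exp_pos _
      calc _ = (Real.exp (F.ε * t) ^ (K + 1) * ‖ev u (fun q => Θ q * (fun y : Y => f (0, y))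
              (F.R t (ContinuousLinearMap.snd ℝ X Y q)))‖) * b := by
            rw [mul_right_comm, h2, one_mul]
        _ ≤ |C₁| * b := by gcongr; exact h1.trans (le_abs_self _)
    have hsecond : ∀ i, ‖Complex.exp (t * F.ν i) * ev u (fun q => (Θ q * F.ζ i q.1) *
        radialMean 0 (F.partialX i f) (F.flow t q))‖ ≤ C i * (d * a + b) := by
      intro i
      rw [norm_mul, Complex.norm_exp]
      have h1 : Real.exp ((t : ℂ) * F.ν i).re ≤ d := by
        rw [hd, Real.exp_le_exp, Complex.re_ofReal_mul]
        nlinarith [F.re_ν_le i]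
      calc _ ≤ d * (C i * (a + b)) := by
            gcongr
            exact hC i t ht
        _ = C i * (d * a + d * b) := by ring
        _ ≤ C i * (d * a + b) := by
            gcongr
            · exact hC0 i
            · exact mul_le_of_le_one_left (Real.exp_pos _).le hd1
    refine (norm_add_le _ _).trans ?_
    rw [add_mul, Finset.sum_mul]
    refine add_le_add (hfirst.trans ?_) ((norm_sum_le _ _).trans
      (Finset.sum_le_sum fun i _ => hsecond i))
    gcongr
    exact le_add_of_nonneg_left (by positivity)

end SaddleFlow

end MainEstimate

/-! ### Generalized eigendistributions are determined by finitely many moments -/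

section Determination

theorem divField_mul {E : Type*} [NormedAddCommGroup E] [NormedSpace ℝ E] (A : E →L[ℝ] E)
    {f g : E → ℂ} (hf : ContDiff ℝ ∞ f) (hg : ContDiff ℝ ∞ g) :
    divField A (fun q => f q * g q) =
      (fun q => f q * divField A g q) + fun q => fderiv ℝ f q (A q) * g q := by
  ext q
  have h := ((hf.differentiable (by simp)) q).hasFDerivAt.mul
    ((hg.differentiable (by simp)) q).hasFDerivAt
  have h' : HasFDerivAt (fun q => f q * g q) _ q := h
  simp only [divField, Pi.add_apply]
  rw [h'.fderiv]
  simp only [add_apply, smul_apply, smul_eq_mul]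
  ring

variable {X Y : Type*} [NormedAddCommGroup X] [NormedSpace ℝ X] [NormedAddCommGroup Y]
  [NormedSpace ℝ Y] [FiniteDimensional ℝ X] [FiniteDimensional ℝ Y]
  [MeasurableSpace Y] [BorelSpace Y] {ι : Type*} [Fintype ι] (F : SaddleFlow X Y ι)
  {Ω : Opens (X × Y)}

theorem tendsto_exp_mul_atTop_zero {a : ℝ} (ha : a < 0) :
    Tendsto (fun t : ℝ => Real.exp (a * t)) atTop (𝓝 0) :=
  Real.tendsto_exp_atBot.comp (tendsto_id.const_mul_atTop_of_neg ha)

/-- Let `u` be a generalized eigendistribution of `L_A` which, near the origin, is supported in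
`{0} × Y` and has no wavefront over the origin in the conormal directions of `X × {0}`. Then `u`
annihilates the test functions near the origin with finitely many vanishing moments: transporting
such a function by the flow, the pairing with `u` decays faster than the solutions of the linear
system which it satisfies. -/
theorem exists_ev_eq_zero_of_momentsVanish (m : Measure Y) [m.IsAddHaarMeasure]
    {A : X × Y →L[ℝ] X × Y} (hΦ : IsLinearFlow A F.flow) (u : Distribution Ω ℂ ⊤)
    (h0 : (0 : X × Y) ∈ Ω) (μ : ℂ) (p : ℕ) (hu : (shiftedLie A μ)^[p] u = 0)
    {W : Set (X × Y)} (hW : W ∈ 𝓝 0)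
    (hsupp : ∀ f ∈ testSpace (Ω : Set (X × Y)), tsupport f ⊆ W ∩ {q | q.1 ≠ 0} → ev u f = 0)
    (hWF : ∀ η : Y →L[ℝ] ℝ, η ≠ 0 →
      ((0 : X × Y), η.comp (ContinuousLinearMap.snd ℝ X Y)) ∉ wavefrontSet u) :
    ∃ n K : ℕ, ∃ Ω' : Set (X × Y), IsOpen Ω' ∧ 0 ∈ Ω' ∧ Ω' ⊆ Ω ∧ ∀ ψ ∈ testSpace Ω',
      F.MomentsVanish m n K ψ → ev u ψ = 0 := by
  -- rapid decay in the conormal directions on a neighbourhood of the origin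
  let J : (Y →L[ℝ] ℝ) →L[ℝ] (X × Y →L[ℝ] ℝ) :=
    (ContinuousLinearMap.compL ℝ (X × Y) Y ℝ).flip (ContinuousLinearMap.snd ℝ X Y)
  have hJ : ∀ η, (1 : ℝ) * ‖η‖ ≤ ‖J η‖ := by
    intro η
    rw [one_mul]
    refine η.opNorm_le_bound (norm_nonneg _) fun y => ?_
    have := (J η).le_opNorm (0, y)
    rwa [Prod.norm_mk, norm_zero, max_eq_right (norm_nonneg y)] at this
  obtain ⟨U, hUo, h0U, hUΩ, hdec⟩ := exists_uniform_decay u h0 J one_pos hJ (fun η hη => by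
    have hη' : J η ≠ 0 := fun h => by
      have := hJ η
      rw [h, norm_zero, one_mul] at this
      exact hη (norm_le_zero_iff.1 this)
    exact rapidDecayNear_of_notMem_wavefrontSet h0 hη' (by
      have := hWF (-η) (neg_ne_zero.2 hη)
      rwa [ContinuousLinearMap.neg_comp] at this))
  obtain ⟨r, hr, hball⟩ := Metric.nhds_basis_closedBall.mem_iff.1
    (inter_mem (hUo.mem_nhds h0U) hW)
  set K₀ : Set (X × Y) := Metric.closedBall 0 r with hK₀def
  have hK₀ : IsCompact K₀ := isCompact_closedBall _ _
  have hK₀U : K₀ ⊆ U := fun q hq => (hball hq).1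
  have hK₀Ω : K₀ ⊆ Ω := hK₀U.trans hUΩ
  obtain ⟨M₀, hM₀⟩ := F.exists_ev_flow_decay m u hK₀ hK₀Ω subset_rfl
    (fun f hf N => hdec f (testSpace_mono hK₀U hf) N)
  let χ : ContDiffBump (0 : X × Y) := ⟨r / 2, r, by positivity, by linarith⟩
  set Θ : X × Y → ℂ := fun q => ((χ q : ℝ) : ℂ) with hΘdef
  have hΘ : Θ ∈ testSpace K₀ := by
    refine mem_testSpace_of_isCompact hK₀ (Complex.ofRealCLM.contDiff.comp χ.contDiff) ?_
    intro q hq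
    have : χ q = 0 := χ.zero_of_le_dist (not_le.1 hq).le
    simp [hΘdef, this]
  have hΘΩ := testSpace_mono hK₀Ω hΘ
  have hΘ1 : ∀ q ∈ Metric.ball (0 : X × Y) (r / 2), Θ q = 1 := fun q hq => by
    have : χ q = 1 := χ.one_of_mem_closedBall (Metric.ball_subset_closedBall hq)
    simp [hΘdef, this]
  set τ : ℝ := LinearMap.trace ℝ (X × Y) A.toLinearMap with hτ
  -- `n` and `K` make both exponents in `exists_ev_flow_decay` smaller than `Re μ - τ`, where the
  -- trace `τ` comes from the transport of densities
  obtain ⟨n, hn⟩ := exists_nat_gt ((τ - μ.re + M₀) / F.ε)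
  obtain ⟨K, hK⟩ := exists_nat_gt ((τ - μ.re) / F.ε)
  rw [div_lt_iff₀ F.ε_pos] at hn hK
  have hε := F.ε_pos
  refine ⟨n, K, Metric.ball 0 (r / 2), Metric.isOpen_ball, Metric.mem_ball_self (by positivity),
    (Metric.ball_subset_closedBall.trans (Metric.closedBall_subset_closedBall (by linarith))).trans
      hK₀Ω, fun ψ hψ hmom => ?_⟩
  set Ψ : ℝ → X × Y → ℂ := fun t q => Θ q * transport A F.flow ψ t q with hΨdef
  have htr := contDiff_transport hΦ hψ.1
  have htrt : ∀ t, ContDiff ℝ ∞ (transport A F.flow ψ t) := contDiff_partial htr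
  have hΨ : ContDiff ℝ ∞ (Function.uncurry Ψ) := (hΘ.1.comp contDiff_snd).mul htr
  have hΨs : ∀ t, Ψ t ∈ testSpace K₀ := fun t => mul_mem_testSpace hΘ (htrt t)
  set VΘ : X × Y → ℂ := fun q => fderiv ℝ Θ q (A q) with hVΘ
  have hVΘK : VΘ ∈ testSpace K₀ := fderiv_apply_mem_testSpace hΘ A.contDiff
  -- the error caused by the cutoff is supported away from `{0} × Y`
  have herr : ∀ j, ∀ t, 0 ≤ t →
      ev ((shiftedLie A μ)^[j] u) (fun q => VΘ q * transport A F.flow ψ t q) = 0 := by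
    intro j t ht
    refine ev_shiftedLie_iterate_eq_zero A μ u _ hsupp j _
      (mul_mem_testSpace (testSpace_mono hK₀Ω hVΘK) (htrt t)) fun q hq => ?_
    have hq1 : q ∈ tsupport VΘ := tsupport_mul_subset_left hq
    refine ⟨(hball (hVΘK.2.2 hq1)).2, fun hx => ?_⟩
    have hq2 : F.flow t q ∈ tsupport ψ := by
      have h1 : q ∈ tsupport (transport A F.flow ψ t) := tsupport_mul_subset_right hq
      have h2 : tsupport (transport A F.flow ψ t) ⊆ F.flow t ⁻¹' tsupport ψ := by
        refine closure_minimal (fun z hz => subset_tsupport ψ ?_)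
          ((isClosed_tsupport ψ).preimage (F.flow t).continuous)
        intro h0
        exact hz (by simp [transport, h0])
      exact h2 h1
    have hq3 := mem_ball_zero_iff.1 (hψ.2.2 hq2)
    have hq4 : ‖q‖ < r / 2 := by
      have h1 : ‖q.2‖ ≤ ‖F.R t q.2‖ := by
        refine le_trans ?_ (F.le_norm_R t ht q.2)
        exact le_mul_of_one_le_left (norm_nonneg _) (Real.one_le_exp (mul_nonneg hε.le ht))
      have h2 : ‖q‖ = ‖q.2‖ := by
        rw [Prod.norm_def, hx, norm_zero, max_eq_right (norm_nonneg _)]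
      rw [h2]
      exact (h1.trans (norm_snd_le (F.flow t q))).trans_lt hq3
    have hq5 : q ∉ tsupport VΘ := by
      rw [notMem_tsupport_iff_eventuallyEq]
      filter_upwards [Metric.isOpen_ball.mem_nhds (mem_ball_zero_iff.2 hq4)] with z hz
      have h1 : Θ =ᶠ[𝓝 z] fun _ => 1 := by
        filter_upwards [Metric.isOpen_ball.mem_nhds hz] with z' hz' using hΘ1 z' hz'
      simp [hVΘ, h1.fderiv_eq]
    exact hq5 hq1
  have hd : ∀ j, ∀ t, 0 ≤ t → ev ((shiftedLie A μ)^[j] u) (fun x => deriv (fun s => Ψ s x) t) =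
      ev ((shiftedLie A μ)^[j] u) (divField A (Ψ t)) := by
    intro j t ht
    have h1 : (fun x => deriv (fun s => Ψ s x) t) =
        fun x => Θ x * divField A (transport A F.flow ψ t) x := by
      ext x
      exact ((deriv_transport hΦ hψ.1 t x).const_mul (Θ x)).deriv
    have h2 : divField A (Ψ t) = (fun x => Θ x * divField A (transport A F.flow ψ t) x) +
        fun q => VΘ q * transport A F.flow ψ t q := divField_mul A hΘ.1 (htrt t)
    have h3 : (fun x => Θ x * divField A (transport A F.flow ψ t) x) =
        divField A (Ψ t) + (-1 : ℂ) • fun q => VΘ q * transport A F.flow ψ t q := by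
      rw [h2]; ext x; simp
    have h4 := mul_mem_testSpace (testSpace_mono hK₀Ω hVΘK) (htrt t)
    rw [h1, h3, ev_add _ (divField_mem_testSpace A (testSpace_mono hK₀Ω (hΨs t)))
      (Submodule.smul_mem _ _ h4), ev_smul _ _ h4, herr j t ht, mul_zero, add_zero]
  have hfam : ∀ j, ∀ b : ℝ, 0 < b → _ := fun j b hb =>
    ev_iterate_family (A := A) μ u hK₀ hK₀Ω hΨ hb (fun t _ => hΨs t)
      (fun j t ht => hd j t ht.1) j
  have hzero := cascade_eq_zero (μ := μ) (fun j t => ev ((shiftedLie A μ)^[j] u) (Ψ t))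
    (fun j t ht => by
      have hb : t < t + 1 := lt_add_one t
      refine ((hfam j (t + 1) (lt_of_le_of_lt ht hb)).1 t ⟨ht, hb.le⟩).mono_of_mem_nhdsWithin ?_
      filter_upwards [self_mem_nhdsWithin, mem_nhdsWithin_of_mem_nhds (Iic_mem_nhds hb)] with
        s hs hs' using ⟨hs, hs'⟩)
    (fun j t ht => (hfam j (t + 1) (lt_of_le_of_lt ht (lt_add_one t))).2 t ⟨ht, lt_add_one t⟩)
    p (fun t _ => by rw [hu, ev_zero_left]) ?_ 0 le_rfl
  · have h1 : Ψ 0 = ψ := by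
      ext q
      simp only [hΨdef, transport_zero hΦ]
      by_cases hq : q ∈ tsupport ψ
      · rw [hΘ1 q (hψ.2.2 hq), one_mul]
      · rw [image_eq_zero_of_notMem_tsupport hq, mul_zero]
    rw [← h1]
    exact hzero
  · obtain ⟨C, hC0, hC⟩ := hM₀ K n ψ hψ.1 ⟨r / 2, fun q hq => by
      refine image_eq_zero_of_notMem_tsupport fun hqs => ?_
      have := mem_ball_zero_iff.1 (hψ.2.2 hqs)
      linarith [norm_snd_le q]⟩ hmom Θ hΘ
    have hlim : Tendsto (fun t : ℝ => C * (Real.exp ((τ - μ.re + (M₀ - F.ε * n)) * t) +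
        Real.exp ((τ - μ.re + -(F.ε * (K + 1))) * t))) atTop (𝓝 0) := by
      have h1 := tendsto_exp_mul_atTop_zero (a := τ - μ.re + (M₀ - F.ε * n)) (by linarith)
      have h2 := tendsto_exp_mul_atTop_zero (a := τ - μ.re + -(F.ε * (K + 1))) (by nlinarith)
      simpa using (h1.add h2).const_mul C
    refine squeeze_zero_norm' ?_ hlim
    filter_upwards [eventually_ge_atTop 0] with t ht
    have h1 : Ψ t = Complex.exp (t * (τ : ℂ)) • fun q => Θ q * ψ (F.flow t q) := by
      ext q
      simp only [hΨdef, transport, Pi.smul_apply, smul_eq_mul, ← hτ]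
      ring
    have h2 : (fun q => Θ q * ψ (F.flow t q)) ∈ testSpace (Ω : Set (X × Y)) :=
      mul_mem_testSpace hΘΩ (hψ.1.comp (F.flow t).contDiff)
    simp only [Function.iterate_zero, id_eq]
    rw [h1, ev_smul _ _ h2, norm_mul, norm_mul, Complex.norm_exp, Complex.norm_exp]
    have h3 : (-(μ * (t : ℂ))).re = -μ.re * t := by simp
    have h4 : ((t : ℂ) * (τ : ℂ)).re = t * τ := by simp
    rw [h3, h4]
    calc _ ≤ Real.exp (-μ.re * t) * (Real.exp (t * τ) * (C *
          (Real.exp ((M₀ - F.ε * n) * t) + Real.exp (-(F.ε * (K + 1)) * t)))) := by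
          gcongr
          exact hC t ht
      _ = _ := by
          have h5 : (τ - μ.re + (M₀ - F.ε * n)) * t =
              -μ.re * t + (t * τ + (M₀ - F.ε * n) * t) := by ring
          have h6 : (τ - μ.re + -(F.ε * (K + 1))) * t =
              -μ.re * t + (t * τ + -(F.ε * (K + 1)) * t) := by ring
          rw [h5, h6, Real.exp_add, Real.exp_add, Real.exp_add, Real.exp_add]
          ring

end Determination

/-! ### The flow of a block-diagonal linear field -/

theorem IsLinearFlow.prodMap {E E' : Type*} [NormedAddCommGroup E] [NormedSpace ℝ E]
    [NormedAddCommGroup E'] [NormedSpace ℝ E'] {A : E →L[ℝ] E} {Φ : ℝ → E →L[ℝ] E}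
    {A' : E' →L[ℝ] E'} {Φ' : ℝ → E' →L[ℝ] E'} (h : IsLinearFlow A Φ) (h' : IsLinearFlow A' Φ') :
    IsLinearFlow (A.prodMap A') (fun t => (Φ t).prodMap (Φ' t)) where
  smooth := (h.smooth.comp (contDiff_fst.prodMk (contDiff_fst.comp contDiff_snd))).prodMk
    (h'.smooth.comp (contDiff_fst.prodMk (contDiff_snd.comp contDiff_snd)))
  zero _ := Prod.ext (h.zero _) (h'.zero _)
  add s t _ := Prod.ext (h.add s t _) (h'.add s t _)
  deriv t q := (h.deriv t q.1).prodMk (h'.deriv t q.2)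

section BlockFlow

variable {a b : ℕ}

/-- The diagonal field with coefficients `χ j` on real lines and `κ j` on complex lines. -/
def blockField (χ : Fin a → ℝ) (κ : Fin b → ℂ) :
    (Fin a → ℝ) × (Fin b → ℂ) →L[ℝ] (Fin a → ℝ) × (Fin b → ℂ) :=
  (ContinuousLinearMap.pi fun j => (ContinuousLinearMap.mul ℝ ℝ (χ j)).comp
      (ContinuousLinearMap.proj j)).prodMap
    (ContinuousLinearMap.pi fun j => (ContinuousLinearMap.mul ℝ ℂ (κ j)).comp
      (ContinuousLinearMap.proj j))

/-- The flow of `blockField χ κ`. -/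
def blockFlow (χ : Fin a → ℝ) (κ : Fin b → ℂ) (t : ℝ) :
    (Fin a → ℝ) × (Fin b → ℂ) →L[ℝ] (Fin a → ℝ) × (Fin b → ℂ) :=
  blockField (fun j => Real.exp (t * χ j)) (fun j => Complex.exp (t * κ j))

variable (χ : Fin a → ℝ) (κ : Fin b → ℂ)

theorem blockFlow_fst (t : ℝ) (q : (Fin a → ℝ) × (Fin b → ℂ)) (j : Fin a) :
    (blockFlow χ κ t q).1 j = Real.exp (t * χ j) * q.1 j := rfl

theorem blockFlow_snd (t : ℝ) (q : (Fin a → ℝ) × (Fin b → ℂ)) (j : Fin b) :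
    (blockFlow χ κ t q).2 j = Complex.exp (t * κ j) * q.2 j := rfl

theorem isLinearFlow_blockFlow : IsLinearFlow (blockField χ κ) (blockFlow χ κ) where
  smooth := by
    refine ContDiff.prodMk (contDiff_pi.2 fun j => ?_) (contDiff_pi.2 fun j => ?_)
    · change ContDiff ℝ ∞ fun p : ℝ × ((Fin a → ℝ) × (Fin b → ℂ)) =>
        Real.exp (p.1 * χ j) * p.2.1 j
      fun_prop
    · have h1 : ContDiff ℝ ∞ fun p : ℝ × ((Fin a → ℝ) × (Fin b → ℂ)) =>
          Complex.exp ((p.1 : ℂ) * κ j) :=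
        ((Complex.ofRealCLM.contDiff.comp contDiff_fst).mul contDiff_const).cexp
      have h2 : ContDiff ℝ ∞ fun p : ℝ × ((Fin a → ℝ) × (Fin b → ℂ)) => p.2.2 j := by fun_prop
      exact h1.mul h2
  zero q := by
    refine Prod.ext (funext fun j => ?_) (funext fun j => ?_)
    · simp [blockFlow_fst]
    · simp [blockFlow_snd]
  add s t q := by
    refine Prod.ext (funext fun j => ?_) (funext fun j => ?_)
    · simp only [blockFlow_fst]
      rw [add_mul, Real.exp_add, mul_assoc]
    · simp only [blockFlow_snd]
      push_cast
      rw [add_mul, Complex.exp_add, mul_assoc]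
  deriv t q := by
    refine HasDerivAt.prodMk (hasDerivAt_pi.2 fun j => ?_) (hasDerivAt_pi.2 fun j => ?_)
    · change HasDerivAt (fun s => Real.exp (s * χ j) * q.1 j)
        (χ j * (Real.exp (t * χ j) * q.1 j)) t
      have h := (((hasDerivAt_id t).mul_const (χ j)).exp).mul_const (q.1 j)
      refine h.congr_deriv ?_
      simp only [id_eq, one_mul]
      ring
    · change HasDerivAt (fun s : ℝ => Complex.exp (s * κ j) * q.2 j)
        (κ j * (Complex.exp (t * κ j) * q.2 j)) t
      have h0 : HasDerivAt (fun s : ℝ => (s : ℂ) * κ j) (1 * κ j) t :=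
        (Complex.ofRealCLM.hasDerivAt (x := t)).mul_const (κ j)
      have h := (h0.cexp).mul_const (q.2 j)
      refine h.congr_deriv ?_
      simp only [one_mul]
      ring

theorem norm_blockFlow_le {t s : ℝ} (hχ : ∀ j, t * χ j ≤ s) (hκ : ∀ j, t * (κ j).re ≤ s)
    (q : (Fin a → ℝ) × (Fin b → ℂ)) : ‖blockFlow χ κ t q‖ ≤ Real.exp s * ‖q‖ := by
  rw [Prod.norm_def]
  refine max_le ?_ ?_
  · refine (pi_norm_le_iff_of_nonneg (by positivity)).2 fun j => ?_
    rw [blockFlow_fst, norm_mul, Real.norm_of_nonneg (Real.exp_pos _).le]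
    gcongr
    · exact hχ j
    · exact (norm_le_pi_norm q.1 j).trans (norm_fst_le q)
  · refine (pi_norm_le_iff_of_nonneg (by positivity)).2 fun j => ?_
    rw [blockFlow_snd, norm_mul, Complex.norm_exp, Complex.re_ofReal_mul]
    gcongr
    · exact hκ j
    · exact (norm_le_pi_norm q.2 j).trans (norm_snd_le q)

theorem trace_pi_comp_proj {ι R M : Type*} [Fintype ι] [Field R] [AddCommGroup M]
    [Module R M] [FiniteDimensional R M] (f : ι → M →ₗ[R] M) :
    LinearMap.trace R (ι → M) (LinearMap.pi fun i => (f i).comp (LinearMap.proj i)) =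
      ∑ i, LinearMap.trace R M (f i) := by
  classical
  have h : LinearMap.pi (fun i => (f i).comp (LinearMap.proj i)) =
      ∑ i, (LinearMap.single R (fun _ : ι => M) i).comp ((f i).comp (LinearMap.proj i)) := by
    ext i x j
    simp [Finset.sum_apply, Pi.single_apply]
  rw [h, map_sum]
  refine Finset.sum_congr rfl fun i _ => ?_
  rw [LinearMap.trace_comp_comm', LinearMap.comp_assoc]
  congr 1
  ext x
  simp

theorem trace_blockField : LinearMap.trace ℝ _ (blockField χ κ).toLinearMap =
    ∑ j, χ j + 2 * ∑ j, (κ j).re := by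
  have h1 : (blockField χ κ).toLinearMap =
      (LinearMap.pi fun j => (LinearMap.mul ℝ ℝ (χ j)).comp (LinearMap.proj j)).prodMap
      (LinearMap.pi fun j => (LinearMap.mul ℝ ℂ (κ j)).comp (LinearMap.proj j)) := rfl
  rw [h1, LinearMap.trace_prodMap', trace_pi_comp_proj, trace_pi_comp_proj, Finset.mul_sum]
  congr 1
  · refine Finset.sum_congr rfl fun j _ => ?_
    have : LinearMap.mul ℝ ℝ (χ j) = χ j • LinearMap.id := by ext; simp
    rw [this, map_smul, LinearMap.trace_id]
    simp
  · exact Finset.sum_congr rfl fun j _ => Algebra.trace_complex_apply (κ j)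

theorem det_blockField : LinearMap.det (blockField χ κ).toLinearMap =
    (∏ j, χ j) * ∏ j, ‖κ j‖ ^ 2 := by
  have h1 : (blockField χ κ).toLinearMap =
      (LinearMap.pi fun j => (LinearMap.mul ℝ ℝ (χ j)).comp (LinearMap.proj j)).prodMap
      (LinearMap.pi fun j => (LinearMap.mul ℝ ℂ (κ j)).comp (LinearMap.proj j)) := rfl
  rw [h1, LinearMap.det_prodMap, LinearMap.det_pi, LinearMap.det_pi]
  congr 1
  · refine Finset.prod_congr rfl fun j _ => ?_
    rw [LinearMap.det_ring]
    simp
  · refine Finset.prod_congr rfl fun j _ => ?_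
    rw [← Complex.normSq_eq_norm_sq]
    exact Algebra.norm_complex_apply (κ j)

theorem det_blockFlow (t : ℝ) : LinearMap.det (blockFlow χ κ t).toLinearMap =
    Real.exp (t * LinearMap.trace ℝ _ (blockField χ κ).toLinearMap) := by
  rw [blockFlow, det_blockField, trace_blockField, mul_add, Real.exp_add, Finset.mul_sum,
    Real.exp_sum]
  congr 1
  rw [Finset.mul_sum, Finset.mul_sum, Real.exp_sum]
  refine Finset.prod_congr rfl fun j _ => ?_
  rw [Complex.norm_exp, Complex.re_ofReal_mul, ← Real.exp_nat_mul]
  congr 1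
  push_cast
  ring

/-- Change of variables by the flow. -/
theorem integral_comp_blockFlow (m : Measure ((Fin a → ℝ) × (Fin b → ℂ))) [m.IsAddHaarMeasure]
    (t : ℝ) (g : (Fin a → ℝ) × (Fin b → ℂ) → ℂ) :
    ∫ y, g (blockFlow χ κ t y) ∂m =
      Complex.exp (-(t * ((LinearMap.trace ℝ _ (blockField χ κ).toLinearMap : ℝ) : ℂ))) *
        ∫ y, g y ∂m := by
  set τ := LinearMap.trace ℝ _ (blockField χ κ).toLinearMap
  have hΦ := isLinearFlow_blockFlow χ κ
  have hdet := det_blockFlow χ κ t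
  have hne : LinearMap.det (blockFlow χ κ t).toLinearMap ≠ 0 := by
    rw [hdet]; exact (Real.exp_pos _).ne'
  have hme : MeasurableEmbedding (blockFlow χ κ t) :=
    ((Homeomorph.mk ⟨blockFlow χ κ t, blockFlow χ κ (-t), hΦ.neg_apply_apply t,
      hΦ.apply_neg_apply t⟩ (blockFlow χ κ t).continuous
      (blockFlow χ κ (-t)).continuous)).measurableEmbedding
  have h1 := Measure.map_linearMap_addHaar_eq_smul_addHaar m hne
  have h2 := hme.integral_map (μ := m) g
  have h3 : Measure.map (blockFlow χ κ t) m = _ := h1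
  rw [← h2, h3, integral_smul_measure, hdet, ← Real.exp_neg, abs_of_pos (Real.exp_pos _),
    ENNReal.toReal_ofReal (Real.exp_pos _).le, Complex.real_smul]
  congr 1
  push_cast
  rfl

end BlockFlow

namespace HyperbolicBlocks

variable (B : HyperbolicBlocks)

theorem planeBlock_apply (χ om : ℝ) (z : ℂ) :
    planeBlock χ om z = ((χ : ℂ) - Complex.I * om) * z := by
  apply Complex.ext
  · simp [planeBlock]
  · simp [planeBlock]
    ring

/-- The coefficients of the stable planes. -/
def stableCoeff (j : Fin B.b) : ℂ := (B.χPs j : ℂ) - Complex.I * B.omPs j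

/-- The coefficients of the unstable planes. -/
def unstableCoeff (j : Fin B.d) : ℂ := (B.χPu j : ℂ) - Complex.I * B.omPu j

@[simp] theorem stableCoeff_re (j : Fin B.b) : (B.stableCoeff j).re = B.χPs j := by
  simp [stableCoeff]

@[simp] theorem unstableCoeff_re (j : Fin B.d) : (B.unstableCoeff j).re = B.χPu j := by
  simp [unstableCoeff]

theorem linearField_eq : B.linearField =
    (blockField B.χLs B.stableCoeff).prodMap (blockField B.χLu B.unstableCoeff) := by
  refine ContinuousLinearMap.ext fun q => Prod.ext (Prod.ext rfl (funext fun j => ?_))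
    (Prod.ext rfl (funext fun j => ?_))
  · exact planeBlock_apply _ _ _
  · exact planeBlock_apply _ _ _

theorem exists_rate : ∃ ε : ℝ, 0 < ε ∧ (∀ j, B.χLs j ≤ -ε) ∧ (∀ j, B.χPs j ≤ -ε) ∧
    (∀ j, ε ≤ B.χLu j) ∧ (∀ j, ε ≤ B.χPu j) := by
  have h : ∀ {k : ℕ} (f : Fin k → ℝ), (∀ j, 0 < f j) → ∃ ε : ℝ, 0 < ε ∧ ∀ j, ε ≤ f j := by
    intro k f hf
    rcases isEmpty_or_nonempty (Fin k) with h | h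
    · exact ⟨1, one_pos, fun j => (h.false j).elim⟩
    · obtain ⟨i, hi⟩ := Finite.exists_min f
      exact ⟨f i, hf i, hi⟩
  obtain ⟨e1, h1, h1'⟩ := h (fun j => -B.χLs j) fun j => neg_pos.2 (B.χLs_neg j)
  obtain ⟨e2, h2, h2'⟩ := h (fun j => -B.χPs j) fun j => neg_pos.2 (B.χPs_neg j)
  obtain ⟨e3, h3, h3'⟩ := h B.χLu B.χLu_pos
  obtain ⟨e4, h4, h4'⟩ := h B.χPu B.χPu_pos
  refine ⟨min (min e1 e2) (min e3 e4), by positivity, fun j => ?_, fun j => ?_, fun j => ?_,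
    fun j => ?_⟩
  · have : min (min e1 e2) (min e3 e4) ≤ e1 := (min_le_left _ _).trans (min_le_left _ _)
    linarith [h1' j]
  · have : min (min e1 e2) (min e3 e4) ≤ e2 := (min_le_left _ _).trans (min_le_right _ _)
    linarith [h2' j]
  · exact ((min_le_right _ _).trans (min_le_left _ _)).trans (h3' j)
  · exact ((min_le_right _ _).trans (min_le_right _ _)).trans (h4' j)

theorem exists_growth : ∃ C : ℝ, 0 ≤ C ∧ (∀ j, B.χLu j ≤ C) ∧ (∀ j, B.χPu j ≤ C) := by
  refine ⟨∑ j, B.χLu j + ∑ j, B.χPu j, add_nonneg (Finset.sum_nonneg fun j _ => (B.χLu_pos j).le)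
    (Finset.sum_nonneg fun j _ => (B.χPu_pos j).le), fun j => ?_, fun j => ?_⟩
  · have h1 := Finset.single_le_sum (f := B.χLu) (fun i _ => (B.χLu_pos i).le) (Finset.mem_univ j)
    have h2 := Finset.sum_nonneg (s := Finset.univ) fun j _ => (B.χPu_pos j).le
    linarith
  · have h1 := Finset.single_le_sum (f := B.χPu) (fun i _ => (B.χPu_pos i).le) (Finset.mem_univ j)
    have h2 := Finset.sum_nonneg (s := Finset.univ) fun j _ => (B.χLu_pos j).le
    linarith

/-- The index set of the stable directions: the stable lines, and two complex directions for each
stable plane. -/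
abbrev StableIndex : Type := Fin B.a ⊕ (Fin B.b ⊕ Fin B.b)

/-- The stable flow. -/
def stableFlow (t : ℝ) : B.X →L[ℝ] B.X := blockFlow B.χLs B.stableCoeff t

/-- The unstable flow. -/
def unstableFlow (t : ℝ) : B.Y →L[ℝ] B.Y := blockFlow B.χLu B.unstableCoeff t

theorem norm_unstableFlow_neg_le {ε : ℝ} (h1 : ∀ j, ε ≤ B.χLu j) (h2 : ∀ j, ε ≤ B.χPu j) {t : ℝ}
    (ht : 0 ≤ t) (y : B.Y) : ‖B.unstableFlow (-t) y‖ ≤ Real.exp (-(ε * t)) * ‖y‖ := by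
  refine norm_blockFlow_le _ _ (fun j => ?_) (fun j => ?_) y
  · nlinarith [h1 j]
  · rw [unstableCoeff_re]; nlinarith [h2 j]

/-- The flow of the block-diagonal field, with the complex directions in which the model
distributions are differentiated. -/
def saddle : SaddleFlow B.X B.Y B.StableIndex where
  S := B.stableFlow
  R := B.unstableFlow
  ε := B.exists_rate.choose
  bound := B.exists_growth.choose
  v := Sum.elim (fun j => (Pi.single j 1, 0))
    (Sum.elim (fun j => (0, Pi.single j 1)) (fun j => (0, Pi.single j 1)))
  w := Sum.elim (fun _ => 0)
    (Sum.elim (fun j => (0, Pi.single j Complex.I)) (fun j => (0, Pi.single j (-Complex.I))))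
  ζ := Sum.elim
    (fun j => Complex.ofRealCLM.comp
      ((ContinuousLinearMap.proj j).comp (ContinuousLinearMap.fst ℝ _ _)))
    (Sum.elim
      (fun j => (2⁻¹ : ℝ) • (Complex.conjCLE : ℂ →L[ℝ] ℂ).comp
        ((ContinuousLinearMap.proj j).comp (ContinuousLinearMap.snd ℝ _ _)))
      (fun j => (2⁻¹ : ℝ) •
        ((ContinuousLinearMap.proj j).comp (ContinuousLinearMap.snd ℝ _ _))))
  ν := Sum.elim (fun j => (B.χLs j : ℂ))
    (Sum.elim (fun j => (B.χPs j : ℂ) + Complex.I * B.omPs j) (fun j => B.stableCoeff j))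
  ε_pos := B.exists_rate.choose_spec.1
  bound_nonneg := B.exists_growth.choose_spec.1
  norm_S_le t ht x := by
    have h := norm_blockFlow_le B.χLs B.stableCoeff (t := t) (s := 0)
      (fun j => mul_nonpos_of_nonneg_of_nonpos ht (B.χLs_neg j).le)
      (fun j => by rw [stableCoeff_re]; exact mul_nonpos_of_nonneg_of_nonpos ht (B.χPs_neg j).le) x
    rwa [Real.exp_zero, one_mul] at h
  norm_R_le t ht y := by
    obtain ⟨-, h1, h2⟩ := B.exists_growth.choose_spec
    refine norm_blockFlow_le _ _ (fun j => ?_) (fun j => ?_) y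
    · nlinarith [h1 j]
    · rw [unstableCoeff_re]; nlinarith [h2 j]
  le_norm_R t ht y := by
    obtain ⟨-, -, -, h1, h2⟩ := B.exists_rate.choose_spec
    have h := B.norm_unstableFlow_neg_le h1 h2 ht (B.unstableFlow t y)
    have h3 : B.unstableFlow (-t) (B.unstableFlow t y) = y :=
      (isLinearFlow_blockFlow B.χLu B.unstableCoeff).neg_apply_apply t y
    rw [h3, Real.exp_neg] at h
    rwa [← le_inv_mul_iff₀ (Real.exp_pos _)]
  le_norm_comp_R t ht ℓ := by
    obtain ⟨-, -, -, h1, h2⟩ := B.exists_rate.choose_spec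
    set ε := B.exists_rate.choose
    have h : ‖ℓ‖ ≤ Real.exp (-(ε * t)) * ‖ℓ.comp (B.unstableFlow t)‖ := by
      refine ℓ.opNorm_le_bound (by positivity) fun y => ?_
      have h3 := (ℓ.comp (B.unstableFlow t)).le_opNorm (B.unstableFlow (-t) y)
      have h4 : B.unstableFlow t (B.unstableFlow (-t) y) = y :=
        (isLinearFlow_blockFlow B.χLu B.unstableCoeff).apply_neg_apply t y
      rw [ContinuousLinearMap.comp_apply, h4] at h3
      refine h3.trans ?_
      rw [mul_comm (Real.exp _), mul_assoc]
      gcongr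
      exact B.norm_unstableFlow_neg_le h1 h2 ht y
    rw [Real.exp_neg] at h
    rwa [← le_inv_mul_iff₀ (Real.exp_pos _)]
  ζ_S i t x := by
    rcases i with j | j | j
    · simp [stableFlow, blockFlow_fst]
    · simp [stableFlow, blockFlow_snd, stableCoeff, ← Complex.exp_conj]
      ring
    · simp [stableFlow, blockFlow_snd]
      ring
  re_ν_le i := by
    obtain ⟨-, h1, h2, -⟩ := B.exists_rate.choose_spec
    rcases i with j | j | j
    · simpa using h1 j
    · simpa using h2 j
    · simpa using h2 j
  expand L x := by
    have hx : x = ∑ j, x.1 j • ((Pi.single j 1, 0) : B.X) +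
        ∑ j, ((x.2 j).re • ((0, Pi.single j 1) : B.X) +
          (x.2 j).im • ((0, Pi.single j Complex.I) : B.X)) := by
      refine Prod.ext (funext fun k => ?_) (funext fun k => ?_)
      · simp [Prod.fst_sum, Finset.sum_apply, Pi.single_apply]
      · simp [Prod.snd_sum, Finset.sum_apply, Pi.single_apply, Finset.sum_add_distrib]
    conv_lhs => rw [hx]
    rw [map_add, map_sum, map_sum, Fintype.sum_sum_type, Fintype.sum_sum_type,
      ← Finset.sum_add_distrib]
    congr 1
    · refine Finset.sum_congr rfl fun j _ => ?_
      rw [map_smul]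
      simp
    · refine Finset.sum_congr rfl fun j _ => ?_
      have hneg : L (0, Pi.single j (-Complex.I)) = -L (0, Pi.single j Complex.I) := by
        rw [← map_neg]
        simp [Pi.single_neg]
      rw [map_add, map_smul, map_smul]
      simp [hneg]
      generalize L (0, Pi.single j 1) = P
      generalize L (0, Pi.single j Complex.I) = Q
      generalize x.2 j = z
      have h1 : (starRingEnd ℂ) z = z.re - z.im * Complex.I := by
        apply Complex.ext <;> simp
      have h2 : z = z.re + z.im * Complex.I := (Complex.re_add_im z).symm
      rw [h1]
      conv_rhs => rw [h2]
      simp only [Complex.add_re, Complex.ofReal_re, Complex.re_ofReal_mul, Complex.I_re, mul_zero,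
        add_zero, Complex.add_im, Complex.ofReal_im, Complex.im_ofReal_mul, Complex.I_im, mul_one,
        zero_add]
      linear_combination z.im * Q * Complex.I_mul_I

theorem isLinearFlow_saddle : IsLinearFlow B.linearField B.saddle.flow := by
  rw [linearField_eq]
  have h1 := isLinearFlow_blockFlow B.χLs B.stableCoeff
  have h2 := isLinearFlow_blockFlow B.χLu B.unstableCoeff
  exact h1.prodMap h2

end HyperbolicBlocks

/-! ### Pairings with the model distributions -/

section DerivativeOfDistributions

variable {E : Type*} [NormedAddCommGroup E] [NormedSpace ℝ E] {Ω : Opens E}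

theorem ev_lineDeriv (v : E) (u : Distribution Ω ℂ ⊤) {f : E → ℂ}
    (hf : f ∈ testSpace (Ω : Set E)) :
    ev (∂_{v} u : Distribution Ω ℂ ⊤) f = -ev u (fun q => fderiv ℝ f q v) := by
  have hg : (fun q => fderiv ℝ f q v) ∈ testSpace (Ω : Set E) :=
    fderiv_apply_mem_testSpace hf (W := fun _ => v) contDiff_const
  rw [ev_of_mem _ hf, ev_of_mem _ hg]
  have hd : ∀ q, HasFDerivAt f (fderiv ℝ f q) q := fun q =>
    ((hf.1.differentiable (by simp)) q).hasFDerivAt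
  have h1 : ∂_{v} (reTest ⟨f, hf⟩) = reTest ⟨_, hg⟩ := by
    ext q
    rw [TestFunction.lineDerivOp_eq_lineDerivCLM (𝕜 := ℝ), TestFunction.lineDerivCLM_apply_of_le le_top]
    have h : HasFDerivAt (fun x => (f x).re) (Complex.reCLM.comp (fderiv ℝ f q)) q :=
      Complex.reCLM.hasFDerivAt.comp q (hd q)
    exact h.hasLineDerivAt v |>.lineDeriv
  have h2 : ∂_{v} (imTest ⟨f, hf⟩) = imTest ⟨_, hg⟩ := by
    ext q
    rw [TestFunction.lineDerivOp_eq_lineDerivCLM (𝕜 := ℝ), TestFunction.lineDerivCLM_apply_of_le le_top]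
    have h : HasFDerivAt (fun x => (f x).im) (Complex.imCLM.comp (fderiv ℝ f q)) q :=
      Complex.imCLM.hasFDerivAt.comp q (hd q)
    exact h.hasLineDerivAt v |>.lineDeriv
  change (∂_{v} u : Distribution Ω ℂ ⊤) _ + Complex.I * (∂_{v} u : Distribution Ω ℂ ⊤) _ =
    -(u _ + Complex.I * u _)
  rw [Distribution.lineDerivOp_apply_apply, Distribution.lineDerivOp_apply_apply, h1, h2, map_neg,
    map_neg]
  ring

theorem ev_complexDeriv [FiniteDimensional ℝ E] (v w : E) (u : Distribution Ω ℂ ⊤) {f : E → ℂ}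
    (hf : f ∈ testSpace (Ω : Set E)) :
    ev (complexDeriv v w u) f = -ev u (cDeriv v w f) := by
  have hg : ∀ v, (fun q => fderiv ℝ f q v) ∈ testSpace (Ω : Set E) := fun v =>
    fderiv_apply_mem_testSpace hf (W := fun _ => v) contDiff_const
  have h1 : cDeriv v w f = (fun q => fderiv ℝ f q v) + Complex.I • fun q => fderiv ℝ f q w := rfl
  rw [complexDeriv, ev_add_left, ev_smul_left, ev_lineDeriv v u hf, ev_lineDeriv w u hf, h1,
    ev_add u (hg v) (Submodule.smul_mem _ _ (hg w)), ev_smul u _ (hg w)]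
  ring

end DerivativeOfDistributions

section Words

variable {X Y ι : Type*} [NormedAddCommGroup X] [NormedSpace ℝ X] [NormedAddCommGroup Y]
  [NormedSpace ℝ Y] [Fintype ι] (F : SaddleFlow X Y ι)

namespace SaddleFlow

theorem partialWord_perm {σ σ' : List ι} (h : σ.Perm σ') {f : X × Y → ℂ} (hf : ContDiff ℝ ∞ f) :
    F.partialWord σ f = F.partialWord σ' f := by
  induction h with
  | nil => rfl
  | cons i _ ih => exact congrArg (F.partialX i) ih
  | swap i j l => exact cDeriv_comm _ _ _ _ (F.contDiff_partialWord l hf)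
  | trans _ _ ih ih' => exact ih.trans ih'

theorem partialWord_mem_testSpace (σ : List ι) {s : Set (X × Y)} {f : X × Y → ℂ}
    (hf : f ∈ testSpace s) : F.partialWord σ f ∈ testSpace s := by
  induction σ with
  | nil => exact hf
  | cons i σ ih => exact cDeriv_mem_testSpace _ _ ih

theorem partialWord_append (σ τ : List ι) (f : X × Y → ℂ) :
    F.partialWord (σ ++ τ) f = F.partialWord σ (F.partialWord τ f) := by
  simp [partialWord, List.foldr_append]

end SaddleFlow

end Words

namespace HyperbolicBlocks

variable {B : HyperbolicBlocks}

theorem isClosedEmbedding_zero_prod : IsClosedEmbedding (fun y : B.Y => ((0, y) : B.Coord)) :=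
  Function.LeftInverse.isClosedEmbedding (f := Prod.snd) (fun _ => rfl) continuous_snd
    (by fun_prop)

theorem ev_diracMonomial (Ω : Opens B.Coord) (α : B.MultiIndex) {f : B.Coord → ℂ}
    (hf : f ∈ testSpace (Ω : Set B.Coord)) :
    ev (diracMonomial Ω α) f = ∫ y : B.Y, f (0, y) * monomial α y := by
  rw [ev_of_mem _ hf]
  change diracMonomial Ω α _ + Complex.I * diracMonomial Ω α _ = _
  rw [diracMonomial_apply, diracMonomial_apply]
  have hemb : IsClosedEmbedding (fun y : B.Y => ((0, y) : B.Coord)) := isClosedEmbedding_zero_prod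
  have hc : ∀ ψ : 𝓓(Ω, ℝ), Integrable fun y : B.Y => (ψ (0, y) : ℂ) * monomial α y := by
    intro ψ
    have h1 : Continuous fun y : B.Y => (ψ (0, y) : ℂ) :=
      Complex.continuous_ofReal.comp (ψ.contDiff.continuous.comp (by fun_prop))
    refine (h1.mul (continuous_monomial α)).integrable_of_hasCompactSupport
      (HasCompactSupport.mul_right ?_)
    exact ((ψ.hasCompactSupport.comp_isClosedEmbedding hemb).comp_left Complex.ofReal_zero)
  rw [← integral_const_mul, ← integral_add (hc _) ((hc _).const_mul _)]
  congr 1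
  ext y
  have h2 : f (0, y) = ((f (0, y)).re : ℂ) + ((f (0, y)).im : ℂ) * Complex.I :=
    (Complex.re_add_im _).symm
  rw [h2]
  change ((f (0, y)).re : ℂ) * _ + Complex.I * (((f (0, y)).im : ℂ) * _) = _
  ring

/-- The operators on distributions from which the model distributions are built. -/
def stableDeriv (Ω : Opens B.Coord) :
    B.StableIndex → Distribution Ω ℂ ⊤ → Distribution Ω ℂ ⊤ :=
  Sum.elim (fun j u => ∂_{(((Pi.single j 1, 0), 0) : B.Coord)} u)
    (Sum.elim
      (fun j => complexDeriv (((0, Pi.single j 1), 0) : B.Coord)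
            (((0, Pi.single j Complex.I), 0) : B.Coord))
      (fun j => complexDeriv (((0, Pi.single j 1), 0) : B.Coord)
            (((0, Pi.single j (-Complex.I)), 0) : B.Coord)))

theorem ev_stableDeriv (Ω : Opens B.Coord) (i : B.StableIndex) (u : Distribution Ω ℂ ⊤)
    {f : B.Coord → ℂ} (hf : f ∈ testSpace (Ω : Set B.Coord)) :
    ev (stableDeriv Ω i u) f = -ev u (B.saddle.partialX i f) := by
  rcases i with j | j | j
  · refine (ev_lineDeriv _ u hf).trans ?_
    congr 2
    ext q
    have : ((0, 0) : B.X × B.Y) = 0 := rfl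
    simp [SaddleFlow.partialX, cDeriv, saddle, this]
  · exact ev_complexDeriv _ _ u hf
  · exact ev_complexDeriv _ _ u hf

/-- The multi-index `α_x`, as a word in the stable directions. -/
def stableWord (α : B.MultiIndex) : List B.StableIndex :=
  ((List.finRange B.a).flatMap fun j => List.replicate (α.s j) (Sum.inl j)) ++
    (List.finRange B.b).flatMap fun j => List.replicate (α.z j) (Sum.inr (Sum.inl j)) ++
      List.replicate (α.zbar j) (Sum.inr (Sum.inr j))

theorem foldr_replicate_eq {ι T : Type*} (D : ι → T → T) (i : ι) (k : ℕ) (t : T) :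
    (List.replicate k i).foldr D t = (D i)^[k] t := by
  induction k with
  | zero => rfl
  | succ k ih => rw [List.replicate_succ, List.foldr_cons, ih, Function.iterate_succ_apply']

theorem model_eq_foldr (Ω : Opens B.Coord) (α : B.MultiIndex) :
    model Ω α = (stableWord α).foldr (stableDeriv Ω) (diracMonomial Ω α) := by
  rw [stableWord, List.foldr_append, List.foldr_flatMap, List.foldr_flatMap, model, composeFin,
    composeFin]
  simp only [List.foldr_append, foldr_replicate_eq]
  rfl

/-- The pairing of a test function with the model distribution, up to sign. -/
def modelPairing (α : B.MultiIndex) (f : B.Coord → ℂ) : ℂ :=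
  ∫ y : B.Y, B.saddle.partialWord (stableWord α) f (0, y) * monomial α y

theorem ev_model (Ω : Opens B.Coord) (α : B.MultiIndex) {f : B.Coord → ℂ}
    (hf : f ∈ testSpace (Ω : Set B.Coord)) :
    ev (model Ω α) f = (-1) ^ (stableWord α).length * modelPairing α f := by
  have h : ∀ (σ : List B.StableIndex) (u : Distribution Ω ℂ ⊤) (f : B.Coord → ℂ),
      f ∈ testSpace (Ω : Set B.Coord) → ev (σ.foldr (stableDeriv Ω) u) f =
        (-1) ^ σ.length * ev u (B.saddle.partialWord σ.reverse f) := by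
    intro σ u
    induction σ with
    | nil => intro f _; simp [SaddleFlow.partialWord]
    | cons i σ ih =>
      intro f hf
      rw [List.foldr_cons, ev_stableDeriv Ω i _ hf, ih (B.saddle.partialX i f) (cDeriv_mem_testSpace _ _ hf),
        List.reverse_cons, SaddleFlow.partialWord_append, List.length_cons, pow_succ]
      simp only [mul_neg, mul_one, neg_mul]
      rfl
  rw [model_eq_foldr, h _ _ f hf, ev_diracMonomial Ω α (B.saddle.partialWord_mem_testSpace _ hf),
    B.saddle.partialWord_perm (List.reverse_perm _) hf.1]
  rfl

instance : LawfulBEq B.StableIndex where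
  eq_of_beq {x y} h := by
    rcases x with x | x | x <;> rcases y with y | y | y <;> first
      | exact congrArg Sum.inl (eq_of_beq (show (x == y) = true from h))
      | exact congrArg (Sum.inr ∘ Sum.inl) (eq_of_beq (show (x == y) = true from h))
      | exact congrArg (Sum.inr ∘ Sum.inr) (eq_of_beq (show (x == y) = true from h))
      | exact absurd h (by simp [BEq.beq, Sum.instBEq.beq])
  rfl {x} := by
    rcases x with x | x | x <;> exact beq_self_eq_true x

theorem count_stableWord (α : B.MultiIndex) (i : B.StableIndex) :
    (stableWord α).count i = Sum.elim α.s (Sum.elim α.z α.zbar) i := by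
  have hsum : ∀ {k : ℕ} (f : Fin k → ℕ), ((List.finRange k).map f).sum = ∑ j, f j := fun f => by
    rw [← List.ofFn_eq_map, List.sum_ofFn]
  rw [stableWord, List.count_append, List.count_flatMap, List.count_flatMap]
  simp only [Function.comp_def, List.count_append, List.count_replicate, hsum]
  rcases i with j | j | j
  · simp [Finset.sum_ite_eq']
  · simp
  · simp

/-! ### Moments and monomials -/

/-- The span of the monomials in `y` with all exponents at most `k`. -/
def monomialSpan (B : HyperbolicBlocks) (k : ℕ) : Submodule ℂ (B.Y → ℂ) :=
  Submodule.span ℂ {g | ∃ α : B.MultiIndex, (∀ j, α.u j ≤ k) ∧ (∀ j, α.w j ≤ k) ∧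
    (∀ j, α.wbar j ≤ k) ∧ g = monomial α}

theorem mul_mem_monomialSpan {k : ℕ} {g : B.Y → ℂ} (hg : g ∈ B.monomialSpan k) (h : B.Y → ℂ)
    (hh : ∀ α : B.MultiIndex, (∀ j, α.u j ≤ k) → (∀ j, α.w j ≤ k) → (∀ j, α.wbar j ≤ k) →
      (fun y => h y * monomial α y) ∈ B.monomialSpan (k + 1)) :
    (fun y => h y * g y) ∈ B.monomialSpan (k + 1) := by
  induction hg using Submodule.span_induction with
  | mem g hg =>
    obtain ⟨α, h1, h2, h3, rfl⟩ := hg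
    exact hh α h1 h2 h3
  | zero =>
    simp only [Pi.zero_apply, mul_zero]
    exact zero_mem _
  | add g g' _ _ ih ih' =>
    simp only [Pi.add_apply, mul_add]
    exact add_mem ih ih'
  | smul c g _ ih =>
    have : (fun y => h y * (c • g) y) = c • fun y => h y * g y := by
      ext y; simp only [Pi.smul_apply, smul_eq_mul]; ring
    rw [this]
    exact Submodule.smul_mem _ _ ih

theorem pow_mem_monomialSpan (ℓ : B.Y →L[ℝ] ℝ) (k : ℕ) :
    (fun y => (ℓ y : ℂ) ^ k) ∈ B.monomialSpan k := by
  induction k with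
  | zero =>
    refine Submodule.subset_span ⟨⟨0, 0, 0, 0, 0, 0⟩, by simp, by simp, by simp, ?_⟩
    ext y
    simp [monomial]
  | succ k ih =>
    have hpow : (fun y => (ℓ y : ℂ) ^ (k + 1)) = fun y => (ℓ y : ℂ) * (ℓ y : ℂ) ^ k := by
      ext y; rw [pow_succ']
    rw [hpow]
    refine mul_mem_monomialSpan ih _ fun α h1 h2 h3 => ?_
    have hu : ∀ j, (fun y : B.Y => (y.1 j : ℂ) * monomial α y) ∈ B.monomialSpan (k + 1) := by
      intro j
      refine Submodule.subset_span ⟨{ α with u := Function.update α.u j (α.u j + 1) }, ?_,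
        fun i => (h2 i).trans k.le_succ, fun i => (h3 i).trans k.le_succ, ?_⟩
      · intro i
        rcases eq_or_ne i j with rfl | hij
        · simpa using h1 i
        · simpa [hij] using (h1 i).trans k.le_succ
      · ext y
        simp only [monomial]
        rw [← Finset.mul_prod_erase _ _ (Finset.mem_univ j),
          ← Finset.mul_prod_erase (a := j) (f := fun i => (y.1 i : ℂ) ^ Function.update α.u j (α.u j + 1) i) _ (Finset.mem_univ j),
          Function.update_self]
        have : ∀ i ∈ Finset.univ.erase j, (y.1 i : ℂ) ^ Function.update α.u j (α.u j + 1) i =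
            (y.1 i : ℂ) ^ α.u i := fun i hi => by
          rw [Function.update_of_ne (Finset.ne_of_mem_erase hi)]
        rw [Finset.prod_congr rfl this]
        ring
    have hw : ∀ j, (fun y : B.Y => y.2 j * monomial α y) ∈ B.monomialSpan (k + 1) := by
      intro j
      refine Submodule.subset_span ⟨{ α with w := Function.update α.w j (α.w j + 1) },
        fun i => (h1 i).trans k.le_succ, ?_, fun i => (h3 i).trans k.le_succ, ?_⟩
      · intro i
        rcases eq_or_ne i j with rfl | hij
        · simpa using h2 i
        · simpa [hij] using (h2 i).trans k.le_succ
      · ext y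
        simp only [monomial, Finset.prod_mul_distrib]
        rw [← Finset.mul_prod_erase (a := j) (f := fun i => y.2 i ^ α.w i) _ (Finset.mem_univ j),
          ← Finset.mul_prod_erase (a := j)
            (f := fun i => y.2 i ^ Function.update α.w j (α.w j + 1) i) _ (Finset.mem_univ j),
          Function.update_self]
        have : ∀ i ∈ Finset.univ.erase j, y.2 i ^ Function.update α.w j (α.w j + 1) i =
            y.2 i ^ α.w i := fun i hi => by
          rw [Function.update_of_ne (Finset.ne_of_mem_erase hi)]
        rw [Finset.prod_congr rfl this]
        ring
    have hwbar : ∀ j, (fun y : B.Y => (starRingEnd ℂ) (y.2 j) * monomial α y) ∈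
        B.monomialSpan (k + 1) := by
      intro j
      refine Submodule.subset_span ⟨{ α with wbar := Function.update α.wbar j (α.wbar j + 1) },
        fun i => (h1 i).trans k.le_succ, fun i => (h2 i).trans k.le_succ, ?_, ?_⟩
      · intro i
        rcases eq_or_ne i j with rfl | hij
        · simpa using h3 i
        · simpa [hij] using (h3 i).trans k.le_succ
      · ext y
        simp only [monomial, Finset.prod_mul_distrib]
        rw [← Finset.mul_prod_erase (a := j) (f := fun i => (starRingEnd ℂ) (y.2 i) ^ α.wbar i) _
            (Finset.mem_univ j),
          ← Finset.mul_prod_erase (a := j) (f := fun i => (starRingEnd ℂ) (y.2 i) ^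
            Function.update α.wbar j (α.wbar j + 1) i) _ (Finset.mem_univ j),
          Function.update_self]
        have : ∀ i ∈ Finset.univ.erase j, (starRingEnd ℂ) (y.2 i) ^
            Function.update α.wbar j (α.wbar j + 1) i =
            (starRingEnd ℂ) (y.2 i) ^ α.wbar i := fun i hi => by
          rw [Function.update_of_ne (Finset.ne_of_mem_erase hi)]
        rw [Finset.prod_congr rfl this]
        ring
    -- the expansion of a linear form in the coordinates `y_j`, `w_j`, `wbar_j`
    have hℓ : (fun y => (ℓ y : ℂ) * monomial α y) =
        ∑ j, (ℓ (Pi.single j 1, 0) : ℂ) • (fun y : B.Y => (y.1 j : ℂ) * monomial α y) +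
        ∑ j, ((((ℓ (0, Pi.single j 1) : ℂ) - Complex.I * ℓ (0, Pi.single j Complex.I)) / 2) •
            (fun y : B.Y => y.2 j * monomial α y) +
          (((ℓ (0, Pi.single j 1) : ℂ) + Complex.I * ℓ (0, Pi.single j Complex.I)) / 2) •
            (fun y : B.Y => (starRingEnd ℂ) (y.2 j) * monomial α y)) := by
      ext y
      have hy : y = ∑ j, y.1 j • ((Pi.single j 1, 0) : B.Y) +
          ∑ j, ((y.2 j).re • ((0, Pi.single j 1) : B.Y) +
            (y.2 j).im • ((0, Pi.single j Complex.I) : B.Y)) := by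
        refine Prod.ext (funext fun k => ?_) (funext fun k => ?_)
        · simp [Prod.fst_sum, Finset.sum_apply, Pi.single_apply]
        · simp [Prod.snd_sum, Finset.sum_apply, Pi.single_apply, Finset.sum_add_distrib]
      have hℓy : ℓ y = ∑ j, y.1 j * ℓ (Pi.single j 1, 0) +
          ∑ j, ((y.2 j).re * ℓ (0, Pi.single j 1) + (y.2 j).im * ℓ (0, Pi.single j Complex.I)) := by
        conv_lhs => rw [hy]
        rw [map_add, map_sum, map_sum]
        simp only [map_add, map_smul, smul_eq_mul]
      rw [hℓy]
      simp only [Pi.add_apply, Finset.sum_apply, Pi.smul_apply, smul_eq_mul]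
      push_cast
      rw [add_mul, Finset.sum_mul, Finset.sum_mul]
      congr 1
      · exact Finset.sum_congr rfl fun j _ => by ring
      · refine Finset.sum_congr rfl fun j _ => ?_
        have h1 : (starRingEnd ℂ) (y.2 j) = (y.2 j).re - (y.2 j).im * Complex.I := by
          apply Complex.ext <;> simp
        have h2 : y.2 j = (y.2 j).re + (y.2 j).im * Complex.I := (Complex.re_add_im _).symm
        rw [h1]
        generalize (y.2 j).re = a at h2 ⊢
        generalize (y.2 j).im = b at h2 ⊢
        rw [h2]
        linear_combination ((b : ℂ) * ℓ (0, Pi.single j Complex.I) * monomial α y) * Complex.I_mul_I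
    rw [hℓ]
    exact add_mem (sum_mem fun j _ => Submodule.smul_mem _ _ (hu j)) (sum_mem fun j _ =>
      add_mem (Submodule.smul_mem _ _ (hw j)) (Submodule.smul_mem _ _ (hwbar j)))

theorem finite_multiIndex_le (B : HyperbolicBlocks) (N : ℕ) : {α : B.MultiIndex | (∀ j, α.s j ≤ N) ∧
    (∀ j, α.z j ≤ N) ∧ (∀ j, α.zbar j ≤ N) ∧ (∀ j, α.u j ≤ N) ∧ (∀ j, α.w j ≤ N) ∧
    (∀ j, α.wbar j ≤ N)}.Finite := by
  let e : B.MultiIndex → (Fin B.a → ℕ) × (Fin B.b → ℕ) × (Fin B.b → ℕ) × (Fin B.c → ℕ) ×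
    (Fin B.d → ℕ) × (Fin B.d → ℕ) := fun α => (α.s, α.z, α.zbar, α.u, α.w, α.wbar)
  have he : Function.Injective e := by
    rintro ⟨⟩ ⟨⟩ h
    simp only [e, Prod.mk.injEq] at h
    obtain ⟨rfl, rfl, rfl, rfl, rfl, rfl⟩ := h
    rfl
  have hfin : ∀ k : ℕ, {f : Fin k → ℕ | ∀ j, f j ≤ N}.Finite := fun k =>
    (Set.finite_Iic (fun _ : Fin k => N)).subset fun f hf => hf
  refine Set.Finite.subset (Set.Finite.preimage he.injOn ((hfin B.a).prod ((hfin B.b).prod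
    ((hfin B.b).prod ((hfin B.c).prod ((hfin B.d).prod (hfin B.d))))))) ?_
  rintro α ⟨h1, h2, h3, h4, h5, h6⟩
  exact ⟨h1, h2, h3, h4, h5, h6⟩

/-- Finitely many model distributions control the moments. -/
theorem exists_finset_momentsVanish (n K : ℕ) : ∃ S : Finset B.MultiIndex,
    ∀ (s : Set B.Coord), ∀ ψ ∈ testSpace s, (∀ α ∈ S, modelPairing α ψ = 0) →
      B.saddle.MomentsVanish volume n K ψ := by
  refine ⟨(B.finite_multiIndex_le (n + K)).toFinset, fun s ψ hψ h σ hσ ℓ k hk => ?_⟩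
  set f := fun y : B.Y => B.saddle.partialWord σ ψ (0, y) with hf
  have hψσ := B.saddle.partialWord_mem_testSpace σ hψ
  have hfc : Continuous f := hψσ.1.continuous.comp (by fun_prop)
  have hfs : HasCompactSupport f :=
    hψσ.2.1.comp_isClosedEmbedding isClosedEmbedding_zero_prod
  have key : ∀ g ∈ B.monomialSpan k, Continuous g ∧ ∫ y, f y * g y = 0 := by
    intro g hg
    have hint : ∀ g : B.Y → ℂ, Continuous g → Integrable fun y => f y * g y := fun g hg =>
      (hfc.mul hg).integrable_of_hasCompactSupport hfs.mul_right
    induction hg using Submodule.span_induction with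
    | mem g hg =>
      obtain ⟨α, h1, h2, h3, rfl⟩ := hg
      refine ⟨continuous_monomial α, ?_⟩
      let β : B.MultiIndex := { α with
        s := fun j => σ.count (Sum.inl j)
        z := fun j => σ.count (Sum.inr (Sum.inl j))
        zbar := fun j => σ.count (Sum.inr (Sum.inr j)) }
      have hcount : ∀ i, σ.count i ≤ n + K := fun i => List.count_le_length.trans (by omega)
      have hβ := h β (by
        simp only [Finite.mem_toFinset, mem_ofPred_eq]
        exact ⟨fun j => hcount _, fun j => hcount _, fun j => hcount _,
          fun j => (h1 j).trans (by omega), fun j => (h2 j).trans (by omega),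
          fun j => (h3 j).trans (by omega)⟩)
      have hperm : (stableWord β).Perm σ := by
        rw [List.perm_iff_count]
        intro i
        rw [count_stableWord]
        rcases i with j | j | j <;> rfl
      rw [modelPairing, B.saddle.partialWord_perm hperm hψ.1] at hβ
      exact hβ
    | zero => exact ⟨continuous_zero, by simp⟩
    | add g g' _ _ ih ih' =>
      refine ⟨ih.1.add ih'.1, ?_⟩
      simp only [Pi.add_apply, mul_add]
      rw [integral_add (hint g ih.1) (hint g' ih'.1), ih.2, ih'.2, add_zero]
    | smul c g _ ih =>
      refine ⟨ih.1.const_smul c, ?_⟩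
      have : ∀ y, f y * (c • g) y = c * (f y * g y) := fun y => by
        simp only [Pi.smul_apply, smul_eq_mul]; ring
      simp_rw [this]
      rw [integral_const_mul, ih.2, mul_zero]
  exact (key _ (pow_mem_monomialSpan ℓ k)).2

end HyperbolicBlocks

/-! ### The model distributions are eigendistributions -/

section Transport

variable {E : Type*} [NormedAddCommGroup E] [NormedSpace ℝ E] [FiniteDimensional ℝ E]
  {A : E →L[ℝ] E} {Φ : ℝ → E →L[ℝ] E} (hΦ : IsLinearFlow A Φ)

include hΦ in
theorem isCompact_flow_image {I : Set ℝ} (hI : IsCompact I) {K : Set E} (hK : IsCompact K) :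
    IsCompact ((fun p : ℝ × E => Φ (-p.1) p.2) '' (I ×ˢ K)) := by
  refine (hI.prod hK).image ?_
  exact hΦ.continuous.comp (continuous_fst.neg.prodMk continuous_snd)

include hΦ in
theorem transport_mem_testSpace {I : Set ℝ} (hI : IsCompact I) {s : Set E} {f : E → ℂ}
    (hf : f ∈ testSpace s) {t : ℝ} (ht : t ∈ I) :
    transport A Φ f t ∈
      testSpace ((fun p : ℝ × E => Φ (-p.1) p.2) '' (I ×ˢ tsupport f)) := by
  refine mem_testSpace_of_isCompact (isCompact_flow_image hΦ hI hf.2.1.isCompact)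
    (contDiff_partial (contDiff_transport hΦ hf.1) t) fun q hq => ?_
  have : f (Φ t q) = 0 := by
    refine image_eq_zero_of_notMem_tsupport fun h => hq ⟨(t, Φ t q), ⟨ht, h⟩, ?_⟩
    exact hΦ.neg_apply_apply t q
  simp [transport, this]

end Transport

namespace HyperbolicBlocks

variable {B : HyperbolicBlocks}

instance : (volume : Measure B.Y).IsAddHaarMeasure := Measure.prod.instIsAddHaarMeasure _ _

theorem partialX_comp_flow (i : B.StableIndex) (t : ℝ) {f : B.Coord → ℂ} (hf : ContDiff ℝ ∞ f) :
    B.saddle.partialX i (fun q => f (B.saddle.flow t q)) =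
      Complex.exp (t * B.saddle.ν i) • fun q => B.saddle.partialX i f (B.saddle.flow t q) := by
  have key : ∀ G : B.Coord →L[ℝ] ℂ,
      G (B.saddle.flow t (B.saddle.v i, 0)) + Complex.I * G (B.saddle.flow t (B.saddle.w i, 0)) =
        Complex.exp (t * B.saddle.ν i) *
          (G (B.saddle.v i, 0) + Complex.I * G (B.saddle.w i, 0)) := by
    intro G
    have h00 : ((0, 0) : B.X × B.Y) = 0 := rfl
    have hplane : ∀ (j : Fin B.b) (z : ℂ), B.saddle.flow t (((0, Pi.single j z), 0) : B.Coord) =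
        (((0, Pi.single j (Complex.exp (t * B.stableCoeff j) * z)), 0) : B.Coord) := by
      intro j z
      rw [SaddleFlow.flow_apply]
      refine Prod.ext (Prod.ext (funext fun k => ?_) (funext fun k => ?_)) (map_zero _)
      · exact mul_zero _
      · change Complex.exp (t * B.stableCoeff k) * (Pi.single j z : Fin B.b → ℂ) k = _
        rcases eq_or_ne k j with rfl | hkj
        · simp
        · simp [hkj]
    have hlin : ∀ (j : Fin B.b) (z : ℂ), G (((0, Pi.single j z), 0) : B.Coord) =
        z.re * G (((0, Pi.single j 1), 0) : B.Coord) +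
          z.im * G (((0, Pi.single j Complex.I), 0) : B.Coord) := by
      intro j z
      have : (((0, Pi.single j z), 0) : B.Coord) = z.re • (((0, Pi.single j 1), 0) : B.Coord) +
          z.im • (((0, Pi.single j Complex.I), 0) : B.Coord) := by
        refine Prod.ext (Prod.ext (by simp) (funext fun k => ?_)) (by simp)
        rcases eq_or_ne k j with rfl | hkj
        · simp
        · simp [hkj]
      rw [this, map_add, map_smul, map_smul, Complex.real_smul, Complex.real_smul]
    rcases i with j | j | j
    · have h1 : B.saddle.flow t (((Pi.single j 1, 0), 0) : B.Coord) =
          Real.exp (t * B.χLs j) • (((Pi.single j 1, 0), 0) : B.Coord) := by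
        rw [SaddleFlow.flow_apply]
        refine Prod.ext (Prod.ext (funext fun k => ?_) (funext fun k => ?_)) ?_
        · change Real.exp (t * B.χLs k) * (Pi.single j 1 : Fin B.a → ℝ) k = _
          rcases eq_or_ne k j with rfl | hkj
          · simp
          · simp [hkj]
        · change _ * (0 : ℂ) = _
          simp
        · simp
      have hv : B.saddle.v (Sum.inl j) = (Pi.single j 1, 0) := rfl
      have hw : B.saddle.w (Sum.inl j) = 0 := rfl
      have hν : B.saddle.ν (Sum.inl j) = B.χLs j := rfl
      rw [hv, hw, hν, h1, h00, map_zero, map_zero, map_smul, Complex.real_smul]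
      push_cast
      ring
    · have hv : B.saddle.v (Sum.inr (Sum.inl j)) = (0, Pi.single j 1) := rfl
      have hw : B.saddle.w (Sum.inr (Sum.inl j)) = (0, Pi.single j Complex.I) := rfl
      have hν : (t : ℂ) * B.saddle.ν (Sum.inr (Sum.inl j)) =
          (starRingEnd ℂ) (t * B.stableCoeff j) := by
        simp [saddle, stableCoeff]
      rw [hv, hw, hν, hplane, hplane, hlin j (_ * 1), hlin j (_ * Complex.I), Complex.exp_conj]
      generalize Complex.exp (t * B.stableCoeff j) = c
      have h1 : (starRingEnd ℂ) c = c.re - c.im * Complex.I := by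
        apply Complex.ext <;> simp
      rw [h1]
      simp only [mul_one, Complex.mul_I_re, Complex.mul_I_im]
      push_cast
      linear_combination (c.im * G ((0, Pi.single j Complex.I), 0)) * Complex.I_mul_I
    · have hv : B.saddle.v (Sum.inr (Sum.inr j)) = (0, Pi.single j 1) := rfl
      have hw : B.saddle.w (Sum.inr (Sum.inr j)) = (0, Pi.single j (-Complex.I)) := rfl
      have hν : B.saddle.ν (Sum.inr (Sum.inr j)) = B.stableCoeff j := rfl
      rw [hv, hw, hν, hplane, hplane, hlin j (_ * 1), hlin j (_ * -Complex.I),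
        hlin j (-Complex.I)]
      generalize Complex.exp (t * B.stableCoeff j) = c
      have h2 : c = c.re + c.im * Complex.I := (Complex.re_add_im _).symm
      conv_rhs => rw [h2]
      simp only [mul_one, mul_neg, Complex.neg_re, Complex.neg_im, Complex.mul_I_re,
        Complex.mul_I_im, Complex.I_re, Complex.I_im]
      push_cast
      linear_combination (c.im * G ((0, Pi.single j Complex.I), 0)) * Complex.I_mul_I
  ext q
  have hf' : HasFDerivAt f (fderiv ℝ f (B.saddle.flow t q)) (B.saddle.flow t q) :=
    ((hf.differentiable (by simp)) _).hasFDerivAt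
  have h1 : HasFDerivAt (fun q => f (B.saddle.flow t q))
      ((fderiv ℝ f (B.saddle.flow t q)).comp (B.saddle.flow t)) q :=
    hf'.comp q (B.saddle.flow t).hasFDerivAt
  rw [SaddleFlow.partialX, cDeriv, h1.fderiv]
  exact key _

theorem partialWord_comp_flow (σ : List B.StableIndex) (t : ℝ) {f : B.Coord → ℂ}
    (hf : ContDiff ℝ ∞ f) :
    B.saddle.partialWord σ (fun q => f (B.saddle.flow t q)) =
      Complex.exp (t * (σ.map B.saddle.ν).sum) •
        fun q => B.saddle.partialWord σ f (B.saddle.flow t q) := by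
  induction σ with
  | nil =>
    ext q
    simp [SaddleFlow.partialWord]
  | cons i σ ih =>
    have h1 : ContDiff ℝ ∞ fun q => B.saddle.partialWord σ f (B.saddle.flow t q) :=
      (B.saddle.contDiff_partialWord σ hf).comp (B.saddle.flow t).contDiff
    change B.saddle.partialX i (B.saddle.partialWord σ (fun q => f (B.saddle.flow t q))) = _
    rw [ih, SaddleFlow.partialX, cDeriv_smul _ _ _ h1]
    have h2 := partialX_comp_flow i t (B.saddle.contDiff_partialWord σ hf)
    rw [SaddleFlow.partialX] at h2
    rw [h2, smul_smul, ← Complex.exp_add, List.map_cons, List.sum_cons]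
    congr 2
    ring

/-- The weight of the monomial `y ^ α_y` under the unstable flow. -/
def unstableWeight (α : B.MultiIndex) : ℂ :=
  ∑ j, (α.u j : ℂ) * B.χLu j + ∑ j, ((α.w j : ℂ) * B.unstableCoeff j +
    (α.wbar j : ℂ) * (starRingEnd ℂ) (B.unstableCoeff j))

theorem monomial_unstableFlow (α : B.MultiIndex) (t : ℝ) (y : B.Y) :
    monomial α (B.unstableFlow t y) = Complex.exp (t * unstableWeight α) * monomial α y := by
  have h1 : ∀ j, (B.unstableFlow t y).1 j = Real.exp (t * B.χLu j) * y.1 j := fun j => rfl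
  have h2 : ∀ j, (B.unstableFlow t y).2 j = Complex.exp (t * B.unstableCoeff j) * y.2 j :=
    fun j => rfl
  simp only [monomial, h1, h2, map_mul, mul_pow, Complex.ofReal_mul, Finset.prod_mul_distrib,
    unstableWeight, mul_add, Finset.mul_sum, Finset.sum_add_distrib, Complex.exp_add,
    Complex.exp_sum, ← Complex.exp_conj, Complex.ofReal_exp, ← Complex.exp_nat_mul]
  have e1 : ∀ j, (α.u j : ℂ) * (t * B.χLu j) = t * (α.u j * B.χLu j) := fun j => by ring
  have e2 : ∀ j, (α.w j : ℂ) * (t * B.unstableCoeff j) = t * (α.w j * B.unstableCoeff j) :=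
    fun j => by ring
  have e3 : ∀ j, (α.wbar j : ℂ) * (t * (starRingEnd ℂ) (B.unstableCoeff j)) =
      t * (α.wbar j * (starRingEnd ℂ) (B.unstableCoeff j)) := fun j => by ring
  simp only [Complex.conj_ofReal, e1, e2, e3]
  ring

theorem sum_ν_stableWord (α : B.MultiIndex) : ((stableWord α).map B.saddle.ν).sum =
    ∑ j, (α.s j : ℂ) * B.χLs j +
    ∑ j, ((α.z j : ℂ) * ((B.χPs j : ℂ) + Complex.I * B.omPs j) +
      (α.zbar j : ℂ) * B.stableCoeff j) := by
  have hsum : ∀ {k : ℕ} (f : Fin k → ℂ), ((List.finRange k).map f).sum = ∑ j, f j := fun f => by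
    rw [← List.ofFn_eq_map, List.sum_ofFn]
  have hflat : ∀ {k : ℕ} (l : List (Fin k)) (g : Fin k → List ℂ),
      (l.flatMap g).sum = (l.map fun a => (g a).sum).sum := by
    intro k l g
    induction l with
    | nil => rfl
    | cons a l ih => rw [List.flatMap_cons, List.sum_append, ih, List.map_cons, List.sum_cons]
  rw [stableWord, List.map_append, List.sum_append, List.map_flatMap, List.map_flatMap,
    hflat, hflat, hsum, hsum]
  simp only [List.map_append, List.sum_append, List.map_replicate, List.sum_replicate,
    nsmul_eq_mul]
  rfl

theorem trace_linearField : LinearMap.trace ℝ _ B.linearField.toLinearMap =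
    LinearMap.trace ℝ _ (blockField B.χLs B.stableCoeff).toLinearMap +
      LinearMap.trace ℝ _ (blockField B.χLu B.unstableCoeff).toLinearMap := by
  rw [linearField_eq]
  exact LinearMap.trace_prodMap' _ _

theorem resonance_eq (α : B.MultiIndex) : resonance α =
    ((LinearMap.trace ℝ _ (blockField B.χLs B.stableCoeff).toLinearMap : ℝ) : ℂ) +
      ((stableWord α).map B.saddle.ν).sum - unstableWeight α := by
  rw [trace_blockField, sum_ν_stableWord, resonance, unstableWeight]
  have h1 : ∀ j, |B.χLs j| = -B.χLs j := fun j => abs_of_neg (B.χLs_neg j)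
  have h2 : ∀ j, |B.χPs j| = -B.χPs j := fun j => abs_of_neg (B.χPs_neg j)
  have h3 : ∀ j, (starRingEnd ℂ) (B.unstableCoeff j) = B.χPu j + Complex.I * B.omPu j := by
    intro j
    simp [unstableCoeff]
  simp only [h1, h2, h3, stableCoeff_re]
  simp only [unstableCoeff, stableCoeff]
  push_cast
  simp only [Finset.sum_neg_distrib]
  ring

theorem modelPairing_transport (α : B.MultiIndex) (t : ℝ) {f : B.Coord → ℂ}
    (hf : ContDiff ℝ ∞ f) :
    modelPairing α (transport B.linearField B.saddle.flow f t) =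
      Complex.exp (t * resonance α) * modelPairing α f := by
  set τ : ℂ := ((LinearMap.trace ℝ _ B.linearField.toLinearMap : ℝ) : ℂ) with hτ
  set τu : ℂ := ((LinearMap.trace ℝ _ (blockField B.χLu B.unstableCoeff).toLinearMap : ℝ) : ℂ)
    with hτu
  set s := ((stableWord α).map B.saddle.ν).sum with hs
  have hft : ContDiff ℝ ∞ fun q => f (B.saddle.flow t q) := hf.comp (B.saddle.flow t).contDiff
  have h1 : transport B.linearField B.saddle.flow f t =
      Complex.exp (t * τ) • fun q => f (B.saddle.flow t q) := rfl
  have hsmul : ∀ (σ : List B.StableIndex) (c : ℂ) (g : B.Coord → ℂ), ContDiff ℝ ∞ g →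
      B.saddle.partialWord σ (c • g) = c • B.saddle.partialWord σ g := by
    intro σ c g hg
    induction σ with
    | nil => rfl
    | cons i σ ih =>
      change B.saddle.partialX i (B.saddle.partialWord σ (c • g)) = _
      rw [ih]
      exact cDeriv_smul _ _ c (B.saddle.contDiff_partialWord σ hg)
  rw [modelPairing, h1, hsmul _ _ _ hft, partialWord_comp_flow _ t hf]
  have h2 : ∀ y : B.Y, (Complex.exp (t * τ) • Complex.exp (t * s) • fun q =>
      B.saddle.partialWord (stableWord α) f (B.saddle.flow t q)) ((0, y) : B.Coord) *
      monomial α y = Complex.exp (t * τ + t * s - t * unstableWeight α) *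
        (fun y' => B.saddle.partialWord (stableWord α) f (0, y') * monomial α y')
          (B.unstableFlow t y) := by
    intro y
    have h3 : B.saddle.flow t ((0, y) : B.Coord) = (0, B.unstableFlow t y) := by
      rw [SaddleFlow.flow_apply, map_zero]; rfl
    simp only [Pi.smul_apply, smul_eq_mul, h3, monomial_unstableFlow, Complex.exp_sub,
      Complex.exp_add]
    have h4 := Complex.exp_ne_zero (t * unstableWeight α)
    field_simp
  refine (integral_congr_ae (Eventually.of_forall h2)).trans ?_
  rw [integral_const_mul]
  have h5 := integral_comp_blockFlow B.χLu B.unstableCoeff volume t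
    (fun y' : B.Y => B.saddle.partialWord (stableWord α) f (0, y') * monomial α y')
  have h6 : ∫ y : B.Y, (fun y' => B.saddle.partialWord (stableWord α) f (0, y') * monomial α y')
      (B.unstableFlow t y) = _ := h5
  rw [h6, ← mul_assoc, ← Complex.exp_add, modelPairing]
  congr 2
  rw [resonance_eq, hτ, trace_linearField]
  push_cast
  rw [← hs, ← hτu]
  ring

theorem ev_model_divField (Ω : Opens B.Coord) (α : B.MultiIndex) {f : B.Coord → ℂ}
    (hf : f ∈ testSpace (Ω : Set B.Coord)) :
    ev (model Ω α) (divField B.linearField f) = resonance α * ev (model Ω α) f := by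
  have hΦ := B.isLinearFlow_saddle
  have hfT : f ∈ testSpace ((⊤ : Opens B.Coord) : Set B.Coord) := ⟨hf.1, hf.2.1, subset_univ _⟩
  have hmem := fun t (ht : t ∈ Icc (0 : ℝ) 1) =>
    transport_mem_testSpace hΦ (isCompact_Icc (a := (0 : ℝ)) (b := 1)) hf ht
  obtain ⟨-, -, hd⟩ := ev_family (model (⊤ : Opens B.Coord) α)
    (isCompact_flow_image hΦ isCompact_Icc hf.2.1.isCompact) (subset_univ _)
    (contDiff_transport hΦ hf.1) one_pos hmem
  have h1 := hd 0 ⟨le_rfl, one_pos⟩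
  have h2 : (fun x => deriv (fun s => transport B.linearField B.saddle.flow f s x) 0) =
      divField B.linearField f := by
    ext x
    rw [(deriv_transport hΦ hf.1 0 x).deriv, transport_zero hΦ]
  rw [h2] at h1
  have h3 : HasDerivAt (fun t : ℝ => Complex.exp (t * resonance α) *
      ev (model (⊤ : Opens B.Coord) α) f) (resonance α * ev (model (⊤ : Opens B.Coord) α) f) 0 := by
    have h : HasDerivAt (fun s : ℝ => (s : ℂ) * resonance α) (1 * resonance α) 0 :=
      (Complex.ofRealCLM.hasDerivAt (x := (0 : ℝ))).mul_const _
    have := h.cexp.mul_const (ev (model (⊤ : Opens B.Coord) α) f)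
    simpa using this
  have h4 : ∀ t ∈ Icc (0 : ℝ) 1, ev (model (⊤ : Opens B.Coord) α)
      (transport B.linearField B.saddle.flow f t) =
      Complex.exp (t * resonance α) * ev (model (⊤ : Opens B.Coord) α) f := by
    intro t ht
    rw [ev_model _ _ (testSpace_mono (subset_univ _) (hmem t ht)), ev_model _ _ hfT,
      modelPairing_transport α t hf.1]
    ring
  have h5 : HasDerivWithinAt (fun t => ev (model (⊤ : Opens B.Coord) α)
      (transport B.linearField B.saddle.flow f t))
      (resonance α * ev (model (⊤ : Opens B.Coord) α) f) (Ici 0) 0 := by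
    refine h3.hasDerivWithinAt.congr_of_eventuallyEq ?_ (h4 0 ⟨le_rfl, zero_le_one⟩)
    filter_upwards [self_mem_nhdsWithin, mem_nhdsWithin_of_mem_nhds (Iic_mem_nhds one_pos)] with
      t ht ht' using h4 t ⟨ht, ht'⟩
  have h6 := (uniqueDiffOn_Ici (0 : ℝ) 0 self_mem_Ici).eq_deriv _ h1 h5
  rw [ev_model _ _ (divField_mem_testSpace _ hf), ev_model _ _ hf]
  rw [ev_model _ _ (divField_mem_testSpace _ hfT), ev_model _ _ hfT] at h6
  exact h6

end HyperbolicBlocks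

/-! ### Expansion of generalized eigendistributions in model distributions -/

/-- A generalized eigenvector in the span of eigenvectors is in the span of those with the same
eigenvalue. -/
theorem exists_linearCombination_of_mem_maxGenEigenspace {V ι : Type*} [AddCommGroup V]
    [Module ℂ V] (T : Module.End ℂ V) {v : ι → V} {l : ι → ℂ} (hv : ∀ i, T (v i) = l i • v i)
    {μ : ℂ} {x : V} (hx : x ∈ T.maxGenEigenspace μ) (hspan : x ∈ Submodule.span ℂ (Set.range v)) :
    ∃ c : ι →₀ ℂ, (∀ i ∈ c.support, l i = μ) ∧ Finsupp.linearCombination ℂ v c = x := by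
  classical
  obtain ⟨c, rfl⟩ := (Finsupp.mem_span_range_iff_exists_finsupp).1 hspan
  change Finsupp.linearCombination ℂ v c ∈ _ at hx
  change ∃ c', _ ∧ _ = Finsupp.linearCombination ℂ v c
  have hmem : ∀ i, v i ∈ T.maxGenEigenspace (l i) := fun i => by
    rw [Module.End.mem_maxGenEigenspace]
    exact ⟨1, by simp [hv]⟩
  set c₁ := c.filter fun i => l i = μ with hc₁
  set c₂ := c.filter fun i => ¬ l i = μ with hc₂
  have hsum : c₁ + c₂ = c := Finsupp.filter_add_filter_not c _
  have h1 : Finsupp.linearCombination ℂ v c₁ ∈ T.maxGenEigenspace μ := by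
    rw [Finsupp.linearCombination_apply]
    refine Submodule.sum_mem _ fun i hi => Submodule.smul_mem _ _ ?_
    have : l i = μ := by
      rw [hc₁, Finsupp.support_filter, Finset.mem_filter] at hi
      exact hi.2
    exact this ▸ hmem i
  have h2 : Finsupp.linearCombination ℂ v c₂ ∈ ⨆ (ν : ℂ) (_ : ν ≠ μ), T.maxGenEigenspace ν := by
    rw [Finsupp.linearCombination_apply]
    refine Submodule.sum_mem _ fun i hi => Submodule.smul_mem _ _ ?_
    have : l i ≠ μ := by
      rw [hc₂, Finsupp.support_filter, Finset.mem_filter] at hi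
      exact hi.2
    exact Submodule.mem_iSup_of_mem (l i) (Submodule.mem_iSup_of_mem this (hmem i))
  have h3 : Finsupp.linearCombination ℂ v c₂ ∈ T.maxGenEigenspace μ := by
    have : Finsupp.linearCombination ℂ v c₂ =
        Finsupp.linearCombination ℂ v c - Finsupp.linearCombination ℂ v c₁ := by
      rw [← hsum, map_add, add_sub_cancel_left]
    rw [this]
    exact sub_mem hx h1
  have h4 := Submodule.disjoint_def.1 (T.independent_maxGenEigenspace μ) _ h3 h2
  refine ⟨c₁, fun i hi => ?_, ?_⟩
  · rw [hc₁, Finsupp.support_filter, Finset.mem_filter] at hi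
    exact hi.2
  · rw [← hsum, map_add, h4, add_zero]

section Restriction

variable {E : Type*} [NormedAddCommGroup E] [NormedSpace ℝ E] [FiniteDimensional ℝ E]
  {Ω : Opens E}

/-- The functional which a distribution induces on the test functions supported in `S`. -/
def restrictTest (S : Set E) (hS : S ⊆ Ω) (u : Distribution Ω ℂ ⊤) :
    Module.Dual ℂ (testSpace S) :=
  complexExt u ∘ₗ Submodule.inclusion (testSpace_mono hS)

theorem restrictTest_apply {S : Set E} (hS : S ⊆ Ω) (u : Distribution Ω ℂ ⊤) (f : testSpace S) :
    restrictTest S hS u f = ev u f.1 := (ev_of_mem u _).symm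

/-- `divField` on the test functions supported in `S`. -/
def divFieldLM (S : Set E) (A : E →L[ℝ] E) : testSpace S →ₗ[ℂ] testSpace S where
  toFun f := ⟨divField A f.1, divField_mem_testSpace A f.2⟩
  map_add' f g := by
    ext q
    change divField A (f.1 + g.1) q = divField A f.1 q + divField A g.1 q
    simp only [divField, Pi.add_apply]
    rw [fderiv_add (f.2.1.differentiable (by simp) q) (g.2.1.differentiable (by simp) q)]
    simp only [add_apply]
    ring
  map_smul' c f := by
    ext q
    change divField A (c • f.1) q = c * divField A f.1 q
    simp only [divField, Pi.smul_apply]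
    rw [fderiv_const_smul (f.2.1.differentiable (by simp) q)]
    simp only [smul_apply, smul_eq_mul]
    ring

theorem restrictTest_shiftedLie {S : Set E} (hS : S ⊆ Ω) (A : E →L[ℝ] E)
    (μ : ℂ) (u : Distribution Ω ℂ ⊤) : restrictTest S hS (shiftedLie A μ u) =
      -(((divFieldLM S A).dualMap : Module.End ℂ (Module.Dual ℂ (testSpace S))) -
        μ • (1 : Module.End ℂ (Module.Dual ℂ (testSpace S)))) (restrictTest S hS u) := by
  refine LinearMap.ext fun f => ?_
  rw [restrictTest_apply, ev_shiftedLie A μ u (testSpace_mono hS f.2)]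
  change _ = -(restrictTest S hS u (divFieldLM S A f) - μ * restrictTest S hS u f)
  rw [restrictTest_apply, restrictTest_apply]
  change _ = -(ev u (divField A f.1) - μ * ev u f.1)
  ring

theorem restrictTest_mem_maxGenEigenspace {S : Set E} (hS : S ⊆ Ω)
    (A : E →L[ℝ] E) (μ : ℂ) (u : Distribution Ω ℂ ⊤) (m : ℕ) (hu : (shiftedLie A μ)^[m] u = 0) :
    restrictTest S hS u ∈ Module.End.maxGenEigenspace
      ((divFieldLM S A).dualMap : Module.End ℂ (Module.Dual ℂ (testSpace S))) μ := by
  rw [Module.End.mem_maxGenEigenspace]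
  set T := ((divFieldLM S A).dualMap : Module.End ℂ (Module.Dual ℂ (testSpace S))) - μ • 1 with hT
  have h : ∀ k, (T ^ k) (restrictTest S hS u) =
      (-1 : ℂ) ^ k • restrictTest S hS ((shiftedLie A μ)^[k] u) := by
    intro k
    induction k with
    | zero => simp
    | succ k ih =>
      rw [Function.iterate_succ_apply', restrictTest_shiftedLie, ← hT, pow_succ',
        Module.End.mul_apply, ih, map_smul, pow_succ]
      simp
  refine ⟨m, ?_⟩
  rw [h, hu]
  have : restrictTest S hS (0 : Distribution Ω ℂ ⊤) = 0 := by
    refine LinearMap.ext fun f => ?_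
    rw [restrictTest_apply, ev_zero_left]
    rfl
  rw [this, smul_zero]

end Restriction

namespace HyperbolicBlocks

/-- The local form of the theorem, in the linearizing coordinates: a generalized eigendistribution
near the origin, with support in the unstable space and wavefront set in its conormal bundle, is a
linear combination of model distributions. -/
theorem exists_model_expansion (B : HyperbolicBlocks) {Ω : Opens B.Coord}
    (u : Distribution Ω ℂ ⊤) (h0 : (0 : B.Coord) ∈ Ω) (μ : ℂ) (m : ℕ)
    (hu : (shiftedLie B.linearField μ)^[m] u = 0) {W : Set B.Coord} (hW : W ∈ 𝓝 0)
    (hsupp : ∀ f ∈ testSpace (Ω : Set B.Coord), tsupport f ⊆ W ∩ {q | q.1 ≠ 0} → ev u f = 0)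
    (hWF : ∀ η : B.Y →L[ℝ] ℝ, η ≠ 0 →
      ((0 : B.Coord), η.comp (ContinuousLinearMap.snd ℝ B.X B.Y)) ∉ wavefrontSet u)
    (h0u : (0 : B.Coord) ∈ Distribution.dsupport u) :
    μ ∈ B.resonanceSet ∧
    ∃ c : B.MultiIndex →₀ ℂ, (∀ α ∈ c.support, resonance α = μ) ∧
      ∃ Ω' : Opens B.Coord, (0 : B.Coord) ∈ Ω' ∧ Ω' ≤ Ω ∧
        ∀ ψ : TestFunction Ω ℝ ⊤, tsupport ψ ⊆ Ω' →
          u ψ = (c.sum fun α z => z * model Ω α ψ) ∧ shiftedLie B.linearField μ u ψ = 0 := by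
  obtain ⟨n, K, S, hSo, h0S, hSΩ, hann⟩ := exists_ev_eq_zero_of_momentsVanish B.saddle volume
    B.isLinearFlow_saddle u h0 μ m hu hW hsupp hWF
  obtain ⟨I, hI⟩ := exists_finset_momentsVanish (B := B) n K
  set v : B.MultiIndex → Module.Dual ℂ (testSpace S) := fun α => restrictTest S hSΩ (model Ω α)
    with hv
  set T := ((divFieldLM S B.linearField).dualMap : Module.End ℂ (Module.Dual ℂ (testSpace S)))
    with hT
  have hTv : ∀ α, T (v α) = resonance α • v α := by
    intro α
    refine LinearMap.ext fun f => ?_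
    change v α (divFieldLM S B.linearField f) = resonance α * v α f
    rw [hv, restrictTest_apply, restrictTest_apply]
    exact ev_model_divField Ω α (testSpace_mono hSΩ f.2)
  have hspan : restrictTest S hSΩ u ∈ Submodule.span ℂ (Set.range v) := by
    have h1 : restrictTest S hSΩ u ∈ Submodule.span ℂ (Set.range fun α : I => v α) := by
      refine mem_span_of_iInf_ker_le_ker fun f hf => ?_
      rw [LinearMap.mem_ker, restrictTest_apply]
      refine hann f.1 f.2 (hI S f.1 f.2 fun α hα => ?_)
      have h2 : v α f = 0 := (Submodule.mem_iInf _).1 hf ⟨α, hα⟩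
      rw [hv, restrictTest_apply, ev_model Ω α (testSpace_mono hSΩ f.2)] at h2
      exact (mul_eq_zero.1 h2).resolve_left (pow_ne_zero _ (by simp))
    refine Submodule.span_mono ?_ h1
    rintro _ ⟨α, rfl⟩
    exact ⟨α, rfl⟩
  obtain ⟨c, hc, hcu⟩ := exists_linearCombination_of_mem_maxGenEigenspace T hTv
    (restrictTest_mem_maxGenEigenspace hSΩ B.linearField μ u m hu) hspan
  have hev : ∀ f ∈ testSpace S, ev u f = c.sum fun α z => z * ev (model Ω α) f := by
    intro f hf
    have h1 := LinearMap.congr_fun hcu ⟨f, hf⟩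
    rw [restrictTest_apply, Finsupp.linearCombination_apply, Finsupp.sum,
      LinearMap.sum_apply] at h1
    rw [← h1, Finsupp.sum]
    refine Finset.sum_congr rfl fun α _ => ?_
    rw [LinearMap.smul_apply, hv, restrictTest_apply, smul_eq_mul]
  have hev' : ∀ f ∈ testSpace S, ev (shiftedLie B.linearField μ u) f = 0 := by
    intro f hf
    rw [ev_shiftedLie _ _ _ (testSpace_mono hSΩ hf), hev f hf,
      hev _ (divField_mem_testSpace _ hf), Finsupp.sum, Finsupp.sum, Finset.mul_sum,
      ← Finset.sum_sub_distrib]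
    refine Finset.sum_eq_zero fun α hα => ?_
    rw [ev_model_divField Ω α (testSpace_mono hSΩ hf), hc α hα]
    ring
  refine ⟨?_, c, hc, ⟨S, hSo⟩, h0S, hSΩ, fun ψ hψ => ?_⟩
  · by_contra hμ
    refine notMem_dsupport_of_ev u (hSo.mem_nhds h0S) (fun f hf hfS => ?_) h0u
    rw [hev f ⟨hf.1, hf.2.1, hfS⟩]
    refine Finset.sum_eq_zero fun α hα => ?_
    exact (hμ ⟨α, hc α hα⟩).elim
  · have hmem := ofReal_comp_mem_testSpace ψ hψ
    refine ⟨?_, ?_⟩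
    · rw [← ev_ofReal, hev _ hmem]
      simp only [ev_ofReal]
    · rw [← ev_ofReal]
      exact hev' _ hmem

end HyperbolicBlocks

/-! ### The flow in a linearizing chart -/

section LocalInverse

variable {E E' H H' N N' : Type*} [NormedAddCommGroup E] [NormedSpace ℝ E]
  [NormedAddCommGroup E'] [NormedSpace ℝ E'] [TopologicalSpace H] [TopologicalSpace H']
  {I : ModelWithCorners ℝ E H} {I' : ModelWithCorners ℝ E' H'}
  [TopologicalSpace N] [ChartedSpace H N] [TopologicalSpace N'] [ChartedSpace H' N']

theorem mfderiv_leftInverse {f : N → N'} {g : N' → N} {x : N} (hf : MDifferentiableAt I I' f x)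
    (hg : MDifferentiableAt I' I g (f x)) (hgf : g ∘ f =ᶠ[𝓝 x] id) (v : TangentSpace I x) :
    (mfderiv I' I g (f x) (mfderiv I I' f x v) : E) = v := by
  have h1 := hg.hasMFDerivAt.comp x hf.hasMFDerivAt
  have h2 : HasMFDerivAt I I (g ∘ f) x (ContinuousLinearMap.id ℝ (TangentSpace I x)) :=
    (hasMFDerivAt_id x).congr_of_eventuallyEq hgf
  have h3 := hasMFDerivAt_unique h1 h2
  exact DFunLike.congr_fun h3 v

/-- The differential of a local diffeomorphism is bijective. -/
theorem bijective_mfderiv_of_localInverse {f : N → N'} {g : N' → N} {x : N}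
    (hf : MDifferentiableAt I I' f x) (hg : MDifferentiableAt I' I g (f x))
    (hgf : g ∘ f =ᶠ[𝓝 x] id) (hfg : f ∘ g =ᶠ[𝓝 (f x)] id) :
    Function.Bijective (mfderiv I I' f x) := by
  refine ⟨Function.LeftInverse.injective (g := fun w => (mfderiv I' I g (f x) w : E))
    (fun v => mfderiv_leftInverse hf hg hgf v), ?_⟩
  have hx : g (f x) = x := hgf.eq_of_nhds
  have hf' : MDifferentiableAt I I' f (g (f x)) := by rwa [hx]
  intro w
  have h := mfderiv_leftInverse (x := f x) hg hf' hfg w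
  have h2 : ∀ y, y = x → ∀ v : E, (mfderiv I I' f y v : E') = mfderiv I I' f x v := by
    rintro y rfl v; rfl
  exact ⟨(mfderiv I' I g (f x) w : E), (h2 _ hx _).symm.trans h⟩

end LocalInverse

section Linearizing

variable {n : ℕ} {M : Type*} [TopologicalSpace M] [ChartedSpace (EuclideanSpace ℝ (Fin n)) M]
  {E : Type*} [NormedAddCommGroup E] [NormedSpace ℝ E]
  {V : (x : M) → TangentSpace (𝓡 n) x} {p : M} {A : E →L[ℝ] E} {h : OpenPartialHomeomorph E M}

namespace IsLinearizingChart

variable (hL : IsLinearizingChart V p A h)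

include hL

theorem mdifferentiableAt {q : E} (hq : q ∈ h.source) :
    MDifferentiableAt 𝓘(ℝ, E) (𝓡 n) h q :=
  (hL.smooth.contMDiffAt (h.open_source.mem_nhds hq)).mdifferentiableAt (by simp)

theorem mdifferentiableAt_symm {x : M} (hx : x ∈ h.target) :
    MDifferentiableAt (𝓡 n) 𝓘(ℝ, E) h.symm x :=
  (hL.smooth_symm.contMDiffAt (h.open_target.mem_nhds hx)).mdifferentiableAt (by simp)

theorem image_mem_nhds {s : Set E} (hs : s ∈ 𝓝 0) : h '' s ∈ 𝓝 p := by
  rw [← hL.map_zero]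
  exact h.image_mem_nhds hL.zero_mem hs

theorem bijective_mfderiv {q : E} (hq : q ∈ h.source) :
    Function.Bijective (mfderiv 𝓘(ℝ, E) (𝓡 n) h q) :=
  bijective_mfderiv_of_localInverse (hL.mdifferentiableAt hq)
    (hL.mdifferentiableAt_symm (h.map_source hq)) (h.eventually_left_inverse hq)
    (h.eventually_right_inverse (h.map_source hq))

theorem mfderiv_symm_apply {x : M} (hx : x ∈ h.target) :
    (mfderiv (𝓡 n) 𝓘(ℝ, E) h.symm x (V x) : E) = A (h.symm x) := by
  obtain ⟨q, hq, rfl⟩ : ∃ q ∈ h.source, h q = x := ⟨h.symm x, h.map_target hx, h.right_inv hx⟩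
  rw [hL.conj q hq, h.left_inv hq]
  exact mfderiv_leftInverse (hL.mdifferentiableAt hq)
    (hL.mdifferentiableAt_symm (h.map_source hq)) (h.eventually_left_inverse hq) _

variable {φ : Flow ℝ M} (hφ : IsSmoothFlowOf φ V) {Φ : ℝ → E →L[ℝ] E} (hΦ : IsLinearFlow A Φ)

include hφ

theorem hasDerivAt_symm_flow {x : M} {t : ℝ} (ht : φ t x ∈ h.target) :
    HasDerivAt (fun s => h.symm (φ s x)) (A (h.symm (φ t x))) t := by
  have h1 := (hL.mdifferentiableAt_symm ht).hasMFDerivAt.comp t (hφ.generator x t)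
  have h2 : HasFDerivAt (fun s => h.symm (φ s x))
      ((1 : ℝ →L[ℝ] ℝ).smulRight (A (h.symm (φ t x)))) t := by
    refine HasFDerivAt.congr_fderiv (hasMFDerivAt_iff_hasFDerivAt.1 h1) ?_
    rw [← hL.mfderiv_symm_apply ht]
    refine ContinuousLinearMap.ext fun r => ?_
    let L : EuclideanSpace ℝ (Fin n) →L[ℝ] E := mfderiv (𝓡 n) 𝓘(ℝ, E) h.symm (φ t x)
    let r' : ℝ := r
    exact L.map_smul r' (V (φ t x))
  refine h2.hasDerivAt.congr_deriv ?_
  simp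

include hΦ

/-- An orbit segment which stays in the range of the chart is linear in the chart. -/
theorem symm_flow_eq {x : M} {T : ℝ} (hT : ∀ t ∈ uIcc 0 T, φ t x ∈ h.target) :
    h.symm (φ T x) = Φ T (h.symm x) := by
  -- `t ↦ Φ (-t) (h.symm (φ t x))` is constant on the segment
  have hd : ∀ t ∈ uIcc 0 T,
      HasDerivWithinAt (fun s => Φ (-s) (h.symm (φ s x))) 0 (uIcc 0 T) t := by
    intro t ht
    have h1 := hL.hasDerivAt_symm_flow hφ (hT t ht)
    have h2 : HasFDerivAt (fun q : ℝ × E => Φ q.1 q.2)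
        (fderiv ℝ (fun q : ℝ × E => Φ q.1 q.2) (-t, h.symm (φ t x))) (-t, h.symm (φ t x)) :=
      ((hΦ.smooth.differentiable (by simp)) _).hasFDerivAt
    set D := fderiv ℝ (fun q : ℝ × E => Φ q.1 q.2) (-t, h.symm (φ t x)) with hD
    have h3 : HasDerivAt (fun s : ℝ => -s) (-1 : ℝ) t := (hasDerivAt_id t).neg
    have h4 : HasDerivAt (fun s => Φ (-s) (h.symm (φ s x))) (D (-1, A (h.symm (φ t x)))) t :=
      HasFDerivAt.comp_hasDerivAt (f := fun s => (-s, h.symm (φ s x))) t h2 (h3.prodMk h1)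
    have h5 : ∀ q : E, D (0, q) = Φ (-t) q := by
      intro q
      have h6 : HasDerivAt (fun s : ℝ => h.symm (φ t x) + s • q) q 0 := by
        have := ((hasDerivAt_id (0 : ℝ)).smul_const q).const_add (h.symm (φ t x))
        simpa using this
      have h2' : HasFDerivAt (fun q : ℝ × E => Φ q.1 q.2) D
          (-t, h.symm (φ t x) + (0 : ℝ) • q) := by simpa using h2
      have h7 : HasDerivAt (fun s : ℝ => Φ (-t) (h.symm (φ t x) + s • q)) (D (0, q)) 0 :=
        HasFDerivAt.comp_hasDerivAt (f := fun s : ℝ => (-t, h.symm (φ t x) + s • q)) (0 : ℝ) h2'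
          ((hasDerivAt_const (0 : ℝ) (-t)).prodMk h6)
      exact h7.unique ((Φ (-t)).hasFDerivAt.comp_hasDerivAt (0 : ℝ) h6)
    have h8 : ∀ q : E, q = h.symm (φ t x) → D (1, 0) = A (Φ (-t) q) := by
      rintro q rfl
      have h6 : HasDerivAt (fun s : ℝ => Φ s (h.symm (φ t x))) (D (1, 0)) (-t) :=
        HasFDerivAt.comp_hasDerivAt (f := fun s : ℝ => (s, h.symm (φ t x))) (-t) h2
          ((hasDerivAt_id (-t)).prodMk (hasDerivAt_const (-t) _))
      exact h6.unique (hΦ.deriv (-t) _)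
    have h9 : D (-1, A (h.symm (φ t x))) = 0 := by
      have : ((-1, A (h.symm (φ t x))) : ℝ × E) = -(1, 0) + (0, A (h.symm (φ t x))) := by simp
      rw [this, map_add, map_neg, h5, h8 _ rfl, hΦ.commute]
      simp
    rw [h9] at h4
    exact h4.hasDerivWithinAt
  have h1 := Convex.norm_image_sub_le_of_norm_hasDerivWithin_le (C := 0) hd (by simp)
    (convex_uIcc 0 T) left_mem_uIcc right_mem_uIcc
  rw [zero_mul, norm_le_zero_iff, sub_eq_zero, neg_zero, hΦ.zero, φ.map_zero_apply] at h1
  rw [← h1, hΦ.apply_neg_apply]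

/-- A segment of an orbit of the linear flow which stays in the domain of the chart is mapped to an
orbit of the flow. -/
theorem flow_eq [T2Space M] {q : E} {T : ℝ} (hT : ∀ t ∈ uIcc 0 T, Φ t q ∈ h.source) :
    φ T (h q) = h (Φ T q) := by
  have hΦc : ∀ q : E, Continuous fun t => Φ t q := fun q =>
    hΦ.continuous.comp (continuous_id.prodMk continuous_const)
  have hφc : ∀ x : M, Continuous fun t => φ t x := fun x =>
    φ.continuous continuous_id continuous_const
  have hq : q ∈ h.source := by simpa [hΦ.zero] using hT 0 left_mem_uIcc
  -- the set of times at which the two curves agree is open in the segment, and so is its complement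
  have key : ∀ t ∈ uIcc 0 T, φ t (h q) = h (Φ t q) →
      ∀ᶠ s in 𝓝 t, φ s (h q) = h (Φ s q) := by
    intro t ht heq
    have h1 : ∀ᶠ s in 𝓝 (0 : ℝ), φ s (h (Φ t q)) ∈ h.target := by
      refine (hφc _).continuousAt.eventually_mem (h.open_target.mem_nhds ?_)
      rw [φ.map_zero_apply]
      exact h.map_source (hT t ht)
    obtain ⟨δ, hδ, hball⟩ := Metric.eventually_nhds_iff_ball.1 h1
    filter_upwards [Metric.ball_mem_nhds t hδ] with s hs
    have hs' : s - t ∈ Metric.ball (0 : ℝ) δ := by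
      simpa [Real.dist_eq] using hs
    have hsub : ∀ r ∈ uIcc 0 (s - t), φ r (h (Φ t q)) ∈ h.target := fun r hr =>
      hball r ((convex_ball (0 : ℝ) δ).ordConnected.uIcc_subset (Metric.mem_ball_self hδ) hs' hr)
    have h2 := hL.symm_flow_eq hφ hΦ hsub
    rw [h.left_inv (hT t ht), ← hΦ.add, sub_add_cancel] at h2
    rw [← h2, h.right_inv (hsub _ right_mem_uIcc), ← heq, ← φ.map_add, sub_add_cancel]
  have hmain := isPreconnected_uIcc (a := (0 : ℝ)) (b := T)
    |>.subset_left_of_subset_union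
      (u := {t | ∀ᶠ s in 𝓝 t, φ s (h q) = h (Φ s q)})
      (v := {t | ∀ᶠ s in 𝓝 t, φ s (h q) ≠ h (Φ s q)})
      isOpen_setOfPred_eventually_nhds isOpen_setOfPred_eventually_nhds ?_ ?_ ?_
  · exact (hmain right_mem_uIcc : ∀ᶠ s in 𝓝 T, _).self_of_nhds
  · refine Set.disjoint_left.2 fun t ht ht' => ?_
    exact (ht' : ∀ᶠ s in 𝓝 t, _).self_of_nhds ((ht : ∀ᶠ s in 𝓝 t, _).self_of_nhds)
  · intro t ht
    by_cases heq : φ t (h q) = h (Φ t q)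
    · exact Or.inl (key t ht heq)
    · right
      have hc : ContinuousAt (fun s => h (Φ s q)) t :=
        ContinuousAt.comp (f := fun s => Φ s q) (h.continuousAt (hT t ht)) (hΦc q).continuousAt
      exact (hφc (h q)).continuousAt.ne_iff_eventually_ne hc |>.1 heq
  · refine ⟨0, left_mem_uIcc, key 0 left_mem_uIcc ?_⟩
    rw [φ.map_zero_apply, hΦ.zero]

end IsLinearizingChart

end Linearizing

/-! ### Invariance of the support -/

section SupportInvariance

variable {E : Type*} [NormedAddCommGroup E] [NormedSpace ℝ E] [FiniteDimensional ℝ E] {Ω : Opens E}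
  {A : E →L[ℝ] E} {Φ : ℝ → E →L[ℝ] E}

/-- The support of a generalized eigendistribution is invariant under the flow, as long as the orbit
stays in the open set on which the distribution is defined: along the flow the pairing with a test
function is an exponential polynomial in time, which is zero as soon as it vanishes on an
interval. -/
theorem flow_neg_mem_dsupport (hΦ : IsLinearFlow A Φ) (u : Distribution Ω ℂ ⊤) (μ : ℂ) (m : ℕ)
    (hu : (shiftedLie A μ)^[m] u = 0) {q : E} (hq : q ∈ Distribution.dsupport u) {T : ℝ}
    (hT : 0 ≤ T) (hstay : ∀ t ∈ Icc 0 T, Φ (-t) q ∈ Ω) :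
    Φ (-T) q ∈ Distribution.dsupport u := by
  by_contra hn
  have hc : Continuous fun z : E × ℝ => Φ (-z.2) z.1 :=
    hΦ.continuous.comp (continuous_snd.neg.prodMk continuous_fst)
  have hO : IsOpen (Distribution.dsupport u)ᶜ := (Distribution.isClosed_dsupport).isOpen_compl
  rcases hT.eq_or_lt with rfl | hT0
  · rw [neg_zero, hΦ.zero] at hn
    exact hn hq
  have hev : ∀ᶠ t in 𝓝 T, Φ (-t) q ∈ (Distribution.dsupport u)ᶜ :=
    (hc.comp (continuous_const.prodMk continuous_id)).continuousAt.eventually_mem (hO.mem_nhds hn)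
  obtain ⟨δ, hδ, hball⟩ := Metric.eventually_nhds_iff_ball.1 hev
  -- on `[T', T]` the transported test functions have left the support of `u`
  set T' := max 0 (T - δ / 2) with hT'
  have hT'T : T' < T := max_lt hT0 (by linarith)
  have h1 : ∀ᶠ x in 𝓝 q, ∀ t ∈ Icc 0 T, Φ (-t) x ∈ Ω :=
    isCompact_Icc.eventually_forall_of_forall_eventually fun t ht =>
      hc.continuousAt.eventually_mem (Ω.isOpen.mem_nhds (hstay t ht))
  have h2 : ∀ᶠ x in 𝓝 q, ∀ t ∈ Icc T' T, Φ (-t) x ∈ (Distribution.dsupport u)ᶜ := by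
    refine isCompact_Icc.eventually_forall_of_forall_eventually fun t ht =>
      hc.continuousAt.eventually_mem (hO.mem_nhds (hball t ?_))
    have := (le_max_right _ _).trans ht.1
    rw [Metric.mem_ball, Real.dist_eq, abs_lt]
    constructor <;> linarith [ht.2]
  refine notMem_dsupport_of_ev u (h1.and h2) (fun f hf hfs => ?_) hq
  have hcomp := isCompact_flow_image hΦ (isCompact_Icc (a := (0 : ℝ)) (b := T)) hf.2.1.isCompact
  have hKΩ : (fun p : ℝ × E => Φ (-p.1) p.2) '' (Icc 0 T ×ˢ tsupport f) ⊆ (Ω : Set E) := by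
    rintro _ ⟨⟨t, x⟩, ⟨ht, hx⟩, rfl⟩
    exact (hfs hx).1 t ht
  have hmem := fun t (ht : t ∈ Icc (0 : ℝ) T) => transport_mem_testSpace hΦ isCompact_Icc hf ht
  have hfam := ev_iterate_family μ u hcomp hKΩ (contDiff_transport hΦ hf.1) hT0 hmem
    fun j t _ => by
      have : (fun x => deriv (fun s => transport A Φ f s x) t) =
          divField A (transport A Φ f t) := by
        ext x
        exact (deriv_transport hΦ hf.1 t x).deriv
      rw [this]
  obtain ⟨P, hP⟩ := exists_polynomial_of_cascade
    (fun j t => ev ((shiftedLie A μ)^[j] u) (transport A Φ f t))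
    (fun j => (hfam j).1) (fun j => (hfam j).2) m fun t _ => by
      simp only [hu, ev_zero_left]
  have hz : ∀ t ∈ Icc T' T, P.eval (t : ℂ) = 0 := by
    intro t ht
    have ht' : t ∈ Icc (0 : ℝ) T := ⟨(le_max_left _ _).trans ht.1, ht.2⟩
    have h3 := hP t ht'
    have h4 : ev u (transport A Φ f t) = 0 := by
      have h5 := transport_mem_testSpace hΦ (isCompact_singleton (x := t)) hf rfl
      refine ev_eq_zero_of_disjoint_dsupport u (testSpace_mono hKΩ (hmem t ht'))
        (Set.disjoint_left.2 fun y hy => ?_)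
      obtain ⟨⟨s, x⟩, ⟨hs, hx⟩, rfl⟩ := h5.2.2 hy
      obtain rfl : s = t := hs
      exact (hfs hx).2 s ht
    simp only [Function.iterate_zero, id_eq, h4] at h3
    exact (mul_eq_zero.1 h3.symm).resolve_left (Complex.exp_ne_zero _)
  have hP0 : P = 0 := by
    refine Polynomial.eq_zero_of_infinite_isRoot P (Set.Infinite.mono (s := (fun t : ℝ => (t : ℂ)) ''
      Icc T' T) ?_ ((Set.Icc_infinite hT'T).image Complex.ofReal_injective.injOn))
    rintro _ ⟨t, ht, rfl⟩
    exact hz t ht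
  have h3 := hP 0 ⟨le_rfl, hT⟩
  simpa [hP0, transport_zero hΦ] using h3

end SupportInvariance

/-! ### Tangent vectors of the invariant manifolds -/

section AsymptoticTangent

variable {n : ℕ} {M : Type*} [TopologicalSpace M] [ChartedSpace (EuclideanSpace ℝ (Fin n)) M]
  {V : (x : M) → TangentSpace (𝓡 n) x} {p : M} {φ : Flow ℝ M}

theorem IsSmoothFlowOf.contMDiff (hφ : IsSmoothFlowOf φ V) (t : ℝ) :
    ContMDiff (𝓡 n) (𝓡 n) ∞ (φ t) :=
  hφ.smooth.comp (contMDiff_const.prodMk contMDiff_id)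

/-- The vector field is tangent to the set of points whose orbit converges to `p`. -/
theorem field_mem_asymptoticTangent [IsManifold (𝓡 n) ∞ M] (hφ : IsSmoothFlowOf φ V)
    {l : Filter ℝ} (hl : Tendsto (fun q : ℝ × ℝ => q.1 + q.2) (l ×ˢ 𝓟 (Ioo (-1) 1)) l) {x : M}
    (hx : Tendsto (fun t => φ t x) l (𝓝ˢ {p})) :
    V x ∈ asymptoticTangent φ l {p} x := by
  refine ⟨fun s => φ s x, ?_, ?_, 1, one_pos, ?_⟩
  · have h1 : ContMDiff 𝓘(ℝ, ℝ) (𝓡 n) ∞ fun s => φ s x :=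
      hφ.smooth.comp (contMDiff_id.prodMk contMDiff_const)
    exact (h1.of_le (by simp)).contMDiffAt
  · rw [(hφ.generator x 0).mfderiv]
    have h1 : ((1 : ℝ →L[ℝ] ℝ).smulRight (V (φ 0 x)) : ℝ →L[ℝ] EuclideanSpace ℝ (Fin n)) 1 =
        V (φ 0 x) := one_smul ℝ (V (φ 0 x) : EuclideanSpace ℝ (Fin n))
    have h2 := congrArg (fun y => (⟨y, V y⟩ : TangentBundle (𝓡 n) M)) (φ.map_zero_apply x)
    refine Eq.trans ?_ h2
    exact congrArg (fun w => (⟨φ 0 x, w⟩ : TangentBundle (𝓡 n) M)) h1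
  · simp only [← φ.map_add]
    exact hx.comp hl

variable {E : Type*} [NormedAddCommGroup E] [NormedSpace ℝ E] {A : E →L[ℝ] E}
  {h : OpenPartialHomeomorph E M} {Φ : ℝ → E →L[ℝ] E}

namespace IsLinearizingChart

theorem mdifferentiableAt_symm_flow (hL : IsLinearizingChart V p A h) (hφ : IsSmoothFlowOf φ V)
    {a : ℝ} {x : M} (hx : φ a x ∈ h.target) :
    MDifferentiableAt (𝓡 n) 𝓘(ℝ, E) (fun m => h.symm (φ a m)) x :=
  (hL.mdifferentiableAt_symm hx).comp x ((hφ.contMDiff a).mdifferentiable (by simp) x)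

theorem bijective_mfderiv_symm_flow (hL : IsLinearizingChart V p A h) (hφ : IsSmoothFlowOf φ V)
    {a : ℝ} {x : M} (hx : φ a x ∈ h.target) :
    Function.Bijective (mfderiv (𝓡 n) 𝓘(ℝ, E) (fun m => h.symm (φ a m)) x) := by
  have hcont : ∀ b, Continuous (φ b) := fun b => φ.continuous continuous_const continuous_id
  have hsymm : h.symm (φ a x) ∈ h.source := h.map_target hx
  refine bijective_mfderiv_of_localInverse (g := fun q => φ (-a) (h q))
    (hL.mdifferentiableAt_symm_flow hφ hx) ?_ ?_ ?_
  · exact ((hφ.contMDiff (-a)).mdifferentiable (by simp) _).comp _ (hL.mdifferentiableAt hsymm)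
  · filter_upwards [(hcont a).continuousAt.eventually_mem (h.open_target.mem_nhds hx)] with m hm
    simp [h.right_inv hm, ← φ.map_add]
  · filter_upwards [h.open_source.mem_nhds hsymm] with q hq
    simp [← φ.map_add, h.left_inv hq]

/-- Let `π` be a linear projection which vanishes on the vectors whose orbit under the linear flow,
in the time direction `σ`, stays small. Then the differential of `π`, in the chart and after a
time `σ T₁`, vanishes on the velocities of the curves asymptotic to `p`. -/
theorem mfderiv_eq_zero_of_mem_asymptoticTangent (hL : IsLinearizingChart V p A h)
    (hφ : IsSmoothFlowOf φ V) (hΦ : IsLinearFlow A Φ) {F : Type*} [NormedAddCommGroup F]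
    [NormedSpace ℝ F] (π : E →L[ℝ] F) {σ ρ T₁ : ℝ} (hρ : 0 < ρ)
    (hsub : Metric.ball 0 ρ ⊆ h.source)
    (hπ : ∀ q, (∀ t, 0 ≤ t → ‖Φ (σ * t) q‖ < ρ) → π q = 0) {l : Filter ℝ}
    (hl : Tendsto (fun t => σ * t) atTop l) {x : M}
    (hx : ∀ t, T₁ ≤ t → φ (σ * t) x ∈ h '' Metric.ball 0 ρ) {v : TangentSpace (𝓡 n) x}
    (hv : v ∈ asymptoticTangent φ l {p} x) :
    π (mfderiv (𝓡 n) 𝓘(ℝ, E) (fun m => h.symm (φ (σ * T₁) m)) x v) = 0 := by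
  obtain ⟨γ, hγ, hxv, ε, hε, hlim⟩ := hv
  cases hxv
  set U := h '' Metric.ball 0 ρ with hU
  have hUo : IsOpen U := h.isOpen_image_of_subset_source Metric.isOpen_ball hsub
  have hUt : U ⊆ h.target := by
    rintro _ ⟨q, hq, rfl⟩
    exact h.map_source (hsub hq)
  have hpU : U ∈ 𝓝ˢ {p} := by
    rw [nhdsSet_singleton]
    exact hL.image_mem_nhds (Metric.ball_mem_nhds _ hρ)
  have h1 : ∀ᶠ t in atTop, ∀ s ∈ Ioo (-ε) ε, φ (σ * t) (γ s) ∈ U :=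
    hl.eventually (eventually_prod_principal_iff.1 (hlim.eventually hpU))
  obtain ⟨T₂, hT₂⟩ := eventually_atTop.1 h1
  have h2 : ∀ᶠ s in 𝓝 (0 : ℝ), ∀ t ∈ Icc T₁ T₂, φ (σ * t) (γ s) ∈ U := by
    refine isCompact_Icc.eventually_forall_of_forall_eventually fun t ht => ?_
    have hc : ContinuousAt (fun z : ℝ × ℝ => φ (σ * z.2) (γ z.1)) (0, t) := by
      have h3 : ContinuousAt (fun z : ℝ × ℝ => (σ * z.2, γ z.1)) (0, t) :=
        (continuous_const.mul continuous_snd).continuousAt.prodMk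
          (ContinuousAt.comp (f := fun z : ℝ × ℝ => z.1) hγ.continuousAt continuousAt_fst)
      exact ContinuousAt.comp (g := fun w : ℝ × M => φ w.1 w.2)
        (φ.continuous continuous_fst continuous_snd).continuousAt h3
    exact hc.eventually_mem (hUo.mem_nhds (hx t ht.1))
  have h3 : ∀ᶠ s in 𝓝 (0 : ℝ), π (h.symm (φ (σ * T₁) (γ s))) = 0 := by
    filter_upwards [h2, Ioo_mem_nhds (neg_lt_zero.2 hε) hε] with s hs hs'
    have hin : ∀ t, T₁ ≤ t → φ (σ * t) (γ s) ∈ U := fun t ht =>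
      (le_total t T₂).elim (fun h => hs t ⟨ht, h⟩) fun h => hT₂ t h s hs'
    have hadd : ∀ t, φ (σ * t) (φ (σ * T₁) (γ s)) = φ (σ * (t + T₁)) (γ s) := fun t => by
      rw [← φ.map_add, mul_add]
    refine hπ _ fun t ht => ?_
    rw [← hL.symm_flow_eq hφ hΦ, hadd]
    · obtain ⟨q, hq, hq'⟩ := hin (t + T₁) (by linarith)
      rw [← hq', h.left_inv (hsub hq)]
      simpa using hq
    · intro r hr
      rw [← mul_zero σ, ← Set.image_const_mul_uIcc, uIcc_of_le ht] at hr
      obtain ⟨t', ht', rfl⟩ := hr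
      simp only [hadd]
      exact hUt (hin _ (by linarith [ht'.1]))
  have hxt : φ (σ * T₁) (γ 0) ∈ h.target := hUt (hx T₁ le_rfl)
  have h4 := (hL.mdifferentiableAt_symm_flow hφ hxt).hasMFDerivAt.comp (0 : ℝ)
    (hγ.mdifferentiableAt (by simp)).hasMFDerivAt
  have h5 := (π.hasMFDerivAt (x := h.symm (φ (σ * T₁) (γ 0)))).comp (0 : ℝ) h4
  have h6 : HasMFDerivAt 𝓘(ℝ, ℝ) 𝓘(ℝ, F) (π ∘ (fun m => h.symm (φ (σ * T₁) m)) ∘ γ) 0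
      (0 : TangentSpace 𝓘(ℝ, ℝ) (0 : ℝ) →L[ℝ] TangentSpace 𝓘(ℝ, F) (0 : F)) :=
    (hasMFDerivAt_const (0 : F) (0 : ℝ)).congr_of_eventuallyEq h3
  exact DFunLike.congr_fun (hasMFDerivAt_unique h5 h6) (1 : ℝ)

end IsLinearizingChart

end AsymptoticTangent

/-! ### The unstable manifold near the fixed point -/

namespace HyperbolicBlocks

variable (B : HyperbolicBlocks)

theorem norm_stableFlow_le {ε : ℝ} (h1 : ∀ j, B.χLs j ≤ -ε) (h2 : ∀ j, B.χPs j ≤ -ε) {t : ℝ}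
    (ht : 0 ≤ t) (x : B.X) : ‖B.stableFlow t x‖ ≤ Real.exp (-(ε * t)) * ‖x‖ := by
  refine norm_blockFlow_le _ _ (fun j => ?_) (fun j => ?_) x
  · nlinarith [h1 j]
  · rw [stableCoeff_re]; nlinarith [h2 j]

theorem flow_apply_mk (t : ℝ) (x : B.X) (y : B.Y) :
    B.saddle.flow t (x, y) = (B.stableFlow t x, B.unstableFlow t y) := rfl

theorem tendsto_stableFlow (x : B.X) : Tendsto (fun t => B.stableFlow t x) atTop (𝓝 0) := by
  obtain ⟨ε, hε, h1, h2, -⟩ := B.exists_rate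
  refine squeeze_zero_norm' (a := fun t => Real.exp (-(ε * t)) * ‖x‖) ?_ ?_
  · filter_upwards [eventually_ge_atTop 0] with t ht using B.norm_stableFlow_le h1 h2 ht x
  · have h3 : Tendsto (fun t => -(ε * t)) atTop atBot :=
      tendsto_neg_atTop_atBot.comp (tendsto_id.const_mul_atTop hε)
    simpa using (Real.tendsto_exp_atBot.comp h3).mul_const ‖x‖

theorem tendsto_unstableFlow_neg (y : B.Y) :
    Tendsto (fun t => B.unstableFlow (-t) y) atTop (𝓝 0) := by
  obtain ⟨ε, hε, -, -, h1, h2⟩ := B.exists_rate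
  refine squeeze_zero_norm' (a := fun t => Real.exp (-(ε * t)) * ‖y‖) ?_ ?_
  · filter_upwards [eventually_ge_atTop 0] with t ht using B.norm_unstableFlow_neg_le h1 h2 ht y
  · have h3 : Tendsto (fun t => -(ε * t)) atTop atBot :=
      tendsto_neg_atTop_atBot.comp (tendsto_id.const_mul_atTop hε)
    simpa using (Real.tendsto_exp_atBot.comp h3).mul_const ‖y‖

theorem norm_stableFlow_le_self {t : ℝ} (ht : 0 ≤ t) (x : B.X) : ‖B.stableFlow t x‖ ≤ ‖x‖ :=
  B.saddle.norm_S_le t ht x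

theorem norm_unstableFlow_neg_le_self {t : ℝ} (ht : 0 ≤ t) (y : B.Y) :
    ‖B.unstableFlow (-t) y‖ ≤ ‖y‖ := by
  obtain ⟨ε, hε, -, -, h1, h2⟩ := B.exists_rate
  refine (B.norm_unstableFlow_neg_le h1 h2 ht y).trans (mul_le_of_le_one_left (norm_nonneg _) ?_)
  exact Real.exp_le_one_iff.2 (neg_nonpos.2 (by positivity))

theorem stableFlow_neg_apply (t : ℝ) (x : B.X) : B.stableFlow t (B.stableFlow (-t) x) = x :=
  (isLinearFlow_blockFlow B.χLs B.stableCoeff).apply_neg_apply t x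

theorem unstableFlow_neg_apply (t : ℝ) (y : B.Y) : B.unstableFlow (-t) (B.unstableFlow t y) = y :=
  (isLinearFlow_blockFlow B.χLu B.unstableCoeff).neg_apply_apply t y

theorem snd_eq_zero_of_forward_bounded {ρ : ℝ} {q : B.Coord}
    (h : ∀ t, 0 ≤ t → ‖B.saddle.flow t q‖ < ρ) : q.2 = 0 := by
  obtain ⟨ε, hε, -, -, h1, h2⟩ := B.exists_rate
  refine norm_le_zero_iff.1 (ge_of_tendsto (f := fun t => Real.exp (-(ε * t)) * ρ)
    (x := atTop) ?_ ?_)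
  · have h3 : Tendsto (fun t => -(ε * t)) atTop atBot :=
      tendsto_neg_atTop_atBot.comp (tendsto_id.const_mul_atTop hε)
    simpa using (Real.tendsto_exp_atBot.comp h3).mul_const ρ
  · filter_upwards [eventually_ge_atTop 0] with t ht
    have h3 := B.norm_unstableFlow_neg_le h1 h2 ht (B.unstableFlow t q.2)
    rw [unstableFlow_neg_apply] at h3
    exact h3.trans (by gcongr; exact (norm_snd_le (B.saddle.flow t q)).trans (h t ht).le)

theorem fst_eq_zero_of_backward_bounded {ρ : ℝ} {q : B.Coord}
    (h : ∀ t, 0 ≤ t → ‖B.saddle.flow (-t) q‖ < ρ) : q.1 = 0 := by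
  obtain ⟨ε, hε, h1, h2, -⟩ := B.exists_rate
  refine norm_le_zero_iff.1 (ge_of_tendsto (f := fun t => Real.exp (-(ε * t)) * ρ)
    (x := atTop) ?_ ?_)
  · have h3 : Tendsto (fun t => -(ε * t)) atTop atBot :=
      tendsto_neg_atTop_atBot.comp (tendsto_id.const_mul_atTop hε)
    simpa using (Real.tendsto_exp_atBot.comp h3).mul_const ρ
  · filter_upwards [eventually_ge_atTop 0] with t ht
    have h3 := B.norm_stableFlow_le h1 h2 ht (B.stableFlow (-t) q.1)
    rw [stableFlow_neg_apply] at h3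
    exact h3.trans (by gcongr; exact (norm_fst_le (B.saddle.flow (-t) q)).trans (h t ht).le)

theorem linearField_injective : Function.Injective B.linearField := by
  refine (injective_iff_map_eq_zero _).2 fun q hq => ?_
  rw [linearField_eq] at hq
  have e1 : ∀ j, B.χLs j * q.1.1 j = 0 := fun j => congrArg (fun q : B.Coord => q.1.1 j) hq
  have e2 : ∀ j, B.stableCoeff j * q.1.2 j = 0 := fun j => congrArg (fun q : B.Coord => q.1.2 j) hq
  have e3 : ∀ j, B.χLu j * q.2.1 j = 0 := fun j => congrArg (fun q : B.Coord => q.2.1 j) hq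
  have e4 : ∀ j, B.unstableCoeff j * q.2.2 j = 0 := fun j =>
    congrArg (fun q : B.Coord => q.2.2 j) hq
  have n2 : ∀ j, B.stableCoeff j ≠ 0 := fun j hj =>
    (B.χPs_neg j).ne (by rw [← stableCoeff_re, hj, Complex.zero_re])
  have n4 : ∀ j, B.unstableCoeff j ≠ 0 := fun j hj =>
    (B.χPu_pos j).ne' (by rw [← unstableCoeff_re, hj, Complex.zero_re])
  refine Prod.ext (Prod.ext (funext fun j => ?_) (funext fun j => ?_))
    (Prod.ext (funext fun j => ?_) (funext fun j => ?_))
  · exact (mul_eq_zero.1 (e1 j)).resolve_left (B.χLs_neg j).ne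
  · exact (mul_eq_zero.1 (e2 j)).resolve_left (n2 j)
  · exact (mul_eq_zero.1 (e3 j)).resolve_left (B.χLu_pos j).ne'
  · exact (mul_eq_zero.1 (e4 j)).resolve_left (n4 j)

end HyperbolicBlocks

section MorseSmale

variable {n : ℕ} {M : Type*} [TopologicalSpace M] [ChartedSpace (EuclideanSpace ℝ (Fin n)) M]
  {V : (x : M) → TangentSpace (𝓡 n) x} {p : M} {φ : Flow ℝ M}

/-- A fixed point of a Morse-Smale flow is hyperbolic, and its invariant manifolds intersect each
other transversally. -/
theorem IsMorseSmale.fixedPoint (hMS : IsMorseSmale n φ) (hp : IsFixedPointOf φ p) :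
    IsHyperbolicElement n φ {p} ∧
      ∀ x ∈ unstableManifold φ {p} ∩ stableManifold φ {p}, ∀ w : TangentSpace (𝓡 n) x,
        ∃ v₁ ∈ unstableTangent φ {p} x, ∃ v₂ ∈ stableTangent φ {p} x, w = v₁ + v₂ := by
  obtain ⟨C, -, hC, hNW, htr⟩ := hMS
  have h1 : p ∈ nonWanderingSet φ := fun U hU T =>
    ⟨T, le_rfl, p, ⟨p, mem_of_mem_nhds hU, hp T⟩, mem_of_mem_nhds hU⟩
  rw [hNW] at h1
  obtain ⟨Λ, hΛ, hpΛ⟩ := h1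
  obtain ⟨⟨p₀, -, hΛ₀⟩, hhyp⟩ := hC Λ hΛ
  have h2 : Λ = {p} := by
    rw [hΛ₀, Flow.mem_orbit_iff] at hpΛ
    obtain ⟨t, ht⟩ := hpΛ
    have h3 : p₀ = p := by
      have := congrArg (φ (-t)) ht
      rwa [← φ.map_add, neg_add_cancel, φ.map_zero_apply, hp] at this
    rw [hΛ₀, h3]
    ext x
    rw [Flow.mem_orbit_iff, mem_singleton_iff]
    exact ⟨fun ⟨t, ht⟩ => by rw [← ht, hp], fun hx => ⟨0, by rw [hp, hx]⟩⟩
  subst h2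
  exact ⟨hhyp, htr _ hΛ _ hΛ⟩

end MorseSmale

namespace AdaptedChart

variable {n : ℕ} {M : Type*} [TopologicalSpace M] [T2Space M]
  [ChartedSpace (EuclideanSpace ℝ (Fin n)) M] [IsManifold (𝓡 n) ∞ M]
  {V : (x : M) → TangentSpace (𝓡 n) x} {p : M} {φ : Flow ℝ M}

/-- There is no homoclinic orbit: a point `(x, 0)` with `x ≠ 0` is on the stable manifold; if it
were on the unstable manifold as well, then the two tangent spaces would have complementary
dimensions and span the whole tangent space, although both contain the vector field. -/
theorem notMem_unstableManifold (κ : AdaptedChart V p) (hφ : IsSmoothFlowOf φ V)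
    (hMS : IsMorseSmale n φ) (hp : IsFixedPointOf φ p) {x : κ.B.X} (hx : x ≠ 0)
    (hsrc : ∀ t, 0 ≤ t → ((κ.B.stableFlow t x, 0) : κ.B.Coord) ∈ κ.h.source) :
    κ.h (x, 0) ∉ unstableManifold φ {p} := by
  intro hu
  have hL := κ.linearizing
  have hΦ := κ.B.isLinearFlow_saddle
  have hflow : ∀ t, 0 ≤ t → φ t (κ.h (x, 0)) = κ.h (κ.B.stableFlow t x, 0) := by
    intro t ht
    rw [hL.flow_eq hφ hΦ (T := t), HyperbolicBlocks.flow_apply_mk, map_zero]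
    intro s hs
    rw [uIcc_of_le ht] at hs
    rw [HyperbolicBlocks.flow_apply_mk, map_zero]
    exact hsrc s hs.1
  obtain ⟨ρ, hρ, hball⟩ := Metric.mem_nhds_iff.1 (κ.h.open_source.mem_nhds hL.zero_mem)
  set z := κ.h (x, 0) with hz
  have hUp : κ.h '' Metric.ball 0 ρ ∈ 𝓝 p := hL.image_mem_nhds (Metric.ball_mem_nhds _ hρ)
  have hs : z ∈ stableManifold φ {p} := by
    change Tendsto (fun t => φ t z) atTop (𝓝ˢ {p})
    rw [nhdsSet_singleton]
    have h1 : Tendsto (fun t => κ.h (κ.B.stableFlow t x, 0)) atTop (𝓝 p) := by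
      have h2 : Tendsto κ.h (𝓝 0) (𝓝 p) := by
        have h3 : Tendsto κ.h (𝓝 0) (𝓝 (κ.h 0)) := κ.h.continuousAt hL.zero_mem
        rwa [hL.map_zero] at h3
      exact h2.comp ((κ.B.tendsto_stableFlow x).prodMk_nhds tendsto_const_nhds)
    refine h1.congr' ?_
    filter_upwards [eventually_ge_atTop 0] with t ht using (hflow t ht).symm
  have hl1 : Tendsto (fun t : ℝ => 1 * t) atTop atTop := by simpa using! tendsto_id
  have hl2 : Tendsto (fun t : ℝ => -1 * t) atTop atBot := by
    simpa using tendsto_neg_atTop_atBot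
  have hs' : Tendsto (fun t => φ t z) atTop (𝓝 p) := by rw [← nhdsSet_singleton]; exact hs
  have hu' : Tendsto (fun t => φ t z) atBot (𝓝 p) := by rw [← nhdsSet_singleton]; exact hu
  obtain ⟨T₁, hT₁⟩ : ∃ T₁, ∀ t, T₁ ≤ t → φ (1 * t) z ∈ κ.h '' Metric.ball 0 ρ :=
    eventually_atTop.1 (hl1.eventually (hs'.eventually hUp))
  obtain ⟨T₂, hT₂⟩ : ∃ T₂, ∀ t, T₂ ≤ t → φ (-1 * t) z ∈ κ.h '' Metric.ball 0 ρ :=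
    eventually_atTop.1 (hl2.eventually (hu'.eventually hUp))
  have hπ1 : ∀ q : κ.B.Coord, (∀ t, 0 ≤ t → ‖κ.B.saddle.flow (1 * t) q‖ < ρ) →
      ContinuousLinearMap.snd ℝ κ.B.X κ.B.Y q = 0 := fun q hq =>
    κ.B.snd_eq_zero_of_forward_bounded (ρ := ρ) fun t ht => by simpa using hq t ht
  have hπ2 : ∀ q : κ.B.Coord, (∀ t, 0 ≤ t → ‖κ.B.saddle.flow (-1 * t) q‖ < ρ) →
      ContinuousLinearMap.fst ℝ κ.B.X κ.B.Y q = 0 := fun q hq =>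
    κ.B.fst_eq_zero_of_backward_bounded (ρ := ρ) fun t ht => by simpa using hq t ht
  -- the tangent spaces of the stable and of the unstable manifold are contained in the kernels of
  -- the `y` component of `D1` and of the `x` component of `D2` below
  have hk1 := fun (v : TangentSpace (𝓡 n) z) (hv : v ∈ stableTangent φ {p} z) =>
    hL.mfderiv_eq_zero_of_mem_asymptoticTangent hφ hΦ _ hρ hball hπ1 hl1 hT₁ hv
  have hk2 := fun (v : TangentSpace (𝓡 n) z) (hv : v ∈ unstableTangent φ {p} z) =>
    hL.mfderiv_eq_zero_of_mem_asymptoticTangent hφ hΦ _ hρ hball hπ2 hl2 hT₂ hv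
  have hVs : V z ∈ stableTangent φ {p} z := by
    refine field_mem_asymptoticTangent hφ ?_ hs
    refine tendsto_atTop.2 fun b => eventually_prod_principal_iff.2 ?_
    filter_upwards [eventually_ge_atTop (b + 1)] with t ht s hs
    linarith [hs.1]
  have hVu : V z ∈ unstableTangent φ {p} z := by
    refine field_mem_asymptoticTangent hφ ?_ hu
    refine tendsto_atBot.2 fun b => eventually_prod_principal_iff.2 ?_
    filter_upwards [eventually_le_atBot (b - 1)] with t ht s hs
    linarith [hs.2]
  have hT1 : φ (1 * T₁) z ∈ κ.h.target := by
    obtain ⟨q, hq, hq'⟩ := hT₁ T₁ le_rfl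
    rw [← hq']; exact κ.h.map_source (hball hq)
  have hT2 : φ (-1 * T₂) z ∈ κ.h.target := by
    obtain ⟨q, hq, hq'⟩ := hT₂ T₂ le_rfl
    rw [← hq']; exact κ.h.map_source (hball hq)
  have hb1 := hL.bijective_mfderiv_symm_flow hφ hT1
  have hb2 := hL.bijective_mfderiv_symm_flow hφ hT2
  let D1 : EuclideanSpace ℝ (Fin n) →L[ℝ] κ.B.Coord :=
    mfderiv (𝓡 n) 𝓘(ℝ, κ.B.Coord) (fun m => κ.h.symm (φ (1 * T₁) m)) z
  let D2 : EuclideanSpace ℝ (Fin n) →L[ℝ] κ.B.Coord :=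
    mfderiv (𝓡 n) 𝓘(ℝ, κ.B.Coord) (fun m => κ.h.symm (φ (-1 * T₂) m)) z
  let L : EuclideanSpace ℝ (Fin n) →ₗ[ℝ] κ.B.Coord :=
    (((ContinuousLinearMap.fst ℝ κ.B.X κ.B.Y).comp D2).prod
      ((ContinuousLinearMap.snd ℝ κ.B.X κ.B.Y).comp D1)).toLinearMap
  have hLs : ∀ v, L v = ((D2 v).1, (D1 v).2) := fun v => rfl
  -- transversality makes the two components jointly surjective, hence injective
  have hsurj : Function.Surjective L := by
    rintro ⟨a, b⟩
    obtain ⟨w₁, hw₁⟩ := hb2.2 ((a, 0) : κ.B.Coord)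
    obtain ⟨w₂, hw₂⟩ := hb1.2 ((0, b) : κ.B.Coord)
    change D2 w₁ = _ at hw₁
    change D1 w₂ = _ at hw₂
    obtain ⟨v₁, hv₁, v₂, hv₂, hv⟩ := (hMS.fixedPoint hp).2 z ⟨hu, hs⟩ w₁
    obtain ⟨v₁', hv₁', v₂', hv₂', hv'⟩ := (hMS.fixedPoint hp).2 z ⟨hu, hs⟩ w₂
    have e1 : (D2 v₁).1 = 0 := hk2 v₁ hv₁
    have e2 : (D1 v₂).2 = 0 := hk1 v₂ hv₂
    have e3 : (D2 v₁').1 = 0 := hk2 v₁' hv₁'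
    have e4 : (D1 v₂').2 = 0 := hk1 v₂' hv₂'
    have e5 : D2 w₁ = D2 v₁ + D2 v₂ := (congrArg D2 hv).trans (D2.map_add v₁ v₂)
    have e6 : D1 w₂ = D1 v₁' + D1 v₂' := (congrArg D1 hv').trans (D1.map_add v₁' v₂')
    have e7 : (D2 v₂).1 = a := by
      have := congrArg Prod.fst (hw₁.symm.trans e5)
      simpa [e1] using this.symm
    have e8 : (D1 v₁').2 = b := by
      have := congrArg Prod.snd (hw₂.symm.trans e6)
      simpa [e4] using this.symm
    refine ⟨(v₂ + v₁' : EuclideanSpace ℝ (Fin n)), (L.map_add v₂ v₁').trans ?_⟩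
    refine (congrArg₂ (· + ·) (hLs v₂) (hLs v₁')).trans ?_
    simp only [e2, e3, e7, e8, Prod.mk_add_mk, add_zero, zero_add]
  have hdim : Module.finrank ℝ (EuclideanSpace ℝ (Fin n)) = Module.finrank ℝ κ.B.Coord :=
    (LinearEquiv.ofBijective D1.toLinearMap hb1).finrank_eq
  have hinj := (LinearMap.injective_iff_surjective_of_finrank_eq_finrank hdim).2 hsurj
  have hV0 : L (V z) = L 0 :=
    ((hLs (V z)).trans (Prod.ext (y := (0 : κ.B.Coord)) (hk2 _ hVu) (hk1 _ hVs))).trans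
      L.map_zero.symm
  have hV : V z = 0 := hinj hV0
  have h0 : ((x, 0) : κ.B.Coord) ∈ κ.h.source := by
    have h := hsrc 0 le_rfl
    have h' : κ.B.stableFlow 0 x = x :=
      (isLinearFlow_blockFlow κ.B.χLs κ.B.stableCoeff).zero x
    rwa [h'] at h
  have hA := hL.mfderiv_symm_apply (κ.h.map_source h0)
  let D0 : EuclideanSpace ℝ (Fin n) →L[ℝ] κ.B.Coord :=
    mfderiv (𝓡 n) 𝓘(ℝ, κ.B.Coord) κ.h.symm z
  have hA' : D0 (V z) = 0 := (congrArg D0 hV).trans D0.map_zero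
  have hA'' : κ.B.linearField (x, 0) = 0 := by
    rw [← κ.h.left_inv h0]
    exact hA.symm.trans hA'
  have h3 : ((x, 0) : κ.B.Coord) = 0 := κ.B.linearField_injective (by rw [hA'', map_zero])
  exact hx (congrArg Prod.fst h3)

end AdaptedChart

/-! ### Distributions supported on the unstable manifold -/

namespace AdaptedChart

variable {n : ℕ} {M : Type*} [TopologicalSpace M] [T2Space M]
  [ChartedSpace (EuclideanSpace ℝ (Fin n)) M]
  {V : (x : M) → TangentSpace (𝓡 n) x} {p : M} {φ : Flow ℝ M}

/-- In adapted coordinates a generalized eigendistribution supported on the unstable manifold is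
supported in `{x = 0}` near the fixed point. Otherwise the backward flow would produce a point
`(x, 0)`, `x ≠ 0`, in the support, hence a homoclinic orbit. -/
theorem exists_nhds_ev_eq_zero [IsManifold (𝓡 n) ∞ M] (κ : AdaptedChart V p)
    (hφ : IsSmoothFlowOf φ V) (hMS : IsMorseSmale n φ) (hp : IsFixedPointOf φ p)
    {Ω : Opens κ.B.Coord} (h0 : (0 : κ.B.Coord) ∈ Ω) (hsub : (Ω : Set κ.B.Coord) ⊆ κ.h.source)
    (u : Distribution Ω ℂ ⊤) (μ : ℂ) (m : ℕ) (hu : (shiftedLie κ.B.linearField μ)^[m] u = 0)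
    (hsupp : Distribution.dsupport u ∩ Ω ⊆ κ.h ⁻¹' (unstableManifold φ {p})) :
    ∃ W ∈ 𝓝 (0 : κ.B.Coord), ∀ f ∈ testSpace (Ω : Set κ.B.Coord),
      tsupport f ⊆ W ∩ {q | q.1 ≠ 0} → ev u f = 0 := by
  have hΦ := κ.B.isLinearFlow_saddle
  obtain ⟨r, hr, hball⟩ := Metric.nhds_basis_closedBall.mem_iff.1 (Ω.isOpen.mem_nhds h0)
  -- on the section `‖x‖ = r` the support stays at a distance `δ` from `{y = 0}`
  set Z : Set κ.B.Coord :=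
    Distribution.dsupport u ∩ (Metric.closedBall 0 r ∩ {q | ‖q.1‖ = r}) with hZ
  have hZc : IsCompact Z :=
    ((isCompact_closedBall (0 : κ.B.Coord) r).inter_right
      (isClosed_eq continuous_fst.norm continuous_const)).inter_left
      Distribution.isClosed_dsupport
  obtain ⟨δ, hδ, hδZ⟩ := hZc.exists_forall_le' (f := fun q : κ.B.Coord => ‖q.2‖)
    continuous_snd.norm.continuousOn (a := 0) fun q hq => by
      refine norm_pos_iff.2 fun hq2 => ?_
      obtain ⟨hqs, hqb, hqr⟩ := hq
      have hqr' : ‖q.1‖ = r := hqr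
      have hq1 : q.1 ≠ 0 := norm_pos_iff.1 (by rw [hqr']; exact hr)
      have hqe : q = (q.1, 0) := Prod.ext rfl hq2
      refine κ.notMem_unstableManifold hφ hMS hp hq1 (fun t ht => hsub (hball ?_)) ?_
      · rw [mem_closedBall_zero_iff, Prod.norm_def]
        exact max_le ((κ.B.norm_stableFlow_le_self ht _).trans hqr'.le) (by simpa using hr.le)
      · rw [← hqe]
        exact hsupp ⟨hqs, hball hqb⟩
  refine ⟨Metric.ball 0 (min δ r), Metric.ball_mem_nhds _ (lt_min hδ hr), fun f hf hfs => ?_⟩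
  refine ev_eq_zero_of_disjoint_dsupport u hf (Set.disjoint_left.2 fun q hq hqs => ?_)
  obtain ⟨hqW, hq1⟩ := hfs hq
  have hq1' : q.1 ≠ 0 := hq1
  rw [mem_ball_zero_iff, lt_min_iff] at hqW
  -- follow the orbit of `q` backwards until it meets the section; `y` does not grow on the way
  obtain ⟨T₀, hT₀, hle⟩ : ∃ t, 0 ≤ t ∧ r ≤ ‖κ.B.stableFlow (-t) q.1‖ := by
    by_contra! hcon
    refine hq1' (κ.B.fst_eq_zero_of_backward_bounded (ρ := r) (q := (q.1, 0)) fun t ht => ?_)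
    rw [HyperbolicBlocks.flow_apply_mk, map_zero, Prod.norm_def, norm_zero]
    exact max_lt (hcon t ht) hr
  have hcont : Continuous fun t => ‖κ.B.stableFlow (-t) q.1‖ :=
    ((isLinearFlow_blockFlow κ.B.χLs κ.B.stableCoeff).continuous.comp
      (continuous_neg.prodMk continuous_const)).norm
  have hz : ‖κ.B.stableFlow (-0) q.1‖ ≤ r := by
    have h' : κ.B.stableFlow 0 q.1 = q.1 :=
      (isLinearFlow_blockFlow κ.B.χLs κ.B.stableCoeff).zero _
    rw [neg_zero, h']
    exact (norm_fst_le q).trans hqW.2.le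
  obtain ⟨T, ⟨hT, -⟩, hTr⟩ := intermediate_value_Icc hT₀ hcont.continuousOn ⟨hz, hle⟩
  have hTr' : ‖κ.B.stableFlow (-T) q.1‖ = r := hTr
  have h2 : ∀ t, 0 ≤ t → ‖κ.B.unstableFlow (-t) q.2‖ ≤ ‖q.2‖ := fun t ht =>
    κ.B.norm_unstableFlow_neg_le_self ht _
  have hq2 : ‖q.2‖ ≤ ‖q‖ := norm_snd_le q
  have hstay : ∀ t ∈ Icc 0 T, κ.B.saddle.flow (-t) q ∈ Metric.closedBall 0 r := by
    intro t ht
    rw [mem_closedBall_zero_iff]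
    refine max_le ?_ ((h2 t ht.1).trans (hq2.trans hqW.2.le))
    have h3 : κ.B.stableFlow (-t) q.1 = κ.B.stableFlow (T - t) (κ.B.stableFlow (-T) q.1) := by
      have := (isLinearFlow_blockFlow κ.B.χLs κ.B.stableCoeff).add (T - t) (-T) q.1
      rw [show T - t + -T = -t by ring] at this
      exact this
    change ‖κ.B.stableFlow (-t) q.1‖ ≤ r
    rw [h3, ← hTr']
    exact κ.B.norm_stableFlow_le_self (sub_nonneg.2 ht.2) _
  have hmem := flow_neg_mem_dsupport hΦ u μ m hu hqs hT fun t ht => hball (hstay t ht)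
  have h4 := hδZ _ ⟨hmem, hstay T ⟨hT, le_rfl⟩, hTr'⟩
  exact absurd (h4.trans ((h2 T hT).trans hq2)) (not_le.2 hqW.1)

theorem mfderiv_mem_unstableTangent (κ : AdaptedChart V p) (hφ : IsSmoothFlowOf φ V) (y : κ.B.Y) :
    (mfderiv 𝓘(ℝ, κ.B.Coord) (𝓡 n) κ.h 0 ((0, y) : κ.B.Coord) : TangentSpace (𝓡 n) (κ.h 0)) ∈
      unstableTangent φ {p} (κ.h 0) := by
  have hL := κ.linearizing
  have hΦ := κ.B.isLinearFlow_saddle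
  obtain ⟨ρ, hρ, hball⟩ := Metric.mem_nhds_iff.1 (κ.h.open_source.mem_nhds hL.zero_mem)
  set ε := ρ / (‖y‖ + 1) with hε
  have hε0 : 0 < ε := by positivity
  have h00 : (0 : ℝ) • ((0, y) : κ.B.Coord) ∈ κ.h.source := by rw [zero_smul]; exact hL.zero_mem
  refine ⟨fun s => κ.h (s • ((0, y) : κ.B.Coord)), ?_, ?_, ε, hε0, ?_⟩
  · have h1 : ContMDiffAt 𝓘(ℝ, κ.B.Coord) (𝓡 n) 1 κ.h ((0 : ℝ) • ((0, y) : κ.B.Coord)) :=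
      (hL.smooth.contMDiffAt (κ.h.open_source.mem_nhds h00)).of_le (by simp)
    have h2 : ContDiff ℝ 1 fun s : ℝ => s • ((0, y) : κ.B.Coord) := contDiff_id.smul contDiff_const
    exact h1.comp (0 : ℝ) h2.contMDiff.contMDiffAt
  · have h1 : HasDerivAt (fun s : ℝ => s • ((0, y) : κ.B.Coord)) ((0, y) : κ.B.Coord) 0 := by
      simpa using (hasDerivAt_id (0 : ℝ)).smul_const ((0, y) : κ.B.Coord)
    have h2 := (hL.mdifferentiableAt h00).hasMFDerivAt.comp (0 : ℝ) h1.hasFDerivAt.hasMFDerivAt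
    have h3 := congrArg (fun q => (⟨κ.h q, mfderiv 𝓘(ℝ, κ.B.Coord) (𝓡 n) κ.h q
      ((0, y) : κ.B.Coord)⟩ : TangentBundle (𝓡 n) M)) (zero_smul ℝ ((0, y) : κ.B.Coord))
    refine Eq.trans ?_ h3
    refine congrArg (fun w => (⟨κ.h ((0 : ℝ) • ((0, y) : κ.B.Coord)), w⟩ : TangentBundle (𝓡 n) M)) ?_
    refine (DFunLike.congr_fun h2.mfderiv (1 : ℝ)).trans ?_
    refine congrArg (mfderiv 𝓘(ℝ, κ.B.Coord) (𝓡 n) κ.h ((0 : ℝ) • ((0, y) : κ.B.Coord))) ?_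
    exact one_smul ℝ ((0, y) : κ.B.Coord)
  · rw [nhdsSet_singleton]
    have h1 : Tendsto (fun q : ℝ × ℝ => ((0, q.2 • κ.B.unstableFlow q.1 y) : κ.B.Coord))
        (atBot ×ˢ 𝓟 (Ioo (-ε) ε)) (𝓝 0) := by
      have h2 : Tendsto (fun t => ε * ‖κ.B.unstableFlow t y‖) atBot (𝓝 0) := by
        have h3 := ((κ.B.tendsto_unstableFlow_neg y).comp tendsto_neg_atBot_atTop).norm.const_mul ε
        simpa using h3
      refine (tendsto_const_nhds (x := (0 : κ.B.X))).prodMk_nhds (y := (0 : κ.B.Y))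
        (squeeze_zero_norm' ?_ (h2.comp tendsto_fst))
      refine eventually_prod_principal_iff.2 (Eventually.of_forall fun t s hs => ?_)
      rw [norm_smul]
      exact mul_le_mul_of_nonneg_right (abs_lt.2 hs).le (norm_nonneg _)
    have h2 : Tendsto κ.h (𝓝 0) (𝓝 p) := by
      have h3 : Tendsto κ.h (𝓝 0) (𝓝 (κ.h 0)) := κ.h.continuousAt hL.zero_mem
      rwa [hL.map_zero] at h3
    refine (h2.comp h1).congr' ?_
    refine eventually_prod_principal_iff.2 ?_
    filter_upwards [eventually_le_atBot 0] with t ht s hs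
    have h3 : ∀ r, κ.B.saddle.flow r (s • ((0, y) : κ.B.Coord)) =
        ((0, s • κ.B.unstableFlow r y) : κ.B.Coord) := by
      intro r
      rw [map_smul, HyperbolicBlocks.flow_apply_mk, map_zero, Prod.smul_mk, smul_zero]
    have h4 := hL.flow_eq hφ hΦ (q := s • ((0, y) : κ.B.Coord)) (T := t) ?_
    · change κ.h (0, s • κ.B.unstableFlow t y) = φ t (κ.h (s • ((0, y) : κ.B.Coord)))
      rw [h4, h3]
    · intro r hr
      rw [uIcc_of_ge ht] at hr
      refine hball ?_
      rw [h3, mem_ball_zero_iff, Prod.norm_def, norm_zero]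
      refine max_lt hρ ?_
      rw [norm_smul]
      have h5 := κ.B.norm_unstableFlow_neg_le_self (neg_nonneg.2 hr.2) y
      rw [neg_neg] at h5
      calc ‖s‖ * ‖κ.B.unstableFlow r y‖ ≤ ε * ‖y‖ := by
            gcongr
            exact (abs_lt.2 hs).le
        _ < ε * (‖y‖ + 1) := by gcongr; linarith
        _ = ρ := by rw [hε]; field_simp

theorem notMem_wavefrontSet (κ : AdaptedChart V p) (hφ : IsSmoothFlowOf φ V)
    {Ω : Opens κ.B.Coord} (u : Distribution Ω ℂ ⊤)
    (hWF : wavefrontSet u ⊆ κ.unstableConormal φ Ω) {η : κ.B.Y →L[ℝ] ℝ} (hη : η ≠ 0) :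
    ((0 : κ.B.Coord), η.comp (ContinuousLinearMap.snd ℝ κ.B.X κ.B.Y)) ∉ wavefrontSet u := by
  intro h
  obtain ⟨-, -, h1⟩ := hWF h
  exact hη (ContinuousLinearMap.ext fun y => h1 (0, y) (κ.mfderiv_mem_unstableTangent hφ y))

end AdaptedChart

/-! ### Real block form of a diagonalizable matrix -/

section BlockForm

variable {E : Type*} [AddCommGroup E] [Module ℝ E]

/-- The invariant subspace `W` has a basis in which `L` is block-diagonal, with real lines and with
planes whose coefficient is not real. -/
def HasBlocks (L : E →ₗ[ℝ] E) (W : Submodule ℝ E) : Prop :=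
  ∃ (a b : ℕ) (χ : Fin a → ℝ) (κ : Fin b → ℂ) (g : (Fin a → ℝ) × (Fin b → ℂ) →ₗ[ℝ] E),
    (∀ j, (κ j).im ≠ 0) ∧ Function.Injective g ∧ (∀ q, L (g q) = g (blockField χ κ q)) ∧
    LinearMap.range g = W

variable {L : E →ₗ[ℝ] E} {W : Submodule ℝ E}

theorem hasBlocks_bot : HasBlocks L ⊥ := by
  refine ⟨0, 0, finZeroElim, finZeroElim, 0, fun j => j.elim0, fun x y _ => Subsingleton.elim _ _,
    fun q => by simp, by simp⟩

theorem HasBlocks.sup_span_singleton (hW : HasBlocks L W) {v : E} {c : ℝ} (hv : L v = c • v) :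
    HasBlocks L (W ⊔ Submodule.span ℝ {v}) := by
  by_cases hvW : v ∈ W
  · rwa [sup_eq_left.2 ((Submodule.span_singleton_le_iff_mem v W).2 hvW)]
  obtain ⟨a, b, χ, κ, g, hκ, hg, hLg, hgW⟩ := hW
  let T : (Fin (a + 1) → ℝ) × (Fin b → ℂ) →ₗ[ℝ] (Fin a → ℝ) × (Fin b → ℂ) :=
    (LinearMap.funLeft ℝ ℝ Fin.succ).prodMap LinearMap.id
  let Z : (Fin (a + 1) → ℝ) × (Fin b → ℂ) →ₗ[ℝ] ℝ :=
    (LinearMap.proj 0).comp (LinearMap.fst ℝ _ _)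
  refine ⟨a + 1, b, Fin.cons c χ, κ, g.comp T + Z.smulRight v, hκ, ?_, ?_, ?_⟩
  · refine (injective_iff_map_eq_zero _).2 fun q hq => ?_
    have h1 : g (T q) + q.1 0 • v = 0 := hq
    have h2 : q.1 0 = 0 := by
      by_contra hne
      refine hvW ?_
      have h3 : q.1 0 • v ∈ W := by
        rw [← hgW, eq_neg_of_add_eq_zero_right h1]
        exact neg_mem ⟨_, rfl⟩
      exact (Submodule.smul_mem_iff W hne).1 h3
    rw [h2, zero_smul, add_zero] at h1
    have h3 : T q = 0 := hg (by rw [h1, map_zero])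
    have h4 : q.2 = 0 := congrArg (fun r : (Fin a → ℝ) × (Fin b → ℂ) => r.2) h3
    refine Prod.ext (funext fun j => ?_) h4
    refine Fin.cases h2 (fun j => ?_) j
    exact congrFun (congrArg Prod.fst h3) j
  · intro q
    change L (g (T q) + q.1 0 • v) = g (T (blockField (Fin.cons c χ) κ q)) + (c * q.1 0) • v
    rw [map_add, map_smul, hLg, hv, smul_smul, mul_comm c]
    rfl
  · rw [← hgW]
    refine le_antisymm ?_ (sup_le ?_ ?_)
    · rintro _ ⟨q, rfl⟩
      exact Submodule.add_mem_sup ⟨T q, rfl⟩ (Submodule.smul_mem _ _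
        (Submodule.mem_span_singleton_self v))
    · rintro _ ⟨q, rfl⟩
      refine ⟨(Fin.cons 0 q.1, q.2), ?_⟩
      change g ((fun j => (Fin.cons 0 q.1 : Fin (a + 1) → ℝ) (Fin.succ j)), q.2) + (0 : ℝ) • v = g q
      rw [zero_smul, add_zero]
      rfl
    · rw [Submodule.span_singleton_le_iff_mem]
      refine ⟨(Fin.cons 1 0, 0), ?_⟩
      change g 0 + (1 : ℝ) • v = v
      rw [map_zero, zero_add, one_smul]

theorem HasBlocks.sup_range (hW : HasBlocks L W) (f : ℂ →ₗ[ℝ] E) {c : ℂ}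
    (hf : ∀ z, L (f z) = f (c * z)) : HasBlocks L (W ⊔ LinearMap.range f) := by
  by_cases hc : c.im = 0
  -- for a real coefficient the plane is the sum of two (possibly equal or zero) lines
  · have hreal : ∀ z, L (f z) = c.re • f z := fun z => by
      have h1 : c * z = c.re • z := by
        rw [Complex.real_smul]
        congr 1
        exact Complex.ext rfl hc
      rw [hf, h1, map_smul]
    have hr : LinearMap.range f = Submodule.span ℝ {f 1} ⊔ Submodule.span ℝ {f Complex.I} := by
      refine le_antisymm ?_ (sup_le ?_ ?_)
      · rintro _ ⟨z, rfl⟩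
        have hz : z = z.re • (1 : ℂ) + z.im • Complex.I := by
          rw [Complex.real_smul, Complex.real_smul, mul_one, Complex.re_add_im]
        rw [hz, map_add, map_smul, map_smul]
        exact Submodule.add_mem_sup (Submodule.smul_mem _ _ (Submodule.mem_span_singleton_self _))
          (Submodule.smul_mem _ _ (Submodule.mem_span_singleton_self _))
      · exact (Submodule.span_singleton_le_iff_mem _ _).2 ⟨_, rfl⟩
      · exact (Submodule.span_singleton_le_iff_mem _ _).2 ⟨_, rfl⟩
    rw [hr, ← sup_assoc]
    exact (hW.sup_span_singleton (hreal _)).sup_span_singleton (hreal _)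
  obtain ⟨a, b, χ, κ, g, hκ, hg, hLg, hgW⟩ := hW
  by_cases hz : ∃ z ≠ 0, f z ∈ W
  -- `z` and `c z` span the plane over the reals
  · obtain ⟨z₀, hz₀, hzW⟩ := hz
    have hle : LinearMap.range f ≤ W := by
      rintro _ ⟨z, rfl⟩
      have hinv : f (c * z₀) ∈ W := by
        rw [← hf]
        rw [← hgW] at hzW ⊢
        obtain ⟨q, hq⟩ := hzW
        exact ⟨_, by rw [← hq, hLg]⟩
      set w := z / z₀ with hw
      have h1 : z = (w.re - w.im / c.im * c.re) • z₀ + (w.im / c.im) • (c * z₀) := by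
        have h2 : w = ((w.re - w.im / c.im * c.re : ℝ) : ℂ) + ((w.im / c.im : ℝ) : ℂ) * c := by
          apply Complex.ext
          · simp
          · simp only [Complex.add_im, Complex.ofReal_im, Complex.mul_im, Complex.ofReal_re]
            field_simp
            ring
        rw [Complex.real_smul, Complex.real_smul, ← mul_assoc, ← add_mul, ← h2, hw,
          div_mul_cancel₀ _ hz₀]
      rw [h1, map_add, map_smul, map_smul]
      exact W.add_mem (W.smul_mem _ hzW) (W.smul_mem _ hinv)
    rw [sup_eq_left.2 hle]
    exact ⟨a, b, χ, κ, g, hκ, hg, hLg, hgW⟩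
  push Not at hz
  let T : (Fin a → ℝ) × (Fin (b + 1) → ℂ) →ₗ[ℝ] (Fin a → ℝ) × (Fin b → ℂ) :=
    LinearMap.id.prodMap (LinearMap.funLeft ℝ ℂ Fin.succ)
  let Z : (Fin a → ℝ) × (Fin (b + 1) → ℂ) →ₗ[ℝ] ℂ :=
    (LinearMap.proj 0).comp (LinearMap.snd ℝ _ _)
  refine ⟨a, b + 1, χ, Fin.cons c κ, g.comp T + f.comp Z, Fin.cases hc hκ, ?_, ?_, ?_⟩
  · refine (injective_iff_map_eq_zero _).2 fun q hq => ?_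
    have h1 : g (T q) + f (q.2 0) = 0 := hq
    have h2 : q.2 0 = 0 := by
      by_contra hne
      refine hz _ hne ?_
      rw [← hgW, eq_neg_of_add_eq_zero_right h1]
      exact neg_mem ⟨_, rfl⟩
    rw [h2, map_zero, add_zero] at h1
    have h3 : T q = 0 := hg (by rw [h1, map_zero])
    have h4 : q.1 = 0 := congrArg (fun r : (Fin a → ℝ) × (Fin b → ℂ) => r.1) h3
    refine Prod.ext h4 (funext fun j => ?_)
    refine Fin.cases h2 (fun j => ?_) j
    exact congrFun (congrArg Prod.snd h3) j
  · intro q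
    change L (g (T q) + f (q.2 0)) = g (T (blockField χ (Fin.cons c κ) q)) + f (c * q.2 0)
    rw [map_add, hLg, hf]
    rfl
  · rw [← hgW]
    refine le_antisymm ?_ (sup_le ?_ ?_)
    · rintro _ ⟨q, rfl⟩
      exact Submodule.add_mem_sup ⟨T q, rfl⟩ ⟨q.2 0, rfl⟩
    · rintro _ ⟨q, rfl⟩
      refine ⟨(q.1, Fin.cons 0 q.2), ?_⟩
      change g (q.1, (fun j => (Fin.cons 0 q.2 : Fin (b + 1) → ℂ) (Fin.succ j))) + f 0 = g q
      rw [map_zero, add_zero]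
      rfl
    · rintro _ ⟨z, rfl⟩
      refine ⟨(0, Fin.cons z 0), ?_⟩
      change g 0 + f z = f z
      rw [map_zero, zero_add]

/-- A real matrix which is diagonalizable over `ℂ` is conjugate to a block-diagonal one. -/
theorem IsComplexDiagonalizable.exists_blockField {n : ℕ} {A : Matrix (Fin n) (Fin n) ℝ}
    (hA : IsComplexDiagonalizable A) :
    ∃ (a b : ℕ) (χ : Fin a → ℝ) (κ : Fin b → ℂ)
      (e : ((Fin a → ℝ) × (Fin b → ℂ)) ≃ₗ[ℝ] EuclideanSpace ℝ (Fin n)),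
      (∀ j, (κ j).im ≠ 0) ∧ ∀ q, Matrix.toEuclideanLin A (e q) = e (blockField χ κ q) := by
  obtain ⟨P, D, hP, hAP⟩ := hA
  -- the real part of the `i`-th complex eigenline
  let f : Fin n → ℂ →ₗ[ℝ] EuclideanSpace ℝ (Fin n) := fun i =>
    { toFun := fun z => WithLp.toLp 2 fun k => (z * P k i).re
      map_add' := fun z w => by ext k; simp [add_mul]
      map_smul' := fun r z => by ext k; simp [mul_assoc] }
  have hfk : ∀ i z k, f i z k = (z * P k i).re := fun i z k => rfl
  have hf : ∀ i z, Matrix.toEuclideanLin A (f i z) = f i (D i * z) := by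
    intro i z
    ext k
    have h1 := congrFun (congrFun hAP k) i
    rw [Matrix.mul_diagonal, Matrix.mul_apply] at h1
    rw [hfk, mul_assoc, mul_comm, mul_assoc, ← mul_comm (D i), mul_comm (D i), ← h1,
      Finset.mul_sum, Complex.re_sum]
    change ∑ l, A k l * (z * P l i).re = _
    refine Finset.sum_congr rfl fun l _ => ?_
    rw [Matrix.map_apply, Complex.coe_algebraMap, mul_left_comm, Complex.re_ofReal_mul]
  have hs : ∀ s : Finset (Fin n),
      HasBlocks (Matrix.toEuclideanLin A) (s.sup fun i => LinearMap.range (f i)) := by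
    intro s
    induction s using Finset.induction_on with
    | empty => exact hasBlocks_bot
    | insert i s _ ih =>
      rw [Finset.sup_insert, sup_comm]
      exact ih.sup_range (f i) (hf i)
  have htop : (Finset.univ.sup fun i => LinearMap.range (f i)) = ⊤ := by
    refine eq_top_iff.2 fun x _ => ?_
    set c : Fin n → ℂ := Matrix.mulVec P⁻¹ (fun k => (x k : ℂ)) with hc
    have h1 : Matrix.mulVec P c = fun k => (x k : ℂ) := by
      rw [hc, Matrix.mulVec_mulVec, Matrix.mul_nonsing_inv _ hP, Matrix.one_mulVec]
    have h2 : x = ∑ i, f i (c i) := by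
      ext k
      have h3 := congrArg Complex.re (congrFun h1 k)
      rw [Complex.ofReal_re] at h3
      rw [← h3, WithLp.ofLp_sum, Finset.sum_apply]
      change (∑ i, P k i * c i).re = _
      rw [Complex.re_sum]
      exact Finset.sum_congr rfl fun i _ => by rw [hfk, mul_comm]
    rw [h2]
    exact Submodule.sum_mem _ fun i hi =>
      Finset.le_sup (f := fun i => LinearMap.range (f i)) hi ⟨c i, rfl⟩
  obtain ⟨a, b, χ, κ, g, hκ, hg, hLg, hgW⟩ := hs Finset.univ
  exact ⟨a, b, χ, κ, LinearEquiv.ofBijective g ⟨hg, LinearMap.range_eq_top.1 (hgW.trans htop)⟩, hκ,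
    hLg⟩

end BlockForm

section Hyperbolic

variable {n : ℕ} {M : Type*} [TopologicalSpace M] [ChartedSpace (EuclideanSpace ℝ (Fin n)) M]
  {V : (x : M) → TangentSpace (𝓡 n) x} {p : M} {φ : Flow ℝ M}
  {E F : Type*} [NormedAddCommGroup E] [NormedSpace ℝ E] [NormedAddCommGroup F] [NormedSpace ℝ F]
  {A : E →L[ℝ] E}

/-- A linear change of coordinates in a linearizing chart. -/
theorem IsLinearizingChart.comp_linearEquiv {h : OpenPartialHomeomorph E M}
    (hL : IsLinearizingChart V p A h) (e : F ≃L[ℝ] E) {A' : F →L[ℝ] F}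
    (he : ∀ q, A (e q) = e (A' q)) :
    IsLinearizingChart V p A' (e.toHomeomorph.transOpenPartialHomeomorph h) where
  zero_mem := by
    change e 0 ∈ h.source
    rw [_root_.map_zero]; exact hL.zero_mem
  map_zero := by
    change h (e 0) = p
    rw [_root_.map_zero]; exact hL.map_zero
  smooth := hL.smooth.comp e.contDiff.contMDiff.contMDiffOn fun _ h => h
  smooth_symm := e.symm.contDiff.contMDiff.comp_contMDiffOn hL.smooth_symm
  conj q hq := by
    have hq' : e q ∈ h.source := hq
    have h1 := (hL.mdifferentiableAt hq').hasMFDerivAt.comp q e.hasFDerivAt.hasMFDerivAt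
    have h2 : V (h (e q)) = mfderiv 𝓘(ℝ, E) (𝓡 n) h (e q) (A (e q)) := hL.conj _ hq'
    rw [he] at h2
    have h3 : mfderiv 𝓘(ℝ, F) (𝓡 n) (e.toHomeomorph.transOpenPartialHomeomorph h) q = _ :=
      h1.mfderiv
    rw [h3]
    exact h2

/-- The linear flow at a hyperbolic fixed point has no periodic vector except zero. -/
theorem IsLinearizingChart.eq_zero_of_flow_eq_self [T2Space M] {h : OpenPartialHomeomorph E M}
    (hL : IsLinearizingChart V p A h) (hφ : IsSmoothFlowOf φ V) (hp : IsFixedPointOf φ p)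
    (hhyp : IsHyperbolicElement n φ {p}) {Φ : ℝ → E →L[ℝ] E} (hΦ : IsLinearFlow A Φ) {T : ℝ}
    (hT : 0 < T) {w : E} (hw : Φ T w = w) : w = 0 := by
  by_contra hw0
  obtain rfl := hL.map_zero
  have h1 : ∀ᶠ s in 𝓝 (0 : ℝ), ∀ t ∈ Icc 0 T, Φ t (s • w) ∈ h.source := by
    refine isCompact_Icc.eventually_forall_of_forall_eventually fun t _ => ?_
    have hc : Continuous fun z : ℝ × ℝ => Φ z.2 (z.1 • w) :=
      hΦ.continuous.comp (continuous_snd.prodMk (continuous_fst.smul continuous_const))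
    refine hc.continuousAt.eventually_mem (h.open_source.mem_nhds ?_)
    simpa using hL.zero_mem
  have h2 : (φ T) ∘ (fun s : ℝ => h (s • w)) =ᶠ[𝓝 0] fun s => h (s • w) := by
    filter_upwards [h1] with s hs
    have := hL.flow_eq hφ hΦ (q := s • w) (T := T) (by rwa [uIcc_of_le hT.le])
    rw [map_smul, hw] at this
    exact this
  have key : ∀ q₀ : E, q₀ = (0 : ℝ) • w → q₀ ∈ h.source →
      (mfderiv (𝓡 n) (𝓡 n) (φ T) (h q₀) (mfderiv 𝓘(ℝ, E) (𝓡 n) h q₀ w) :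
        EuclideanSpace ℝ (Fin n)) = mfderiv 𝓘(ℝ, E) (𝓡 n) h q₀ w := by
    rintro q₀ rfl hq₀
    have h3 : HasDerivAt (fun s : ℝ => s • w) w 0 := by
      simpa using (hasDerivAt_id (0 : ℝ)).smul_const w
    have h4 := (hL.mdifferentiableAt hq₀).hasMFDerivAt.comp (0 : ℝ) h3.hasFDerivAt.hasMFDerivAt
    have h5 := ((hφ.contMDiff T).mdifferentiable (by simp)
      (h ((0 : ℝ) • w))).hasMFDerivAt.comp (0 : ℝ) h4
    have h6 := DFunLike.congr_fun (hasMFDerivAt_unique h5 (h4.congr_of_eventuallyEq h2)) (1 : ℝ)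
    have h7 : ((ContinuousLinearMap.toSpanSingleton ℝ w) (1 : ℝ) : E) = w := one_smul ℝ w
    have h8 : ∀ w' : E, w' = w → (mfderiv (𝓡 n) (𝓡 n) (φ T) (h ((0 : ℝ) • w))
        (mfderiv 𝓘(ℝ, E) (𝓡 n) h ((0 : ℝ) • w) w') : EuclideanSpace ℝ (Fin n)) =
        mfderiv 𝓘(ℝ, E) (𝓡 n) h ((0 : ℝ) • w) w' →
        (mfderiv (𝓡 n) (𝓡 n) (φ T) (h ((0 : ℝ) • w))
        (mfderiv 𝓘(ℝ, E) (𝓡 n) h ((0 : ℝ) • w) w) : EuclideanSpace ℝ (Fin n)) =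
        mfderiv 𝓘(ℝ, E) (𝓡 n) h ((0 : ℝ) • w) w := by
      rintro _ rfl h; exact h
    exact h8 _ h7 h6
  have h9 := key 0 (zero_smul ℝ w).symm hL.zero_mem
  set v : EuclideanSpace ℝ (Fin n) := mfderiv 𝓘(ℝ, E) (𝓡 n) h 0 w with hv
  have hv0 : v ≠ 0 := fun hv0 => hw0 ((hL.bijective_mfderiv hL.zero_mem).1
    (hv0.trans (mfderiv 𝓘(ℝ, E) (𝓡 n) h 0).map_zero.symm))
  have hu := (hhyp (h 0) rfl T hT (hp T)).1 hp
  let D : EuclideanSpace ℝ (Fin n) →L[ℝ] EuclideanSpace ℝ (Fin n) :=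
    mfderiv (𝓡 n) (𝓡 n) (φ T) (h 0)
  have hev : Module.End.HasEigenvalue D.toLinearMap (1 : ℝ) :=
    Module.End.hasEigenvalue_of_hasEigenvector (x := v)
      ⟨Module.End.mem_eigenspace_iff.2 (h9.trans (one_smul ℝ v).symm), hv0⟩
  have hroot := (Module.End.hasEigenvalue_iff_isRoot_charpoly _ _).1 hev
  have hmem : (1 : ℂ) ∈ unitModulusEigenvalues (n := n) φ T (h 0) := by
    refine Multiset.mem_filter.2 ⟨?_, norm_one⟩
    refine (Polynomial.mem_roots (D.toLinearMap.charpoly_monic.map _).ne_zero).2 ?_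
    have := hroot.map (f := algebraMap ℝ ℂ)
    rwa [map_one] at this
  rw [hu] at hmem
  exact absurd hmem (Multiset.notMem_zero _)

end Hyperbolic

/-! ### Existence of adapted coordinates -/

theorem exists_equiv_sum_fin_neg_pos {a : ℕ} {f : Fin a → ℝ} (hf : ∀ j, f j ≠ 0) :
    ∃ (k l : ℕ) (σ : Fin k ⊕ Fin l ≃ Fin a),
      (∀ i, f (σ (Sum.inl i)) < 0) ∧ ∀ i, 0 < f (σ (Sum.inr i)) := by
  classical
  let e1 := Fintype.equivFin {j // f j < 0}
  let e2 := Fintype.equivFin {j // ¬ f j < 0}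
  refine ⟨_, _, (Equiv.sumCongr e1.symm e2.symm).trans (Equiv.sumCompl fun j => f j < 0),
    fun i => ?_, fun i => ?_⟩
  · exact (e1.symm i).2
  · exact lt_of_le_of_ne (not_lt.1 (e2.symm i).2) (hf _).symm

section Reorder

variable {a b k l r s : ℕ} (σ : Fin k ⊕ Fin l ≃ Fin a) (τ : Fin r ⊕ Fin s ≃ Fin b)

/-- Sorting the blocks into two groups. -/
def blockReorder : (((Fin k → ℝ) × (Fin r → ℂ)) × ((Fin l → ℝ) × (Fin s → ℂ))) ≃ₗ[ℝ]
    (Fin a → ℝ) × (Fin b → ℂ) where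
  toFun q := (fun i => Sum.elim q.1.1 q.2.1 (σ.symm i), fun i => Sum.elim q.1.2 q.2.2 (τ.symm i))
  invFun p := ((fun i => p.1 (σ (Sum.inl i)), fun i => p.2 (τ (Sum.inl i))),
    (fun i => p.1 (σ (Sum.inr i)), fun i => p.2 (τ (Sum.inr i))))
  left_inv q := by simp
  right_inv p := by
    refine Prod.ext (funext fun i => ?_) (funext fun i => ?_)
    · obtain ⟨j, rfl⟩ := σ.surjective i
      rcases j with j | j <;> simp
    · obtain ⟨j, rfl⟩ := τ.surjective i
      rcases j with j | j <;> simp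
  map_add' q q' := by
    refine Prod.ext (funext fun i => ?_) (funext fun i => ?_)
    · obtain ⟨j, rfl⟩ := σ.surjective i
      rcases j with j | j <;> simp
    · obtain ⟨j, rfl⟩ := τ.surjective i
      rcases j with j | j <;> simp
  map_smul' c q := by
    refine Prod.ext (funext fun i => ?_) (funext fun i => ?_)
    · obtain ⟨j, rfl⟩ := σ.surjective i
      rcases j with j | j <;> simp
    · obtain ⟨j, rfl⟩ := τ.surjective i
      rcases j with j | j <;> simp

theorem blockField_blockReorder (χ : Fin a → ℝ) (κ : Fin b → ℂ)
    (q : ((Fin k → ℝ) × (Fin r → ℂ)) × ((Fin l → ℝ) × (Fin s → ℂ))) :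
    blockField χ κ (blockReorder σ τ q) = blockReorder σ τ
      ((blockField (fun i => χ (σ (Sum.inl i))) (fun i => κ (τ (Sum.inl i)))).prodMap
        (blockField (fun i => χ (σ (Sum.inr i))) (fun i => κ (τ (Sum.inr i)))) q) := by
  refine Prod.ext (funext fun i => ?_) (funext fun i => ?_)
  · obtain ⟨j, rfl⟩ := σ.surjective i
    rcases j with j | j <;> simp [blockReorder, blockField]
  · obtain ⟨j, rfl⟩ := τ.surjective i
    rcases j with j | j <;> simp [blockReorder, blockField]

end Reorder

section Existence

variable {n : ℕ} {M : Type*} [TopologicalSpace M] [ChartedSpace (EuclideanSpace ℝ (Fin n)) M]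
  {V : (x : M) → TangentSpace (𝓡 n) x} {p : M} {φ : Flow ℝ M}

/-- At a hyperbolic fixed point the blocks of a linearizing chart are hyperbolic: a zero or purely
imaginary coefficient would give a periodic vector of the linear flow. -/
theorem IsLinearizingChart.re_ne_zero_of_blockField [T2Space M] {a b : ℕ} {χ : Fin a → ℝ}
    {κ : Fin b → ℂ} {h : OpenPartialHomeomorph ((Fin a → ℝ) × (Fin b → ℂ)) M}
    (hL : IsLinearizingChart V p (blockField χ κ) h) (hφ : IsSmoothFlowOf φ V)
    (hp : IsFixedPointOf φ p) (hhyp : IsHyperbolicElement n φ {p}) (hκ : ∀ j, (κ j).im ≠ 0) :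
    (∀ j, χ j ≠ 0) ∧ ∀ j, (κ j).re ≠ 0 := by
  classical
  have hΦ := isLinearFlow_blockFlow χ κ
  refine ⟨fun j hj => ?_, fun j hj => ?_⟩
  · have h1 : ((Pi.single j 1, 0) : (Fin a → ℝ) × (Fin b → ℂ)) = 0 := by
      refine hL.eq_zero_of_flow_eq_self hφ hp hhyp hΦ one_pos (Prod.ext (funext fun i => ?_) ?_)
      · rw [blockFlow_fst]
        rcases eq_or_ne i j with rfl | hij
        · rw [hj, mul_zero, Real.exp_zero, one_mul]
        · change _ * (Pi.single j (1 : ℝ) : Fin a → ℝ) i = (Pi.single j (1 : ℝ) : Fin a → ℝ) i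
          rw [Pi.single_eq_of_ne hij, mul_zero]
      · exact funext fun i => mul_zero _
    have h2 : (Pi.single j (1 : ℝ) : Fin a → ℝ) j = 0 := congrFun (congrArg Prod.fst h1) j
    simp at h2
  · have hT : 0 < 2 * Real.pi / |(κ j).im| :=
      div_pos Real.two_pi_pos (abs_pos.2 (hκ j))
    have h1 : ((0, Pi.single j 1) : (Fin a → ℝ) × (Fin b → ℂ)) = 0 := by
      refine hL.eq_zero_of_flow_eq_self hφ hp hhyp hΦ hT (Prod.ext ?_ (funext fun i => ?_))
      · exact funext fun i => mul_zero _
      · rw [blockFlow_snd]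
        rcases eq_or_ne i j with rfl | hij
        · have h3 : κ i = (κ i).im * Complex.I := by
            apply Complex.ext <;> simp [hj]
          have h4 : Complex.exp ((2 * Real.pi / |(κ i).im| : ℝ) * κ i) = 1 := by
            rcases lt_or_gt_of_ne (hκ i) with hneg | hpos
            · rw [Complex.exp_eq_one_iff]
              refine ⟨-1, ?_⟩
              rw [h3, abs_of_neg (by simpa using hneg)]
              have h5 : ((κ i).im : ℂ) ≠ 0 := by exact_mod_cast hκ i
              simp only [Complex.mul_im, Complex.ofReal_re, Complex.I_im, Complex.ofReal_im,
                Complex.I_re, mul_one, mul_zero, add_zero]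
              push_cast
              field_simp
            · rw [Complex.exp_eq_one_iff]
              refine ⟨1, ?_⟩
              rw [h3, abs_of_pos (by simpa using hpos)]
              have h5 : ((κ i).im : ℂ) ≠ 0 := by exact_mod_cast hκ i
              simp only [Complex.mul_im, Complex.ofReal_re, Complex.I_im, Complex.ofReal_im,
                Complex.I_re, mul_one, mul_zero, add_zero]
              push_cast
              field_simp
          rw [h4, one_mul]
        · change _ * (Pi.single j (1 : ℂ) : Fin b → ℂ) i = (Pi.single j (1 : ℂ) : Fin b → ℂ) i
          rw [Pi.single_eq_of_ne hij, mul_zero]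
    have h2 : (Pi.single j (1 : ℂ) : Fin b → ℂ) j = 0 := congrFun (congrArg Prod.snd h1) j
    simp at h2

theorem nonempty_adaptedChart [T2Space M] (hφ : IsSmoothFlowOf φ V) (hp : IsFixedPointOf φ p)
    (hhyp : IsHyperbolicElement n φ {p}) (hdiag : IsSmoothlyDiagonalizableAt V p) :
    Nonempty (AdaptedChart V p) := by
  obtain ⟨A, h, hA, hL⟩ := hdiag
  obtain ⟨a, b, χ, κ, e, hκ, he⟩ := hA.exists_blockField
  have hL' := hL.comp_linearEquiv e.toContinuousLinearEquiv (A' := blockField χ κ) he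
  obtain ⟨hχ0, hκ0⟩ := hL'.re_ne_zero_of_blockField hφ hp hhyp hκ
  obtain ⟨k, l, σ, hσ1, hσ2⟩ := exists_equiv_sum_fin_neg_pos hχ0
  obtain ⟨r, s, τ, hτ1, hτ2⟩ := exists_equiv_sum_fin_neg_pos hκ0
  let B : HyperbolicBlocks :=
    { a := k, b := r, c := l, d := s
      χLs := fun i => χ (σ (Sum.inl i))
      χPs := fun i => (κ (τ (Sum.inl i))).re
      omPs := fun i => -(κ (τ (Sum.inl i))).im
      χLu := fun i => χ (σ (Sum.inr i))
      χPu := fun i => (κ (τ (Sum.inr i))).re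
      omPu := fun i => -(κ (τ (Sum.inr i))).im
      χLs_neg := hσ1
      χPs_neg := hτ1
      omPs_ne := fun i => neg_ne_zero.2 (hκ _)
      χLu_pos := hσ2
      χPu_pos := hτ2
      omPu_ne := fun i => neg_ne_zero.2 (hκ _) }
  have hs : B.stableCoeff = fun i => κ (τ (Sum.inl i)) := by
    funext i
    apply Complex.ext <;> simp [HyperbolicBlocks.stableCoeff, B]
  have hu : B.unstableCoeff = fun i => κ (τ (Sum.inr i)) := by
    funext i
    apply Complex.ext <;> simp [HyperbolicBlocks.unstableCoeff, B]
  have hB : ∀ q, blockField χ κ (blockReorder σ τ q) = blockReorder σ τ (B.linearField q) := by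
    intro q
    rw [B.linearField_eq, hs, hu]
    exact blockField_blockReorder σ τ χ κ q
  exact ⟨⟨B, _, hL'.comp_linearEquiv (blockReorder σ τ).toContinuousLinearEquiv
    (A' := B.linearField) hB⟩⟩

end Existence

end

theorem theoremt {n : ℕ} {M : Type*} [TopologicalSpace M] [T2Space M] [CompactSpace M]
    [ChartedSpace (EuclideanSpace ℝ (Fin n)) M] [IsManifold (𝓡 n) ∞ M]
    (V : (x : M) → TangentSpace (𝓡 n) x) (φ : Flow ℝ M) (hφ : IsSmoothFlowOf φ V)
    (hMS : IsMorseSmale n φ)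
    (p : M) (hp : IsFixedPointOf φ p) (hdiag : IsSmoothlyDiagonalizableAt V p) :
    Nonempty (AdaptedChart V p) ∧
    ∀ (κ : AdaptedChart V p) (Ω : Opens κ.B.Coord), (0 : κ.B.Coord) ∈ Ω →
      (Ω : Set κ.B.Coord) ⊆ κ.h.source →
      ∀ (u : Distribution Ω ℂ ⊤) (μ : ℂ) (m : ℕ), 1 ≤ m →
        (κ.lieShift μ)^[m] u = 0 →
        Distribution.dsupport u ∩ Ω ⊆ κ.h ⁻¹' (unstableManifold φ {p}) →
        wavefrontSet u ⊆ κ.unstableConormal φ Ω →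
        (0 : κ.B.Coord) ∈ Distribution.dsupport u →
        μ ∈ κ.B.resonanceSet ∧
        ∃ c : κ.B.MultiIndex →₀ ℂ, (∀ α ∈ c.support, HyperbolicBlocks.resonance α = μ) ∧
          ∃ Ω' : Opens κ.B.Coord, (0 : κ.B.Coord) ∈ Ω' ∧ Ω' ≤ Ω ∧
            ∀ ψ : TestFunction Ω ℝ ⊤, tsupport ψ ⊆ Ω' →
              u ψ = (c.sum fun α z => z * HyperbolicBlocks.model Ω α ψ) ∧
              κ.lieShift μ u ψ = 0 := by
  refine ⟨nonempty_adaptedChart hφ hp (hMS.fixedPoint hp).1 hdiag, ?_⟩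
  intro κ Ω h0 hsub u μ m _ hu hsupp hWF h0u
  obtain ⟨W, hW, hsupp'⟩ := κ.exists_nhds_ev_eq_zero hφ hMS hp h0 hsub u μ m hu hsupp
  exact HyperbolicBlocks.exists_model_expansion κ.B u h0 μ m hu hW hsupp'
    (fun η hη => κ.notMem_wavefrontSet hφ u hWF hη) h0u
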